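/- Let $K$ be a field of characteristic $0$ and let $H$ be a Hopf algebra over $K$ (antipode $S$) with an ad-invariant integral $\lambda\in H^*$, i.e. $\lambda(1)=1$, $h_{(1)}\lambda(h_{(2)})=\lambda(h)1_H=\lambda(h_{(1)})h_{(2)}$, and $\lambda(h_{(1)}xS(h_{(2)}))=\varepsilon(h)\lambda(x)=\lambda(S(h_{(1)})xh_{(2)})$ for all $h,x\in H$. Let ${}^H_H\mathcal{YD}$ be the braided monoidal category of left-left Yetter–Drinfeld modules over $H$, with $\rho(hv)=h_{(1)}v_{\langle-1\rangle}S(h_{(3)})\otimes h_{(2)}v_{\langle0\rangle}$, diagonal action and coaction on tensor products, and braiding $c(v\otimes w)=v_{\langle-1\rangle}w\otimes v_{\langle0\rangle}$. For coalgebras $C,D$ in ${}^H_H\mathcal{YD}$, $C\otimes D$ is a coalgebra via $\Delta_{C\otimes D}=(C\otimes c\otimes D)(\Delta_C\otimes\Delta_D)$, $\varepsilon_{C\otimes D}=\varepsilon_C\otimes\varepsilon_D$; $*$ denotes convolution. A pre-bialgebra $(R,m,u,\Delta,\varepsilon)$ in ${}^H_H\mathcal{YD}$ is a coalgebra $(R,\Delta,\varepsilon)$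 in ${}^H_H\mathcal{YD}$ with a coalgebra homomorphism $u:K\to R$ in ${}^H_H\mathcal{YD}$ (write $1_R=u(1)$) and a left $H$-linear coalgebra homomorphism $m:R\otimes R\to R$ having $1_R$ as two-sided unit. It is connected if the coradical of $R$ (the sum of its simple subcoalgebras) is $K1_R$. A cocycle for it is a linear map $\xi:R\otimes R\to H$ such that, for all $z\in R\otimes R$, $r,t\in R$, $h\in H$ (with $z^{(1)}\otimes z^{(2)}=\Delta_{R\otimes R}(z)$): 1. $\xi(hz)=h_{(1)}\xi(z)S(h_{(2)})$; 2. $\Delta_H\xi(z)=\xi(z^{(1)})z^{(2)}_{\langle-1\rangle}\otimes\xi(z^{(2)}_{\langle0\rangle})$ and $\varepsilon_H\xi=\varepsilon_{R\otimes R}$; 3. $m(z^{(1)})_{\langle-1\rangle}\xi(z^{(2)})\otimes m(z^{(1)})_{\langle0\rangle}=\xi(z^{(1)})z^{(2)}_{\langle-1\rangle}\otimes m(z^{(2)}_{\langle0\rangle})$; 4. $m(R\otimes m)(z\otimes t)=m\bigl(m(z^{(1)})\otimes\xi(z^{(2)})t\bigr)$; 5. $m_H(\xi\otimes H)\bigl[R\otimes(m\otimes\xi)\Delta_{R\otimes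 R}\bigr](z\otimes t)=\xi\bigl(m(z^{(1)})\otimes\xi(z^{(2)})_{(1)}t\bigr)\,\xi(z^{(2)})_{(2)}$; 6. $\xi(r\otimes1_R)=\xi(1_R\otimes r)=\varepsilon(r)1_H$. Given such $(R,\xi)$, let $A=R\#_\xi H$ be $R\otimes H$ with $$\Delta_A(r\#h)=(r^{(1)}\#r^{(2)}_{\langle-1\rangle}h_{(1)})\otimes(r^{(2)}_{\langle0\rangle}\#h_{(2)}),\qquad \varepsilon_A(r\#h)=\varepsilon(r)\varepsilon(h),$$ $$m_A(r\#h\otimes s\#l)=m\bigl(r^{(1)}\otimes r^{(2)}_{\langle-1\rangle}h_{(1)}s^{(1)}\bigr)\#\xi\bigl(r^{(2)}_{\langle0\rangle}\otimes h_{(2)}s^{(2)}\bigr)h_{(3)}l .$$ For a convolution invertible $v:R\otimes R\to K$ put $v_A(r\#h\otimes s\#l)=v(r\otimes hs)\varepsilon(l)$ and, if $v_A$ is convolution invertible on the usual tensor product coalgebra $A\otimes A$, let $\partial^2_R(v):R^{\otimes3}\to K$ be the map $$\partial_R^2(v)(r\otimes s\otimes t)=\partial^2_A(v_A)(r\#1\otimes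 s\#1\otimes t\#1),$$ $$\partial_A^2(w)=(\varepsilon_A\otimes w)*w(A\otimes m_A)*w^{-1}(m_A\otimes A)*(w^{-1}\otimes\varepsilon_A),$$ where the convolution is that of the usual tensor product coalgebra $A^{\otimes 3}$. Put also $m^v=v*m*v^{-1}$. A dual quasi-bialgebra $(Q,m,u,\Delta,\varepsilon,\alpha)$ in ${}^H_H\mathcal{YD}$ is a coalgebra $(Q,\Delta,\varepsilon)$ in ${}^H_H\mathcal{YD}$ with coalgebra homomorphisms $m:Q\otimes Q\to Q$ and $u:K\to Q$ in ${}^H_H\mathcal{YD}$ and a convolution invertible morphism $\alpha:Q^{\otimes3}\to K$ in ${}^H_H\mathcal{YD}$ such that $$\alpha(Q\otimes Q\otimes m)*\alpha(m\otimes Q\otimes Q)=(\varepsilon\otimes\alpha)*\alpha(Q\otimes m\otimes Q)*(\alpha\otimes\varepsilon),$$ $$\alpha(Q\otimes u\otimes Q)=\alpha(u\otimes Q\otimes Q)=\alpha(Q\otimes Q\otimes u)=\varepsilon_{Q\otimes Q},$$ $$m(Q\otimes m)*\alpha=\alpha*m(m\otimes Q),\qquad m(u\otimes Q)=\mathrm{Id}_Q=m(Q\otimes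 u).$$ **Proposition.** Let $(R,\xi)$ be a connected pre-bialgebra with cocycle in ${}^H_H\mathcal{YD}$. Then $\lambda\xi:R\otimes R\to K$ is convolution invertible and, for $v:=(\lambda\xi)^{-1}$, $v_A$ is convolution invertible and $R^v=(R,m^v,u,\Delta,\varepsilon,\partial^2_R(v))$ is a connected dual quasi-bialgebra in ${}^H_H\mathcal{YD}$. In particular, $\partial^2_R(v)$ satisfies the 3-cocycle condition (the first displayed identity above, with $m=m^v$ and $\alpha=\partial^2_R(v)$). -/

import Mathlib

noncomputable section

open scoped TensorProduct

namespace YD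

/-! ### Linear algebra of tensor products and convolution

All comultiplications are passed explicitly, because `R ⊗ R` carries the braided comultiplication,
which is not the one of Mathlib's instance on a tensor product. -/

section Convolution

variable {K : Type*} [Field K]
variable {A B B' C C' D E M : Type*}
  [AddCommGroup A] [Module K A] [AddCommGroup B] [Module K B] [AddCommGroup B'] [Module K B']
  [AddCommGroup C] [Module K C] [AddCommGroup C'] [Module K C'] [AddCommGroup D] [Module K D]
  [AddCommGroup E] [Module K E] [AddCommGroup M] [Module K M]

/-- The map `A ⊗ c ⊗ D : (A ⊗ B) ⊗ (C ⊗ D) → (A ⊗ C') ⊗ (B' ⊗ D)` for `c : B ⊗ C → C' ⊗ B'`. -/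
def middle (A : Type*) [AddCommGroup A] [Module K A] (D : Type*) [AddCommGroup D] [Module K D]
    (c : B ⊗[K] C →ₗ[K] C' ⊗[K] B') :
    (A ⊗[K] B) ⊗[K] (C ⊗[K] D) →ₗ[K] (A ⊗[K] C') ⊗[K] (B' ⊗[K] D) :=
  (TensorProduct.assoc K A C' (B' ⊗[K] D)).symm.toLinearMap ∘ₗ
    LinearMap.lTensor A
      ((TensorProduct.assoc K C' B' D).toLinearMap ∘ₗ LinearMap.rTensor D c ∘ₗ
        (TensorProduct.assoc K B C D).symm.toLinearMap) ∘ₗ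
    (TensorProduct.assoc K A B (C ⊗[K] D)).toLinearMap

/-- The comultiplication `(C ⊗ c ⊗ D) (Δ_C ⊗ Δ_D)` on `C ⊗ D`. -/
def tensorComul (c : C ⊗[K] D →ₗ[K] D ⊗[K] C) (ΔC : C →ₗ[K] C ⊗[K] C) (ΔD : D →ₗ[K] D ⊗[K] D) :
    C ⊗[K] D →ₗ[K] (C ⊗[K] D) ⊗[K] (C ⊗[K] D) :=
  middle C D c ∘ₗ TensorProduct.map ΔC ΔD

/-- The functional `m_K (f ⊗ g)` on `C ⊗ D`. -/
def tensorFun (f : C →ₗ[K] K) (g : D →ₗ[K] K) : C ⊗[K] D →ₗ[K] K :=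
  LinearMap.mul' K K ∘ₗ TensorProduct.map f g

/-- The convolution product of functionals, `(f * g)(x) = f(x₁) g(x₂)`. -/
def conv (Δ : C →ₗ[K] C ⊗[K] C) (f g : C →ₗ[K] K) : C →ₗ[K] K :=
  tensorFun f g ∘ₗ Δ

/-- `(v * f)(x) = v(x₁) f(x₂)` for a functional `v` and a map `f` to a vector space. -/
def convLeft (Δ : C →ₗ[K] C ⊗[K] C) (v : C →ₗ[K] K) (f : C →ₗ[K] M) : C →ₗ[K] M :=
  (TensorProduct.lid K M).toLinearMap ∘ₗ TensorProduct.map v f ∘ₗ Δ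

/-- `(f * v)(x) = f(x₁) v(x₂)` for a functional `v` and a map `f` to a vector space. -/
def convRight (Δ : C →ₗ[K] C ⊗[K] C) (f : C →ₗ[K] M) (v : C →ₗ[K] K) : C →ₗ[K] M :=
  (TensorProduct.rid K M).toLinearMap ∘ₗ TensorProduct.map f v ∘ₗ Δ

/-- `g` is a two-sided convolution inverse of `f`, for the comultiplication `Δ` and counit `ε`. -/
def IsConvInverse (Δ : C →ₗ[K] C ⊗[K] C) (ε f g : C →ₗ[K] K) : Prop :=
  conv Δ f g = ε ∧ conv Δ g f = ε

/-- Convolution invertibility of a functional. -/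
def IsConvInvertible (Δ : C →ₗ[K] C ⊗[K] C) (ε f : C →ₗ[K] K) : Prop :=
  ∃ g, IsConvInverse Δ ε f g

open Classical in
/-- The convolution inverse of `f` (with the value `0` when `f` is not invertible). -/
def convInv (Δ : C →ₗ[K] C ⊗[K] C) (ε f : C →ₗ[K] K) : C →ₗ[K] K :=
  if h : IsConvInvertible Δ ε f then h.choose else 0

/-- `E ⊗ m : E ⊗ (E ⊗ E) → E ⊗ E`. -/
def idMul (m : E ⊗[K] E →ₗ[K] E) : E ⊗[K] (E ⊗[K] E) →ₗ[K] E ⊗[K] E :=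
  LinearMap.lTensor E m

/-- `m ⊗ E : E ⊗ (E ⊗ E) → E ⊗ E`. -/
def mulId (m : E ⊗[K] E →ₗ[K] E) : E ⊗[K] (E ⊗[K] E) →ₗ[K] E ⊗[K] E :=
  LinearMap.rTensor E m ∘ₗ (TensorProduct.assoc K E E E).symm.toLinearMap

/-- `m_K (w ⊗ ε)` on `E ⊗ (E ⊗ E)`, for a functional `w` on `E ⊗ E`. -/
def tensorCounit (w : E ⊗[K] E →ₗ[K] K) (ε : E →ₗ[K] K) : E ⊗[K] (E ⊗[K] E) →ₗ[K] K :=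
  tensorFun w ε ∘ₗ (TensorProduct.assoc K E E E).symm.toLinearMap

/-- `m_K (α ⊗ ε)` on `E ⊗ (E ⊗ (E ⊗ E))`, for a functional `α` on `E ⊗ (E ⊗ E)`. -/
def tensorCounit₃ (α : E ⊗[K] (E ⊗[K] E) →ₗ[K] K) (ε : E →ₗ[K] K) :
    E ⊗[K] (E ⊗[K] (E ⊗[K] E)) →ₗ[K] K :=
  tensorFun α ε ∘ₗ (TensorProduct.assoc K E (E ⊗[K] E) E).symm.toLinearMap ∘ₗ
    LinearMap.lTensor E (TensorProduct.assoc K E E E).symm.toLinearMap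

/-- The usual comultiplication on the tensor product of two ordinary coalgebras. -/
def usualComul (ΔC : C →ₗ[K] C ⊗[K] C) (ΔD : D →ₗ[K] D ⊗[K] D) :
    C ⊗[K] D →ₗ[K] (C ⊗[K] D) ⊗[K] (C ⊗[K] D) :=
  tensorComul (TensorProduct.comm K C D).toLinearMap ΔC ΔD

/-- For an ordinary coalgebra `(E, Δ, ε)` with multiplication `m`, the map
`∂²(w) = [(ε ⊗ w) * w(E ⊗ m)] * [w⁻¹(m ⊗ E) * (w⁻¹ ⊗ ε)]` on convolution invertible functionals
`w` of `E ⊗ E`. -/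
def coboundary₂ (Δ : E →ₗ[K] E ⊗[K] E) (ε : E →ₗ[K] K) (m : E ⊗[K] E →ₗ[K] E)
    (w : E ⊗[K] E →ₗ[K] K) : E ⊗[K] (E ⊗[K] E) →ₗ[K] K :=
  let Δ₃ := usualComul Δ (usualComul Δ Δ)
  let w' := convInv (usualComul Δ Δ) (tensorFun ε ε) w
  conv Δ₃ (conv Δ₃ (tensorFun ε w) (w ∘ₗ idMul m)) (conv Δ₃ (w' ∘ₗ mulId m) (tensorCounit w' ε))

end Convolution

/-! ### Coradical and connectedness -/

section Coradical

variable {K : Type*} [Field K] {C : Type*} [AddCommGroup C] [Module K C]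

/-- `Δ(D) ⊆ D ⊗ D`. -/
def IsSubcoalgebra (Δ : C →ₗ[K] C ⊗[K] C) (D : Submodule K C) : Prop :=
  ∀ x ∈ D, Δ x ∈ LinearMap.range (TensorProduct.map D.subtype D.subtype)

/-- A nonzero subcoalgebra without proper nonzero subcoalgebras. -/
def IsSimpleSubcoalgebra (Δ : C →ₗ[K] C ⊗[K] C) (D : Submodule K C) : Prop :=
  IsSubcoalgebra Δ D ∧ D ≠ ⊥ ∧ ∀ D' ≤ D, IsSubcoalgebra Δ D' → D' = ⊥ ∨ D' = D

/-- The coradical: the sum of all simple subcoalgebras. -/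
def coradical (Δ : C →ₗ[K] C ⊗[K] C) : Submodule K C :=
  sSup {D | IsSimpleSubcoalgebra Δ D}

/-- A coaugmented coalgebra is connected when its coradical is `K 1_C`. -/
def IsConnectedCoalgebra (Δ : C →ₗ[K] C ⊗[K] C) (u : K →ₗ[K] C) : Prop :=
  coradical Δ = Submodule.span K {u 1}

end Coradical

/-! ### Hopf algebras with an ad-invariant integral -/

section Hopf

variable (K : Type*) [Field K] (H : Type*) [Ring H] [HopfAlgebra K H]

/-- The linear map `x ⊗ y ↦ (z ↦ x z y)`. -/
def sandwich : H ⊗[K] H →ₗ[K] H →ₗ[K] H :=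
  TensorProduct.lift
    ((LinearMap.mul K (Module.End K H)).compl₁₂ (LinearMap.mul K H) (LinearMap.mul K H).flip)

/-- The left adjoint action `h ⇀ x = h₁ x S(h₂)`. -/
def leftAdjoint : H →ₗ[K] H →ₗ[K] H :=
  sandwich K H ∘ₗ LinearMap.lTensor H (HopfAlgebra.antipode K) ∘ₗ
    Coalgebra.comul

/-- The right adjoint action `x ↼ h = S(h₁) x h₂`, as a function of `h` and then `x`. -/
def rightAdjoint : H →ₗ[K] H →ₗ[K] H :=
  sandwich K H ∘ₗ LinearMap.rTensor H (HopfAlgebra.antipode K) ∘ₗ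
    Coalgebra.comul

variable {K H}

/-- A left and right integral `l ∈ H*` with `l(1) = 1`, invariant under both adjoint actions. -/
structure IsAdInvariantIntegral (l : H →ₗ[K] K) : Prop where
  left_integral : ∀ h, LinearMap.lTensor H l (Coalgebra.comul h) = 1 ⊗ₜ[K] l h
  right_integral : ∀ h, LinearMap.rTensor H l (Coalgebra.comul h) = l h ⊗ₜ[K] 1
  map_one : l 1 = 1
  left_adjoint : ∀ h x, l (leftAdjoint K H h x) = Coalgebra.counit (R := K) h * l x
  right_adjoint : ∀ h x, l (rightAdjoint K H h x) = Coalgebra.counit (R := K) h * l x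

end Hopf

/-! ### Coalgebras in the category of left-left Yetter-Drinfeld modules -/

/-- The structure maps of a coalgebra in the category of Yetter-Drinfeld modules over `H`: action,
coaction, comultiplication and counit. The laws are `YDCoalgebraData.IsCoalgebra`. -/
structure YDCoalgebraData (K : Type*) [Field K] (H : Type*) [Ring H] [HopfAlgebra K H]
    (C : Type*) [AddCommGroup C] [Module K C] where
  /-- the left action `h · c` -/
  act : H →ₗ[K] C →ₗ[K] C
  /-- the left coaction `ρ(c) = c₋₁ ⊗ c₀` -/
  coact : C →ₗ[K] H ⊗[K] C
  /-- the comultiplication -/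
  comul : C →ₗ[K] C ⊗[K] C
  /-- the counit -/
  counit : C →ₗ[K] K

section YetterDrinfeld

variable {K : Type*} [Field K] {H : Type*} [Ring H] [HopfAlgebra K H]
variable {V W : Type*} [AddCommGroup V] [Module K V] [AddCommGroup W] [Module K W]

/-- The map `v ⊗ w ↦ v₋₁ w ⊗ v₀`, for a coaction on `V` and an action on `W`. -/
def braiding (coact : V →ₗ[K] H ⊗[K] V) (act : H →ₗ[K] W →ₗ[K] W) :
    V ⊗[K] W →ₗ[K] W ⊗[K] V :=
  LinearMap.rTensor V (TensorProduct.lift act) ∘ₗ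
    (TensorProduct.rightComm K H V W).toLinearMap ∘ₗ LinearMap.rTensor W coact

/-- The diagonal action `h (v ⊗ w) = h₁ v ⊗ h₂ w`. -/
def tensorAct (actV : H →ₗ[K] V →ₗ[K] V) (actW : H →ₗ[K] W →ₗ[K] W) :
    H →ₗ[K] V ⊗[K] W →ₗ[K] V ⊗[K] W :=
  TensorProduct.lift (TensorProduct.mapBilinear (RingHom.id K) V W V W) ∘ₗ
    TensorProduct.map actV actW ∘ₗ Coalgebra.comul

/-- The codiagonal coaction `ρ(v ⊗ w) = v₋₁ w₋₁ ⊗ v₀ ⊗ w₀`. -/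
def tensorCoact (coactV : V →ₗ[K] H ⊗[K] V) (coactW : W →ₗ[K] H ⊗[K] W) :
    V ⊗[K] W →ₗ[K] H ⊗[K] (V ⊗[K] W) :=
  LinearMap.rTensor (V ⊗[K] W) (LinearMap.mul' K H) ∘ₗ
    (TensorProduct.tensorTensorTensorComm K H V H W).toLinearMap ∘ₗ
    TensorProduct.map coactV coactW

/-- The action of `h ∈ H` on `H ⊗ V` by `g ⊗ v ↦ h₁ g S(h₃) ⊗ h₂ v`. -/
def ydAct (act : H →ₗ[K] V →ₗ[K] V) : H →ₗ[K] H ⊗[K] V →ₗ[K] H ⊗[K] V :=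
  TensorProduct.lift (TensorProduct.mapBilinear (RingHom.id K) H V H V) ∘ₗ
    TensorProduct.map
      (sandwich K H ∘ₗ LinearMap.lTensor H (HopfAlgebra.antipode K)) act ∘ₗ
    (TensorProduct.rightComm K H H H).toLinearMap ∘ₗ
    LinearMap.rTensor H Coalgebra.comul ∘ₗ Coalgebra.comul

end YetterDrinfeld

namespace YDCoalgebraData

variable {K : Type*} [Field K] {H : Type*} [Ring H] [HopfAlgebra K H]
variable {C D : Type*} [AddCommGroup C] [Module K C] [AddCommGroup D] [Module K D]

/-- The unit object `K`, with trivial action and coaction. -/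
def unit (K : Type*) [Field K] (H : Type*) [Ring H] [HopfAlgebra K H] :
    YDCoalgebraData K H K where
  act := LinearMap.mul K K ∘ₗ Coalgebra.counit
  coact := TensorProduct.mk K H K 1
  comul := TensorProduct.mk K K K 1
  counit := LinearMap.id

/-- The tensor product of coalgebras in the braided category of Yetter-Drinfeld modules. -/
def tensor (X : YDCoalgebraData K H C) (Y : YDCoalgebraData K H D) :
    YDCoalgebraData K H (C ⊗[K] D) where
  act := tensorAct X.act Y.act
  coact := tensorCoact X.coact Y.coact
  comul := tensorComul (braiding X.coact Y.act) X.comul Y.comul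
  counit := tensorFun X.counit Y.counit

/-- `f` is left `H`-linear. -/
def IsLinear (X : YDCoalgebraData K H C) (Y : YDCoalgebraData K H D) (f : C →ₗ[K] D) : Prop :=
  ∀ h c, f (X.act h c) = Y.act h (f c)

/-- `f` is left `H`-colinear. -/
def IsColinear (X : YDCoalgebraData K H C) (Y : YDCoalgebraData K H D) (f : C →ₗ[K] D) : Prop :=
  Y.coact ∘ₗ f = LinearMap.lTensor H f ∘ₗ X.coact

/-- `f` is a coalgebra homomorphism. -/
def IsCoalgHom (X : YDCoalgebraData K H C) (Y : YDCoalgebraData K H D) (f : C →ₗ[K] D) : Prop :=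
  Y.comul ∘ₗ f = TensorProduct.map f f ∘ₗ X.comul ∧ Y.counit ∘ₗ f = X.counit

/-- The laws of a coalgebra in the category of left-left Yetter-Drinfeld modules. -/
structure IsCoalgebra (X : YDCoalgebraData K H C) : Prop where
  one_act : ∀ c, X.act 1 c = c
  mul_act : ∀ g h c, X.act (g * h) c = X.act g (X.act h c)
  coact_coassoc : TensorProduct.assoc K H H C ∘ₗ LinearMap.rTensor C Coalgebra.comul ∘ₗ X.coact =
    LinearMap.lTensor H X.coact ∘ₗ X.coact
  coact_counit : LinearMap.rTensor C Coalgebra.counit ∘ₗ X.coact = TensorProduct.mk K K C 1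
  /-- `ρ(h c) = h₁ c₋₁ S(h₃) ⊗ h₂ c₀` -/
  yetter_drinfeld : ∀ h c, X.coact (X.act h c) = ydAct X.act h (X.coact c)
  coassoc : TensorProduct.assoc K C C C ∘ₗ LinearMap.rTensor C X.comul ∘ₗ X.comul =
    LinearMap.lTensor C X.comul ∘ₗ X.comul
  rTensor_counit : LinearMap.rTensor C X.counit ∘ₗ X.comul = TensorProduct.mk K K C 1
  lTensor_counit : LinearMap.lTensor C X.counit ∘ₗ X.comul = (TensorProduct.mk K C K).flip 1
  comul_linear : IsLinear X (X.tensor X) X.comul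
  comul_colinear : IsColinear X (X.tensor X) X.comul
  counit_linear : IsLinear X (unit K H) X.counit
  counit_colinear : IsColinear X (unit K H) X.counit

end YDCoalgebraData

/-! ### Pre-bialgebras with cocycle, and dual quasi-bialgebras -/

section PreBialgebra

open YDCoalgebraData

variable {K : Type*} [Field K] {H : Type*} [Ring H] [HopfAlgebra K H]
variable {R : Type*} [AddCommGroup R] [Module K R]

/-- The tensor square, as a coalgebra in Yetter-Drinfeld modules. -/
def tensorSq (X : YDCoalgebraData K H R) : YDCoalgebraData K H (R ⊗[K] R) :=
  X.tensor X

/-- The tensor cube, as a coalgebra in Yetter-Drinfeld modules. -/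
def tensorCube (X : YDCoalgebraData K H R) : YDCoalgebraData K H (R ⊗[K] (R ⊗[K] R)) :=
  X.tensor (tensorSq X)

/-- The fourth tensor power, as a coalgebra in Yetter-Drinfeld modules. -/
def tensorFourth (X : YDCoalgebraData K H R) : YDCoalgebraData K H (R ⊗[K] (R ⊗[K] (R ⊗[K] R))) :=
  X.tensor (tensorCube X)

/-- `(R, m, u, Δ, ε)` is a pre-bialgebra in Yetter-Drinfeld modules: the multiplication need not be
associative and need not be colinear. -/
structure IsPreBialgebra (X : YDCoalgebraData K H R) (m : R ⊗[K] R →ₗ[K] R) (u : K →ₗ[K] R) :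
    Prop where
  coalgebra : X.IsCoalgebra
  unit_linear : IsLinear (unit K H) X u
  unit_colinear : IsColinear (unit K H) X u
  unit_coalgHom : IsCoalgHom (unit K H) X u
  mul_linear : IsLinear (tensorSq X) X m
  mul_coalgHom : IsCoalgHom (tensorSq X) X m
  mul_one : ∀ r, m (r ⊗ₜ u 1) = r
  one_mul : ∀ r, m (u 1 ⊗ₜ r) = r

/-- `Φ(ξ) : R ⊗ R ⊗ R → R ⊗ R ⊗ R`, `z ⊗ t ↦ z₁ ⊗ ξ(z₂) t` for `z ∈ R ⊗ R` and `t ∈ R`. -/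
def Phi (X : YDCoalgebraData K H R) (ξ : R ⊗[K] R →ₗ[K] H) :
    (R ⊗[K] R) ⊗[K] R →ₗ[K] (R ⊗[K] R) ⊗[K] R :=
  LinearMap.lTensor (R ⊗[K] R) (TensorProduct.lift X.act) ∘ₗ
    (TensorProduct.assoc K (R ⊗[K] R) H R).toLinearMap ∘ₗ
    LinearMap.rTensor R (LinearMap.lTensor (R ⊗[K] R) ξ ∘ₗ (tensorSq X).comul)

/-- `(m ⊗ ξ) Δ : R ⊗ R → R ⊗ H`. -/
def mulXi (X : YDCoalgebraData K H R) (m : R ⊗[K] R →ₗ[K] R) (ξ : R ⊗[K] R →ₗ[K] H) :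
    R ⊗[K] R →ₗ[K] R ⊗[K] H :=
  TensorProduct.map m ξ ∘ₗ (tensorSq X).comul

/-- `c : R ⊗ H → H ⊗ R`, `r ⊗ h ↦ r₋₁ h ⊗ r₀`, where `H` acts on itself by left multiplication. -/
def braidRH (X : YDCoalgebraData K H R) : R ⊗[K] H →ₗ[K] H ⊗[K] R :=
  braiding X.coact (LinearMap.mul K H)

/-- `c : H ⊗ R → R ⊗ H`, `h ⊗ r ↦ h₁ r ⊗ h₂`, where `H` coacts on itself by `Δ_H`. -/
def braidHR (X : YDCoalgebraData K H R) : H ⊗[K] R →ₗ[K] R ⊗[K] H :=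
  braiding Coalgebra.comul X.act

/-- `ξ : R ⊗ R → H` is a cocycle for the pre-bialgebra `R`. -/
structure IsCocycle (X : YDCoalgebraData K H R) (m : R ⊗[K] R →ₗ[K] R) (u : K →ₗ[K] R)
    (ξ : R ⊗[K] R →ₗ[K] H) : Prop where
  /-- linearity for the left adjoint action on `H` -/
  linear : ∀ h z, ξ ((tensorSq X).act h z) = leftAdjoint K H h (ξ z)
  /-- `Δ_H ξ = (m_H ⊗ ξ)(ξ ⊗ ρ) Δ` -/
  comul_comp : Coalgebra.comul ∘ₗ ξ =
    TensorProduct.map (LinearMap.mul' K H) ξ ∘ₗ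
      (TensorProduct.assoc K H H (R ⊗[K] R)).symm.toLinearMap ∘ₗ
      TensorProduct.map ξ (tensorSq X).coact ∘ₗ (tensorSq X).comul
  counit_comp : Coalgebra.counit ∘ₗ ξ = (tensorSq X).counit
  /-- `c_{R,H} (m ⊗ ξ) Δ = (m_H ⊗ m)(ξ ⊗ ρ) Δ` -/
  braid_comp : braidRH X ∘ₗ mulXi X m ξ =
    TensorProduct.map (LinearMap.mul' K H) m ∘ₗ
      (TensorProduct.assoc K H H (R ⊗[K] R)).symm.toLinearMap ∘ₗ
      TensorProduct.map ξ (tensorSq X).coact ∘ₗ (tensorSq X).comul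
  /-- `m (R ⊗ m) = m (m ⊗ R) Φ(ξ)` -/
  mul_assoc : m ∘ₗ LinearMap.lTensor R m ∘ₗ (TensorProduct.assoc K R R R).toLinearMap =
    m ∘ₗ LinearMap.rTensor R m ∘ₗ Phi X ξ
  /-- `m_H (ξ ⊗ H) [R ⊗ (m ⊗ ξ) Δ] = m_H (ξ ⊗ H) (R ⊗ c_{H,R}) [(m ⊗ ξ) Δ ⊗ R]` -/
  cocycle : LinearMap.mul' K H ∘ₗ LinearMap.rTensor H ξ ∘ₗ
      (TensorProduct.assoc K R R H).symm.toLinearMap ∘ₗ LinearMap.lTensor R (mulXi X m ξ) ∘ₗ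
      (TensorProduct.assoc K R R R).toLinearMap =
    LinearMap.mul' K H ∘ₗ LinearMap.rTensor H ξ ∘ₗ
      (TensorProduct.assoc K R R H).symm.toLinearMap ∘ₗ LinearMap.lTensor R (braidHR X) ∘ₗ
      (TensorProduct.assoc K R H R).toLinearMap ∘ₗ LinearMap.rTensor R (mulXi X m ξ)
  map_tmul_one : ∀ r, ξ (r ⊗ₜ u 1) = algebraMap K H (X.counit r)
  map_one_tmul : ∀ r, ξ (u 1 ⊗ₜ r) = algebraMap K H (X.counit r)

/-- `(Q, m, u, Δ, ε, α)` is a dual quasi-bialgebra in Yetter-Drinfeld modules. -/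
structure IsDualQuasiBialgebra (X : YDCoalgebraData K H R) (m : R ⊗[K] R →ₗ[K] R)
    (u : K →ₗ[K] R) (α : R ⊗[K] (R ⊗[K] R) →ₗ[K] K) : Prop where
  coalgebra : X.IsCoalgebra
  mul_linear : IsLinear (tensorSq X) X m
  mul_colinear : IsColinear (tensorSq X) X m
  mul_coalgHom : IsCoalgHom (tensorSq X) X m
  unit_linear : IsLinear (unit K H) X u
  unit_colinear : IsColinear (unit K H) X u
  unit_coalgHom : IsCoalgHom (unit K H) X u
  assoc_linear : IsLinear (tensorCube X) (unit K H) α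
  assoc_colinear : IsColinear (tensorCube X) (unit K H) α
  assoc_invertible : IsConvInvertible (tensorCube X).comul (tensorCube X).counit α
  /-- `α(Q ⊗ Q ⊗ m) * α(m ⊗ Q ⊗ Q) = (ε ⊗ α) * α(Q ⊗ m ⊗ Q) * (α ⊗ ε)` -/
  three_cocycle :
    conv (tensorFourth X).comul
      (α ∘ₗ LinearMap.lTensor R (LinearMap.lTensor R m))
      (α ∘ₗ LinearMap.rTensor (R ⊗[K] R) m ∘ₗ
        (TensorProduct.assoc K R R (R ⊗[K] R)).symm.toLinearMap) =
    conv (tensorFourth X).comul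
      (conv (tensorFourth X).comul (tensorFun X.counit α) (α ∘ₗ LinearMap.lTensor R (mulId m)))
      (tensorCounit₃ α X.counit)
  assoc_one_left : ∀ r s, α (u 1 ⊗ₜ (r ⊗ₜ s)) = X.counit r * X.counit s
  assoc_one_middle : ∀ r s, α (r ⊗ₜ (u 1 ⊗ₜ s)) = X.counit r * X.counit s
  assoc_one_right : ∀ r s, α (r ⊗ₜ (s ⊗ₜ u 1)) = X.counit r * X.counit s
  /-- `m(Q ⊗ m) * α = α * m(m ⊗ Q)` -/
  quasi_assoc : convRight (tensorCube X).comul (m ∘ₗ idMul m) α =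
    convLeft (tensorCube X).comul α (m ∘ₗ mulId m)
  one_mul : ∀ r, m (u 1 ⊗ₜ r) = r
  mul_one : ∀ r, m (r ⊗ₜ u 1) = r

/-- The convolution inverse in `Hom(R ⊗ R, K)`. -/
def sqInv (X : YDCoalgebraData K H R) (v : R ⊗[K] R →ₗ[K] K) : R ⊗[K] R →ₗ[K] K :=
  convInv (tensorSq X).comul (tensorSq X).counit v

/-- The twisted multiplication `m^v = v * m * v⁻¹`. -/
def twist (X : YDCoalgebraData K H R) (m : R ⊗[K] R →ₗ[K] R) (v : R ⊗[K] R →ₗ[K] K) :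
    R ⊗[K] R →ₗ[K] R :=
  convRight (tensorSq X).comul (convLeft (tensorSq X).comul v m) (sqInv X v)

/-! The bosonization `A = R #_ξ H` on the vector space `R ⊗ H`, and the cohomology of `(R, ξ)`,
which is defined through that of `A`. -/

/-- The smash coproduct `Δ(r # h) = (r¹ # r²₋₁ h₁) ⊗ (r²₀ # h₂)`. -/
def smashComul (X : YDCoalgebraData K H R) :
    R ⊗[K] H →ₗ[K] (R ⊗[K] H) ⊗[K] (R ⊗[K] H) :=
  tensorComul (braidRH X) X.comul Coalgebra.comul

/-- The counit `ε(r # h) = ε(r) ε(h)`. -/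
def smashCounit (X : YDCoalgebraData K H R) : R ⊗[K] H →ₗ[K] K :=
  tensorFun X.counit Coalgebra.counit

/-- The multiplication `m_A = (R ⊗ m_H) [(m ⊗ ξ) Δ ⊗ m_H] (R ⊗ c_{H,R} ⊗ H)`. -/
def smashMul (X : YDCoalgebraData K H R) (m : R ⊗[K] R →ₗ[K] R) (ξ : R ⊗[K] R →ₗ[K] H) :
    (R ⊗[K] H) ⊗[K] (R ⊗[K] H) →ₗ[K] R ⊗[K] H :=
  LinearMap.lTensor R (LinearMap.mul' K H) ∘ₗ
    (TensorProduct.assoc K R H H).toLinearMap ∘ₗ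
    TensorProduct.map (mulXi X m ξ) (LinearMap.mul' K H) ∘ₗ
    middle R H (braidHR X)

/-- `℧²(v)((r # h) ⊗ (s # l)) = v(r ⊗ h s) ε(l)`. -/
def mho₂ (X : YDCoalgebraData K H R) (v : R ⊗[K] R →ₗ[K] K) :
    (R ⊗[K] H) ⊗[K] (R ⊗[K] H) →ₗ[K] K :=
  tensorFun v Coalgebra.counit ∘ₗ
    (TensorProduct.assoc K R R H).symm.toLinearMap ∘ₗ
    LinearMap.lTensor R
      (LinearMap.rTensor H (TensorProduct.lift X.act) ∘ₗ
        (TensorProduct.assoc K H R H).symm.toLinearMap) ∘ₗ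
    (TensorProduct.assoc K R H (R ⊗[K] H)).toLinearMap

/-- `Ω³(γ)(r ⊗ s ⊗ t) = γ((r # 1) ⊗ (s # 1) ⊗ (t # 1))`. -/
def omega₃ (γ : (R ⊗[K] H) ⊗[K] ((R ⊗[K] H) ⊗[K] (R ⊗[K] H)) →ₗ[K] K) :
    R ⊗[K] (R ⊗[K] R) →ₗ[K] K :=
  let i : R →ₗ[K] R ⊗[K] H := (TensorProduct.mk K R H).flip 1
  γ ∘ₗ TensorProduct.map i (TensorProduct.map i i)

/-- `∂²_R = Ω³ ∘ ∂²_A ∘ ℧²` for `A = R #_ξ H`. -/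
def coboundaryR₂ (X : YDCoalgebraData K H R) (m : R ⊗[K] R →ₗ[K] R) (ξ : R ⊗[K] R →ₗ[K] H)
    (v : R ⊗[K] R →ₗ[K] K) : R ⊗[K] (R ⊗[K] R) →ₗ[K] K :=
  omega₃ (coboundary₂ (smashComul X) (smashCounit X) (smashMul X m ξ) (mho₂ X v))

end PreBialgebra

end YD

end

/-! The braided statements about `R` are proved upstairs, in ordinary tensor powers of the
bosonization `A = R #_ξ H`, and then pushed down. The map `(r # h) ⊗ d ↦ r ⊗ h d` (`actFirst`) is a
surjective coalgebra map from the usual coalgebra `A ⊗ D` to the braided coalgebra `R ⊗ D`.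
Iterating it gives surjective coalgebra maps `P_n : A^{⊗n} → R^{⊗n}` (`smashProj₂`, `smashProj₃`,
`smashProj₄`), so a convolution identity on `R^{⊗n}` may be tested after composing with `P_n`. Since
`v_A = v ∘ P₂`, invertibility of `v_A` is inherited from `v`. Since `λξ` is `H`-invariant (adjoint
linearity of `ξ`, ad-invariance of `λ`), so is `v`, and then `∂²_A(v_A) = ∂²_R(v) ∘ P₃`
(`coboundary₂_eq_comp`).

Upstairs nothing is braided. The cocycle conditions make `m_A` an associative coalgebra map
(`isCoalgMap_smashMul`, `smashMul_assoc`). For any such multiplication and any convolution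
invertible `w`, the twist `w * m * w⁻¹` is associative up to `∂²(w)`, and `∂²(w)` satisfies the
pentagon. Both are cancellations in a convolution monoid (`quasi_assoc_conj`, `pentagon_conj`).

The integral enters through the components `p : A → R` and `π : A → H`, which determine `a = p(a₁) #
π(a₂)`. The formula for `Δ_H ξ` and `h₁ λ(h₂) = λ(h) 1` give `(π m_A) * (λξ P₂) = (λξ P₂) * (π · π)`
(`smashSnd_smashMul_integral`). Hence `π` is multiplicative for the twisted product, which therefore
is `(r # h)(s # k) = m^v(r ⊗ h₁ s) # h₂ k` (`isSmashMul_twistedMul`): the cocycle has been twisted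
away. In this form the product descends along the `P_n`, which gives quasi-associativity and the
3-cocycle condition for `R^v`. Comparing `H`-components gives colinearity of `m^v` and of `∂²_R(v)`.

Invertibility of `λξ` comes from connectedness. The form `g = ε - λξ` vanishes on `1 ⊗ R`, so
`g^{*n}` vanishes on `W_n ⊗ R`, where `W_n` is the wedge filtration of `R` at `1_R`, and the
geometric series `∑ g^{*n}` is locally finite. That the `W_n` exhaust `R` (`exists_mem_wedgePow`) is
seen in the dual algebra: its action on a finite dimensional piece factors through an Artinian ring
in which the annihilator of `1_R` becomes the greatest proper two-sided ideal, and such an ideal is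
nilpotent. -/

open scoped TensorProduct

namespace YD

noncomputable section

/-! ### Sweedler sums -/

section Sweedler
variable {K : Type*} [Field K]
variable {M N P Q : Type*} [AddCommGroup M] [Module K M] [AddCommGroup N] [Module K N]
  [AddCommGroup P] [Module K P] [AddCommGroup Q] [Module K Q]

/-- `f` is `K`-linear, in unbundled form. -/
@[fun_prop]
structure Lin (K : Type*) [Field K] {M N : Type*} [AddCommGroup M] [Module K M] [AddCommGroup N]
    [Module K N] (f : M → N) : Prop where
  add : ∀ x y, f (x + y) = f x + f y
  smul : ∀ (k : K) x, f (k • x) = k • f x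

theorem exists_repr (t : M ⊗[K] N) :
    ∃ s : Multiset (M × N), (s.map fun p => p.1 ⊗ₜ[K] p.2).sum = t := by
  induction t using TensorProduct.induction_on with
  | zero => exact ⟨0, by simp⟩
  | tmul a b => exact ⟨{(a, b)}, by simp⟩
  | add x y hx hy =>
    obtain ⟨s, rfl⟩ := hx
    obtain ⟨s', rfl⟩ := hy
    exact ⟨s + s', by simp⟩

/-- A multiset of pure tensors with sum `t`. -/
def repr (t : M ⊗[K] N) : Multiset (M × N) := (exists_repr t).choose

/-- The Sweedler sum `∑ f a b`, where `t = ∑ a ⊗ b`; it is meant for bilinear `f`. -/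
def sw (t : M ⊗[K] N) (f : M → N → P) : P :=
  ((repr t).map fun p => f p.1 p.2).sum

@[fun_prop] theorem lin_id : Lin K (fun x : M => x) := ⟨fun _ _ => rfl, fun _ _ => rfl⟩
@[fun_prop]
theorem lin_comp {f : N → P} {g : M → N} (hf : Lin K f) (hg : Lin K g) : Lin K (fun x => f (g x)) :=
  ⟨fun x y => by rw [hg.add, hf.add], fun k x => by rw [hg.smul, hf.smul]⟩
@[fun_prop] theorem lin_linearMap (L : M →ₗ[K] N) : Lin K L := ⟨by simp, by simp⟩
@[fun_prop] theorem lin_linearEquiv (L : M ≃ₗ[K] N) : Lin K L := ⟨by simp, by simp⟩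
@[fun_prop]
theorem lin_linearEquiv_apply (L : N ≃ₗ[K] P) {f : M → N} (hf : Lin K f) :
    Lin K (fun x => L (f x)) := lin_comp (lin_linearEquiv L) hf
@[fun_prop]
theorem lin_apply_right (L : N →ₗ[K] P) {f : M → N} (hf : Lin K f) : Lin K (fun x => L (f x)) :=
    lin_comp (lin_linearMap L) hf
@[fun_prop] theorem lin_apply {f : M → N →ₗ[K] P} (hf : Lin K f) (y : N) : Lin K (fun x => f x y) :=
  ⟨fun x y => by rw [hf.add]; rfl, fun k x => by rw [hf.smul]; rfl⟩
@[fun_prop]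
theorem lin_tmul_left {f : M → N} (hf : Lin K f) (y : P) : Lin K (fun x => f x ⊗ₜ[K] y) :=
  ⟨fun a b => by rw [hf.add, TensorProduct.add_tmul], fun k x => by rw [hf.smul]; rfl⟩
@[fun_prop]
theorem lin_tmul_right {f : M → N} (hf : Lin K f) (y : P) : Lin K (fun x => y ⊗ₜ[K] f x) :=
  ⟨fun a b => by rw [hf.add, TensorProduct.tmul_add],
    fun k x => by rw [hf.smul, TensorProduct.tmul_smul]⟩
@[fun_prop] theorem lin_smul_left {f : M → K} (hf : Lin K f) (y : P) : Lin K (fun x => f x • y) :=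
  ⟨fun a b => by rw [hf.add, add_smul], fun k x => by rw [hf.smul, smul_assoc]⟩
@[fun_prop] theorem lin_smul_right {f : M → P} (hf : Lin K f) (y : K) : Lin K (fun x => y • f x) :=
  ⟨fun a b => by rw [hf.add, smul_add], fun k x => by rw [hf.smul, smul_comm]⟩
section
variable {H : Type*} [Ring H] [Algebra K H]
@[fun_prop] theorem lin_mul_left {f : M → H} (hf : Lin K f) (y : H) : Lin K (fun x => f x * y) :=
  ⟨fun a b => by rw [hf.add, add_mul], fun k x => by rw [hf.smul, smul_mul_assoc]⟩
@[fun_prop] theorem lin_mul_right {f : M → H} (hf : Lin K f) (y : H) : Lin K (fun x => y * f x) :=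
  ⟨fun a b => by rw [hf.add, mul_add], fun k x => by rw [hf.smul, mul_smul_comm]⟩
end

/-- Reduces to pure tensors for maps given as unbundled expressions, so nested Sweedler sums need
not be packaged as linear maps. The recurring pattern `revert; apply lin_ext` peels off one tensor
factor at a time. -/
theorem lin_ext {f g : M ⊗[K] N → P} (hf : Lin K f) (hg : Lin K g)
    (h : ∀ a b, f (a ⊗ₜ b) = g (a ⊗ₜ b)) (t) : f t = g t := by
  induction t using TensorProduct.induction_on with
  | zero => have := hf.smul 0 0; have h2 := hg.smul 0 0; simp at this h2; rw [this, h2]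
  | tmul a b => exact h a b
  | add x y hx hy => rw [hf.add, hg.add, hx, hy]

/-- For bilinear `f` the representative chosen in `repr` is immaterial, the sum being the value of
the induced linear map. Every rule for `sw` that uses the tensor itself rests on this. -/
theorem sw_eq_lift (t : M ⊗[K] N) {f : M → N → P} (h₁ : ∀ b, Lin K (fun a => f a b))
    (h₂ : ∀ a, Lin K (f a)) :
    sw t f = TensorProduct.lift (LinearMap.mk₂ K f (fun a a' b => (h₁ b).add a a')
     (fun k a b => (h₁ b).smul k a) (fun a b b' => (h₂ a).add b b')
     (fun k a b => (h₂ a).smul k b)) t := by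
  conv_rhs => rw [← (exists_repr t).choose_spec]
  rw [map_multiset_sum, Multiset.map_map]
  rfl

theorem sw_tmul (a : M) (b : N) {f : M → N → P} (h₁ : ∀ b, Lin K (fun a => f a b))
    (h₂ : ∀ a, Lin K (f a)) :
    sw (a ⊗ₜ[K] b) f = f a b := by rw [sw_eq_lift _ h₁ h₂]; rfl

@[fun_prop]
theorem lin_sw_left {T : Q → M ⊗[K] N} {f : M → N → P} (hT : Lin K T)
    (h₁ : ∀ b, Lin K (fun a => f a b)) (h₂ : ∀ a, Lin K (f a)) : Lin K (fun x => sw (T x) f) := by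
  simp only [sw_eq_lift _ h₁ h₂]
  fun_prop

@[fun_prop]
theorem lin_sw_right (t : M ⊗[K] N) {f : Q → M → N → P} (h : ∀ a b, Lin K (fun x => f x a b)) :
    Lin K (fun x => sw t (f x)) := by
  constructor
  · intro x y; simp only [sw, (h _ _).add, Multiset.sum_map_add]
  · intro k x; simp only [sw, (h _ _).smul, Multiset.smul_sum, Multiset.map_map]; rfl

theorem map_sw {L : P → Q} (hL : Lin K L) (t : M ⊗[K] N) (f : M → N → P) :
    L (sw t f) = sw t (fun a b => L (f a b)) := by
  let L' : P →ₗ[K] Q := ⟨⟨L, hL.add⟩, hL.smul⟩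
  change L' _ = _
  rw [sw, map_multiset_sum, Multiset.map_map]; rfl

/-- Both sides are finite sums over fixed representatives, so no linearity is needed; only the
independence of the inner tensor from the outer variables matters. -/
theorem sw_comm {M' N' S : Type*} [AddCommGroup M'] [Module K M'] [AddCommGroup N'] [Module K N']
    [AddCommGroup S] (t : M ⊗[K] N) (t' : M' ⊗[K] N') (f : M → N → M' → N' → S) :
    sw t (fun a b => sw t' (f a b)) = sw t' fun c d => sw t fun a b => f a b c d := by
  simp only [sw]; exact Multiset.sum_map_sum_map _ _

theorem sw_sw {M' N' : Type*} [AddCommGroup M'] [Module K M'] [AddCommGroup N'] [Module K N']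
    (t : M' ⊗[K] N') (g : M' → N' → M ⊗[K] N) {f : M → N → P}
    (h₁ : ∀ b, Lin K (fun a => f a b)) (h₂ : ∀ a, Lin K (f a)) :
    sw (sw t g) f = sw t fun a b => sw (g a b) f :=
  map_sw (L := fun s => sw s f) (by fun_prop) t g

theorem sw_eta (t : M ⊗[K] N) : sw t (fun a b => a ⊗ₜ[K] b) = t := by
  revert t; apply lin_ext (by fun_prop) (by fun_prop); intro a b
  simp (disch := fun_prop) only [sw_tmul]

theorem tmul_sw (x : Q) (t : M ⊗[K] N) (f : M → N → P) :
    x ⊗ₜ[K] sw t f = sw t fun a b => x ⊗ₜ[K] f a b :=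
  map_sw (L := fun y => x ⊗ₜ[K] y) (by fun_prop) t f

theorem sw_tmul_const (x : Q) (t : M ⊗[K] N) (f : M → N → P) :
    sw t f ⊗ₜ[K] x = sw t fun a b => f a b ⊗ₜ[K] x :=
  map_sw (L := fun y => y ⊗ₜ[K] x) (by fun_prop) t f

theorem linearMap_sw (L : P →ₗ[K] Q) (t : M ⊗[K] N) (f : M → N → P) :
    L (sw t f) = sw t fun a b => L (f a b) :=
  map_sw (L := L) (by fun_prop) t f

theorem linearEquiv_sw (L : P ≃ₗ[K] Q) (t : M ⊗[K] N) (f : M → N → P) :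
    L (sw t f) = sw t fun a b => L (f a b) :=
  map_sw (L := L) (by fun_prop) t f

theorem smul_sw (k : K) (t : M ⊗[K] N) (f : M → N → P) :
    k • sw t f = sw t fun a b => k • f a b :=
  map_sw (L := fun y => k • y) (by fun_prop) t f

theorem sw_apply (t : M ⊗[K] N) (f : M → N → P →ₗ[K] Q) (x : P) :
    sw t f x = sw t fun a b => f a b x :=
  map_sw (L := fun y : P →ₗ[K] Q => y x) (by fun_prop) t f

theorem mul_sw {H : Type*} [Ring H] [Algebra K H] (x : H) (t : M ⊗[K] N) (f : M → N → H) :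
    x * sw t f = sw t fun a b => x * f a b :=
  map_sw (L := fun y => x * y) (by fun_prop) t f

theorem sw_mul {H : Type*} [Ring H] [Algebra K H] (x : H) (t : M ⊗[K] N) (f : M → N → H) :
    sw t f * x = sw t fun a b => f a b * x :=
  map_sw (L := fun y => y * x) (by fun_prop) t f

section MapSums

variable {M' N' : Type*} [AddCommGroup M'] [Module K M'] [AddCommGroup N'] [Module K N']

theorem sw_map (f : M →ₗ[K] M') (g : N →ₗ[K] N') (t : M ⊗[K] N) {F : M' → N' → P}
    (h₁ : ∀ b, Lin K (fun a => F a b)) (h₂ : ∀ a, Lin K (F a)) :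
    sw (TensorProduct.map f g t) F = sw t fun a b => F (f a) (g b) := by
  revert t; apply lin_ext (by fun_prop) (by fun_prop); intro a b
  simp (disch := fun_prop) only [sw_tmul, TensorProduct.map_tmul]

theorem sw_lTensor (g : N →ₗ[K] N') (t : M ⊗[K] N) {F : M → N' → P}
    (h₁ : ∀ b, Lin K (fun a => F a b)) (h₂ : ∀ a, Lin K (F a)) :
    sw (LinearMap.lTensor M g t) F = sw t fun a b => F a (g b) :=
  sw_map LinearMap.id g t h₁ h₂

theorem sw_rTensor (f : M →ₗ[K] M') (t : M ⊗[K] N) {F : M' → N → P}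
    (h₁ : ∀ b, Lin K (fun a => F a b)) (h₂ : ∀ a, Lin K (F a)) :
    sw (LinearMap.rTensor N f t) F = sw t fun a b => F (f a) b :=
  sw_map f LinearMap.id t h₁ h₂

theorem sw_assoc (t : (M ⊗[K] N) ⊗[K] M') {F : M → N → M' → P}
    (h₁ : ∀ b c, Lin K (fun a => F a b c)) (h₂ : ∀ a c, Lin K (fun b => F a b c))
    (h₃ : ∀ a b, Lin K (F a b)) :
    sw (TensorProduct.assoc K M N M' t) (fun a s => sw s (F a)) =
      sw t fun s c => sw s fun a b => F a b c := by
  revert t; apply lin_ext (by fun_prop) (by fun_prop); intro s c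
  revert s; apply lin_ext (by fun_prop) (by fun_prop); intro a b
  simp (disch := fun_prop) only [sw_tmul, TensorProduct.assoc_tmul]

end MapSums

/-! Functionals separate the points of a vector space and of tensor products. -/

/-- Turns identities between vector-valued convolutions into identities of functionals, where
convolution is the product of a monoid. -/
theorem dual_ext {f g : M →ₗ[K] N} (h : ∀ φ : N →ₗ[K] K, φ ∘ₗ f = φ ∘ₗ g) : f = g := by
  ext x
  rw [← sub_eq_zero, ← Module.forall_dual_apply_eq_zero_iff K]
  intro φ
  rw [map_sub, sub_eq_zero]
  exact LinearMap.congr_fun (h φ) x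

/-- A basis of `M` writes `t` as a finite family of vectors of `N`, each obtained by applying a
coordinate functional. -/
theorem tensor_eq_zero_of_rTensor {t : M ⊗[K] N}
    (h : ∀ φ : M →ₗ[K] K, LinearMap.rTensor N φ t = 0) : t = 0 := by
  classical
  let b := Module.Basis.ofVectorSpace K M
  apply (TensorProduct.equivFinsuppOfBasisLeft b).injective
  ext i
  rw [TensorProduct.equivFinsuppOfBasisLeft_apply, h]
  simp

theorem tensor_ext_dual {t t' : M ⊗[K] N}
    (h : ∀ (φ : M →ₗ[K] K) (ψ : N →ₗ[K] K), tensorFun φ ψ t = tensorFun φ ψ t') : t = t' := by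
  rw [← sub_eq_zero]
  apply tensor_eq_zero_of_rTensor
  intro φ
  apply (TensorProduct.lid K N).injective
  rw [map_zero, ← Module.forall_dual_apply_eq_zero_iff K]
  intro ψ
  have e : (fun t => ψ (TensorProduct.lid K N (LinearMap.rTensor N φ t))) = tensorFun φ ψ := by
    funext t; revert t; apply lin_ext (by fun_prop) (by fun_prop); intro a b
    simp [tensorFun]
  have := congrFun e (t - t')
  rw [this, map_sub, h, sub_self]

theorem tensorFun_tmul (φ : M →ₗ[K] K) (ψ : N →ₗ[K] K) (a : M) (b : N) :
    tensorFun φ ψ (a ⊗ₜ b) = φ a * ψ b := by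
  simp [tensorFun]

theorem tensorFun_eq_sw (φ : M →ₗ[K] K) (ψ : N →ₗ[K] K) (t : M ⊗[K] N) :
    tensorFun φ ψ t = sw t fun a b => φ a * ψ b := by
  revert t; apply lin_ext (by fun_prop) (by fun_prop); intro a b
  simp (disch := fun_prop) only [sw_tmul, tensorFun_tmul]

theorem tensor_ext_dual₃ {t t' : M ⊗[K] (N ⊗[K] P)}
    (h : ∀ (φ : M →ₗ[K] K) (ψ : N →ₗ[K] K) (χ : P →ₗ[K] K),
      tensorFun φ (tensorFun ψ χ) t = tensorFun φ (tensorFun ψ χ) t') : t = t' := by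
  rw [← sub_eq_zero]
  apply tensor_eq_zero_of_rTensor
  intro φ
  apply (TensorProduct.lid K (N ⊗[K] P)).injective
  apply tensor_ext_dual
  intro ψ χ
  have e : (fun t => tensorFun ψ χ (TensorProduct.lid K _ (LinearMap.rTensor _ φ t))) =
      tensorFun φ (tensorFun ψ χ) := by
    funext t; revert t; apply lin_ext (by fun_prop) (by fun_prop); intro a b
    simp [tensorFun_tmul]
  have := congrFun e (t - t')
  rw [this, map_sub, h, sub_self, map_zero, map_zero]

end Sweedler

/-! ### Ordinary coalgebras and convolution -/

section Coalg

variable {K : Type*} [Field K]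
variable {A B C C' D D' M N : Type*} [AddCommGroup A] [Module K A] [AddCommGroup B] [Module K B]
  [AddCommGroup C] [Module K C] [AddCommGroup C'] [Module K C']
  [AddCommGroup D] [Module K D] [AddCommGroup D'] [Module K D']
  [AddCommGroup M] [Module K M] [AddCommGroup N] [Module K N]

/-- `(C, Δ, ε)` is a coassociative counital coalgebra. -/
structure IsCoalg (Δ : C →ₗ[K] C ⊗[K] C) (ε : C →ₗ[K] K) : Prop where
  coassoc : ∀ x, TensorProduct.assoc K C C C (LinearMap.rTensor C Δ (Δ x)) =
    LinearMap.lTensor C Δ (Δ x)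
  counit_left : ∀ x, LinearMap.rTensor C ε (Δ x) = 1 ⊗ₜ x
  counit_right : ∀ x, LinearMap.lTensor C ε (Δ x) = x ⊗ₜ 1

/-- `f` is a homomorphism of coalgebras. -/
structure IsCoalgMap (ΔC : C →ₗ[K] C ⊗[K] C) (εC : C →ₗ[K] K) (ΔD : D →ₗ[K] D ⊗[K] D)
    (εD : D →ₗ[K] K) (f : C →ₗ[K] D) : Prop where
  comul : ∀ x, ΔD (f x) = TensorProduct.map f f (ΔC x)
  counit : ∀ x, εD (f x) = εC x

variable {Δ : C →ₗ[K] C ⊗[K] C} {ε : C →ₗ[K] K} {ΔD : D →ₗ[K] D ⊗[K] D} {εD : D →ₗ[K] K}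

theorem conv_apply (Δ : C →ₗ[K] C ⊗[K] C) (f g : C →ₗ[K] K) (x : C) :
    conv Δ f g x = sw (Δ x) fun a b => f a * g b :=
  tensorFun_eq_sw f g (Δ x)

theorem convLeft_apply (Δ : C →ₗ[K] C ⊗[K] C) (v : C →ₗ[K] K) (f : C →ₗ[K] M) (x : C) :
    convLeft Δ v f x = sw (Δ x) fun a b => v a • f b := by
  simp only [convLeft, LinearMap.comp_apply]
  generalize Δ x = t
  revert t; apply lin_ext (by fun_prop) (by fun_prop); intro a b
  simp (disch := fun_prop) [sw_tmul]

theorem convRight_apply (Δ : C →ₗ[K] C ⊗[K] C) (f : C →ₗ[K] M) (v : C →ₗ[K] K) (x : C) :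
    convRight Δ f v x = sw (Δ x) fun a b => v b • f a := by
  simp only [convRight, LinearMap.comp_apply]
  generalize Δ x = t
  revert t; apply lin_ext (by fun_prop) (by fun_prop); intro a b
  simp (disch := fun_prop) [sw_tmul]

theorem comp_convLeft (L : M →ₗ[K] N) (v : C →ₗ[K] K) (f : C →ₗ[K] M) :
    L ∘ₗ convLeft Δ v f = convLeft Δ v (L ∘ₗ f) := by
  ext x; simp [convLeft_apply, linearMap_sw]

theorem comp_convRight (L : M →ₗ[K] N) (v : C →ₗ[K] K) (f : C →ₗ[K] M) :
    L ∘ₗ convRight Δ f v = convRight Δ (L ∘ₗ f) v := by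
  ext x; simp [convRight_apply, linearMap_sw]

theorem convLeft_eq_conv (v f : C →ₗ[K] K) : convLeft Δ v f = conv Δ v f := by
  ext x; simp [convLeft_apply, conv_apply]

theorem convRight_eq_conv (v f : C →ₗ[K] K) : convRight Δ f v = conv Δ f v := by
  ext x; simp [convRight_apply, conv_apply, mul_comm]

namespace IsCoalg

theorem sw_coassoc (h : IsCoalg Δ ε) (x : C) {F : C → C → C → M}
    (h₁ : ∀ b c, Lin K (fun a => F a b c)) (h₂ : ∀ a c, Lin K (fun b => F a b c))
    (h₃ : ∀ a b, Lin K (F a b)) :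
    (sw (Δ x) fun a b => sw (Δ a) fun a₁ a₂ => F a₁ a₂ b) =
      sw (Δ x) fun a b => sw (Δ b) fun b₁ b₂ => F a b₁ b₂ := by
  have := congrArg (fun t => sw t fun a s => sw s (F a)) (h.coassoc x)
  simp (disch := fun_prop) only [sw_assoc, sw_lTensor, sw_rTensor] at this
  exact this

theorem sw_counit_left (h : IsCoalg Δ ε) (x : C) {F : C → M} (hF : Lin K F) :
    (sw (Δ x) fun a b => ε a • F b) = F x := by
  have := congrArg (fun t => sw t fun (a : K) b => a • F b) (h.counit_left x)
  simp (disch := fun_prop) only [sw_rTensor, sw_tmul] at this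
  simpa using this

theorem sw_counit_right (h : IsCoalg Δ ε) (x : C) {F : C → M} (hF : Lin K F) :
    (sw (Δ x) fun a b => ε b • F a) = F x := by
  have := congrArg (fun t => sw t fun b (a : K) => a • F b) (h.counit_right x)
  simp (disch := fun_prop) only [sw_lTensor, sw_tmul] at this
  simpa using this

theorem conv_assoc (h : IsCoalg Δ ε) (f g k : C →ₗ[K] K) :
    conv Δ (conv Δ f g) k = conv Δ f (conv Δ g k) := by
  ext x
  simp only [conv_apply, sw_mul, mul_sw, mul_assoc]
  exact h.sw_coassoc (F := fun a b c => f a * (g b * k c)) x (by fun_prop) (by fun_prop)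
    (by fun_prop)

theorem one_conv (h : IsCoalg Δ ε) (f : C →ₗ[K] K) : conv Δ ε f = f := by
  ext x; rw [conv_apply]; exact h.sw_counit_left x (by fun_prop)

theorem conv_one (h : IsCoalg Δ ε) (f : C →ₗ[K] K) : conv Δ f ε = f := by
  ext x; rw [conv_apply]; simp only [mul_comm (f _)]; exact h.sw_counit_right x (by fun_prop)

/-- Functionals separate the points of `C ⊗ (C ⊗ C)`, so the coalgebra laws are equivalent to the
monoid laws for convolution of functionals. This allows the laws to be transported along
surjections. -/
theorem of_conv (h₁ : ∀ f g k, conv Δ (conv Δ f g) k = conv Δ f (conv Δ g k))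
    (h₂ : ∀ f, conv Δ ε f = f) (h₃ : ∀ f, conv Δ f ε = f) : IsCoalg Δ ε where
  coassoc x := by
    apply tensor_ext_dual₃
    intro φ ψ χ
    have := LinearMap.congr_fun (h₁ φ ψ χ) x
    simp only [conv_apply, sw_mul, mul_sw, mul_assoc] at this
    simp (disch := fun_prop) only [tensorFun_eq_sw, sw_lTensor, mul_sw]
    rw [sw_assoc (F := fun a b c => φ a * (ψ b * χ c)) _ (by fun_prop) (by fun_prop) (by fun_prop)]
    simp (disch := fun_prop) only [sw_rTensor]
    exact this
  counit_left x := by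
    apply tensor_ext_dual
    intro φ ψ
    have := LinearMap.congr_fun (h₂ ψ) x
    have hφ : ∀ k : K, φ k = φ 1 * k := fun k => by
      rw [mul_comm, ← smul_eq_mul, ← map_smul, smul_eq_mul, mul_one]
    rw [tensorFun_tmul, ← this, conv_apply, mul_sw]
    simp (disch := fun_prop) only [tensorFun_eq_sw, sw_rTensor, hφ (ε _), mul_assoc]
  counit_right x := by
    apply tensor_ext_dual
    intro φ ψ
    have := LinearMap.congr_fun (h₃ φ) x
    have hψ : ∀ k : K, ψ k = k * ψ 1 := fun k => by
      rw [← smul_eq_mul, ← map_smul, smul_eq_mul, mul_one]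
    rw [tensorFun_tmul, ← this, conv_apply, sw_mul]
    simp (disch := fun_prop) only [tensorFun_eq_sw, sw_lTensor, hψ (ε _), mul_assoc]

/-- The convolution monoid of functionals. -/
abbrev convMonoid (h : IsCoalg Δ ε) : Monoid (C →ₗ[K] K) where
  mul := conv Δ
  mul_assoc := h.conv_assoc
  one := ε
  one_mul := h.one_conv
  mul_one := h.conv_one

/-- Uniqueness of inverses in a monoid identifies the chosen value of `convInv` with any inverse at
hand. -/
theorem convInv_eq (h : IsCoalg Δ ε) {f g : C →ₗ[K] K} (hfg : IsConvInverse Δ ε f g) :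
    convInv Δ ε f = g := by
  have hf : IsConvInvertible Δ ε f := ⟨g, hfg⟩
  have hc : IsConvInverse Δ ε f (convInv Δ ε f) := by
    rw [convInv, dif_pos hf]; exact hf.choose_spec
  calc convInv Δ ε f = conv Δ (conv Δ g f) (convInv Δ ε f) := by rw [hfg.2, h.one_conv]
    _ = g := by rw [h.conv_assoc, hc.1, h.conv_one]

end IsCoalg

namespace IsCoalgMap

variable {ΔC' : C' →ₗ[K] C' ⊗[K] C'} {εC' : C' →ₗ[K] K} {f : C →ₗ[K] D}
variable {ΔD' : D' →ₗ[K] D' ⊗[K] D'} {εD' : D' →ₗ[K] K}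

theorem sw_comul (hf : IsCoalgMap Δ ε ΔD εD f) (x : C) {F : D → D → M}
    (h₁ : ∀ b, Lin K (fun a => F a b)) (h₂ : ∀ a, Lin K (F a)) :
    sw (ΔD (f x)) F = sw (Δ x) fun a b => F (f a) (f b) := by
  rw [hf.comul, sw_map _ _ _ h₁ h₂]

theorem comul_eq_sw (hf : IsCoalgMap Δ ε ΔD εD f) (x : C) :
    ΔD (f x) = sw (Δ x) fun a b => f a ⊗ₜ f b := by
  rw [← hf.sw_comul x (by fun_prop) (by fun_prop), sw_eta]

theorem conv_comp (hf : IsCoalgMap Δ ε ΔD εD f) (φ ψ : D →ₗ[K] K) :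
    conv ΔD φ ψ ∘ₗ f = conv Δ (φ ∘ₗ f) (ψ ∘ₗ f) := by
  ext x
  simp only [LinearMap.comp_apply, conv_apply]
  exact hf.sw_comul x (by fun_prop) (by fun_prop)

theorem counit_comp (hf : IsCoalgMap Δ ε ΔD εD f) : εD ∘ₗ f = ε :=
  LinearMap.ext hf.counit

/-- Dual criterion: `f` is a coalgebra map when pull-back along it is a homomorphism of convolution
monoids. -/
theorem of_conv (h₁ : ∀ φ ψ, conv ΔD φ ψ ∘ₗ f = conv Δ (φ ∘ₗ f) (ψ ∘ₗ f)) (h₂ : εD ∘ₗ f = ε) :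
    IsCoalgMap Δ ε ΔD εD f where
  comul x := by
    apply tensor_ext_dual
    intro φ ψ
    have := LinearMap.congr_fun (h₁ φ ψ) x
    rw [conv_apply] at this
    simp (disch := fun_prop) only [tensorFun_eq_sw φ ψ, sw_map]
    rw [← tensorFun_eq_sw]
    exact this
  counit := LinearMap.congr_fun h₂

theorem id : IsCoalgMap Δ ε Δ ε LinearMap.id := ⟨by simp, by simp⟩

theorem comp {g : D →ₗ[K] D'} (hg : IsCoalgMap ΔD εD ΔD' εD' g) (hf : IsCoalgMap Δ ε ΔD εD f) :
    IsCoalgMap Δ ε ΔD' εD' (g ∘ₗ f) :=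
  of_conv (fun φ ψ => by
    rw [← LinearMap.comp_assoc, hg.conv_comp, hf.conv_comp]; rfl)
    (by rw [← LinearMap.comp_assoc, hg.counit_comp, hf.counit_comp])

theorem isConvInverse_comp (hf : IsCoalgMap Δ ε ΔD εD f) {φ ψ : D →ₗ[K] K}
    (h : IsConvInverse ΔD εD φ ψ) : IsConvInverse Δ ε (φ ∘ₗ f) (ψ ∘ₗ f) := by
  constructor
  · rw [← hf.conv_comp, h.1, hf.counit_comp]
  · rw [← hf.conv_comp, h.2, hf.counit_comp]

/-- A quotient of a coalgebra is a coalgebra. -/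
theorem isCoalg_of_surjective (hf : IsCoalgMap Δ ε ΔD εD f) (hs : Function.Surjective f)
    (h : IsCoalg Δ ε) : IsCoalg ΔD εD := by
  have key : ∀ φ ψ : D →ₗ[K] K, φ ∘ₗ f = ψ ∘ₗ f → φ = ψ := fun φ ψ e =>
    (LinearMap.cancel_right hs).1 e
  refine IsCoalg.of_conv (fun a b c => key _ _ ?_) (fun a => key _ _ ?_) (fun a => key _ _ ?_)
  · simp only [hf.conv_comp, h.conv_assoc]
  · simp only [hf.conv_comp, hf.counit_comp, h.one_conv]
  · simp only [hf.conv_comp, hf.counit_comp, h.conv_one]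

end IsCoalgMap

/-! ### Tensor products of ordinary coalgebras -/

theorem tensorComul_tmul (c : C ⊗[K] D →ₗ[K] D ⊗[K] C) (ΔC : C →ₗ[K] C ⊗[K] C)
    (ΔD : D →ₗ[K] D ⊗[K] D) (x : C) (y : D) : tensorComul c ΔC ΔD (x ⊗ₜ y) =
    sw (ΔC x) fun x₁ x₂ => sw (ΔD y) fun y₁ y₂ => sw (c (x₂ ⊗ₜ y₁)) fun y' x' =>
      (x₁ ⊗ₜ y') ⊗ₜ (x' ⊗ₜ[K] y₂) := by
  simp only [tensorComul, middle, LinearMap.comp_apply, TensorProduct.map_tmul]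
  generalize ΔC x = t
  generalize ΔD y = t'
  revert t; apply lin_ext (by fun_prop) (by fun_prop); intro x₁ x₂
  rw [sw_tmul _ _ (by fun_prop) (by fun_prop)]
  revert t'; apply lin_ext (by fun_prop) (by fun_prop); intro y₁ y₂
  rw [sw_tmul _ _ (by fun_prop) (by fun_prop)]
  simp only [LinearEquiv.coe_coe, TensorProduct.assoc_tmul, LinearMap.lTensor_tmul,
    LinearMap.comp_apply, TensorProduct.assoc_symm_tmul, LinearMap.rTensor_tmul]
  generalize c (x₂ ⊗ₜ y₁) = t
  revert t; apply lin_ext (by fun_prop) (by fun_prop); intro y' x'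
  simp (disch := fun_prop) [sw_tmul]

theorem usualComul_tmul (ΔC : C →ₗ[K] C ⊗[K] C) (ΔD : D →ₗ[K] D ⊗[K] D) (x : C) (y : D) :
    usualComul ΔC ΔD (x ⊗ₜ y) =
      sw (ΔC x) fun x₁ x₂ => sw (ΔD y) fun y₁ y₂ => (x₁ ⊗ₜ y₁) ⊗ₜ (x₂ ⊗ₜ[K] y₂) := by
  rw [usualComul, tensorComul_tmul]
  simp (disch := fun_prop) only [LinearEquiv.coe_coe, TensorProduct.comm_tmul, sw_tmul]

theorem sw_usualComul (ΔC : C →ₗ[K] C ⊗[K] C) (ΔD : D →ₗ[K] D ⊗[K] D) (x : C) (y : D)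
    {F : C ⊗[K] D → C ⊗[K] D → M} (h₁ : ∀ b, Lin K (fun a => F a b)) (h₂ : ∀ a, Lin K (F a)) :
    sw (usualComul ΔC ΔD (x ⊗ₜ y)) F =
      sw (ΔC x) fun x₁ x₂ => sw (ΔD y) fun y₁ y₂ => F (x₁ ⊗ₜ y₁) (x₂ ⊗ₜ y₂) := by
  simp (disch := fun_prop) only [usualComul_tmul, sw_sw, sw_tmul]

theorem IsCoalg.tensor (hC : IsCoalg Δ ε) (hD : IsCoalg ΔD εD) :
    IsCoalg (usualComul Δ ΔD) (tensorFun ε εD) := by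
  -- Bundling the two coalgebras gives the axioms for their usual tensor product; its structure maps
  -- are then matched with `usualComul` and `tensorFun` on pure tensors.
  let _ : Coalgebra K C :=
    { comul := Δ, counit := ε, coassoc := LinearMap.ext hC.coassoc,
      rTensor_counit_comp_comul := LinearMap.ext hC.counit_left,
      lTensor_counit_comp_comul := LinearMap.ext hC.counit_right }
  let _ : Coalgebra K D :=
    { comul := ΔD, counit := εD, coassoc := LinearMap.ext hD.coassoc,
      rTensor_counit_comp_comul := LinearMap.ext hD.counit_left,
      lTensor_counit_comp_comul := LinearMap.ext hD.counit_right }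
  have e : (Coalgebra.comul : C ⊗[K] D →ₗ[K] _) = usualComul Δ ΔD := by
    refine TensorProduct.ext' fun x y => ?_
    rw [usualComul_tmul, TensorProduct.comul_tmul]
    change TensorProduct.AlgebraTensorModule.tensorTensorTensorComm K K K K C C D D
      (Δ x ⊗ₜ ΔD y) = _
    generalize Δ x = t
    generalize ΔD y = t'
    revert t; apply lin_ext (by fun_prop) (by fun_prop); intro x₁ x₂
    rw [sw_tmul _ _ (by fun_prop) (by fun_prop)]
    revert t'; apply lin_ext (by fun_prop) (by fun_prop); intro y₁ y₂
    rw [sw_tmul _ _ (by fun_prop) (by fun_prop)]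
    simp
  have e' : (Coalgebra.counit : C ⊗[K] D →ₗ[K] K) = tensorFun ε εD := by
    refine TensorProduct.ext' fun x y => ?_
    rw [TensorProduct.counit_tmul, tensorFun_tmul, mul_comm]
    rfl
  rw [← e, ← e']
  exact ⟨LinearMap.congr_fun Coalgebra.coassoc,
    LinearMap.congr_fun Coalgebra.rTensor_counit_comp_comul,
    LinearMap.congr_fun Coalgebra.lTensor_counit_comp_comul⟩

section TensorMaps

variable {ΔC' : C' →ₗ[K] C' ⊗[K] C'} {εC' : C' →ₗ[K] K}
variable {ΔD' : D' →ₗ[K] D' ⊗[K] D'} {εD' : D' →ₗ[K] K}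

/-- To check a coalgebra map out of a tensor product, pure tensors suffice. -/
theorem IsCoalgMap.of_tmul {f : C ⊗[K] D →ₗ[K] C'}
    (h₁ : ∀ x y, ΔC' (f (x ⊗ₜ y)) =
      sw (Δ x) fun x₁ x₂ => sw (ΔD y) fun y₁ y₂ => f (x₁ ⊗ₜ y₁) ⊗ₜ f (x₂ ⊗ₜ y₂))
    (h₂ : ∀ x y, εC' (f (x ⊗ₜ y)) = ε x * εD y) :
    IsCoalgMap (usualComul Δ ΔD) (tensorFun ε εD) ΔC' εC' f where
  comul := by
    apply lin_ext (by fun_prop) (by fun_prop); intro x y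
    rw [h₁, usualComul_tmul]
    simp only [linearMap_sw, TensorProduct.map_tmul]
  counit := by
    apply lin_ext (by fun_prop) (by fun_prop); intro x y
    rw [h₂, tensorFun_tmul]

theorem IsCoalgMap.map {f : C →ₗ[K] C'} {g : D →ₗ[K] D'} (hf : IsCoalgMap Δ ε ΔC' εC' f)
    (hg : IsCoalgMap ΔD εD ΔD' εD' g) :
    IsCoalgMap (usualComul Δ ΔD) (tensorFun ε εD) (usualComul ΔC' ΔD') (tensorFun εC' εD')
      (TensorProduct.map f g) := by
  refine of_tmul (fun x y => ?_) (fun x y => ?_)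
  · simp only [TensorProduct.map_tmul, usualComul_tmul]
    rw [hf.sw_comul _ (by fun_prop) (by fun_prop)]
    congr! 3
    rw [hg.sw_comul _ (by fun_prop) (by fun_prop)]
  · rw [TensorProduct.map_tmul, tensorFun_tmul, hf.counit, hg.counit]

theorem IsCoalgMap.lTensor {g : D →ₗ[K] D'} (hg : IsCoalgMap ΔD εD ΔD' εD' g) :
    IsCoalgMap (usualComul Δ ΔD) (tensorFun ε εD) (usualComul Δ ΔD') (tensorFun ε εD')
      (LinearMap.lTensor C g) :=
  IsCoalgMap.id.map hg

theorem IsCoalgMap.rTensor {f : C →ₗ[K] C'} (hf : IsCoalgMap Δ ε ΔC' εC' f) :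
    IsCoalgMap (usualComul Δ ΔD) (tensorFun ε εD) (usualComul ΔC' ΔD) (tensorFun εC' εD)
      (LinearMap.rTensor D f) :=
  hf.map IsCoalgMap.id

theorem isCoalgMap_assoc_symm : IsCoalgMap (usualComul Δ (usualComul ΔD ΔD'))
    (tensorFun ε (tensorFun εD εD')) (usualComul (usualComul Δ ΔD) ΔD')
    (tensorFun (tensorFun ε εD) εD') (TensorProduct.assoc K C D D').symm.toLinearMap := by
  refine IsCoalgMap.of_tmul (fun x y => ?_) (fun x y => ?_)
  · revert y; apply lin_ext (by fun_prop) (by fun_prop); intro y z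
    simp (disch := fun_prop) only [LinearEquiv.coe_coe, TensorProduct.assoc_symm_tmul,
      usualComul_tmul, sw_sw, sw_tmul]
  · revert y; apply lin_ext (by fun_prop) (by fun_prop); intro y z
    simp only [LinearEquiv.coe_coe, TensorProduct.assoc_symm_tmul, tensorFun_tmul, mul_assoc]

/-- `ε ⊗ D : C ⊗ D → D`. -/
def counitLeft (ε : C →ₗ[K] K) (D : Type*) [AddCommGroup D] [Module K D] : C ⊗[K] D →ₗ[K] D :=
  (TensorProduct.lid K D).toLinearMap ∘ₗ LinearMap.rTensor D ε

/-- `C ⊗ ε : C ⊗ D → C`. -/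
def counitRight (C : Type*) [AddCommGroup C] [Module K C] (ε : D →ₗ[K] K) : C ⊗[K] D →ₗ[K] C :=
  (TensorProduct.rid K C).toLinearMap ∘ₗ LinearMap.lTensor C ε

@[simp] theorem counitLeft_tmul (ε : C →ₗ[K] K) (x : C) (y : D) :
    counitLeft ε D (x ⊗ₜ y) = ε x • y := by simp [counitLeft]

@[simp] theorem counitRight_tmul (ε : D →ₗ[K] K) (x : C) (y : D) :
    counitRight C ε (x ⊗ₜ y) = ε y • x := by simp [counitRight]

/-- Padding a functional by a counit is pull-back along the coalgebra map `ε ⊗ D`, hence it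
preserves convolution products and inverses. -/
theorem tensorFun_eq_comp_counitLeft (ε : C →ₗ[K] K) (f : D →ₗ[K] K) :
    tensorFun ε f = f ∘ₗ counitLeft ε D := by
  refine TensorProduct.ext' fun x y => ?_
  simp [tensorFun_tmul]

theorem tensorFun_eq_comp_counitRight (f : C →ₗ[K] K) (ε : D →ₗ[K] K) :
    tensorFun f ε = f ∘ₗ counitRight C ε := by
  refine TensorProduct.ext' fun x y => ?_
  simp [tensorFun_tmul, mul_comm]

theorem isCoalgMap_counitLeft (hC : IsCoalg Δ ε) :
    IsCoalgMap (usualComul Δ ΔD) (tensorFun ε εD) ΔD εD (counitLeft ε D) := by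
  refine IsCoalgMap.of_tmul (fun x y => ?_) (fun x y => ?_)
  · simp only [counitLeft_tmul, map_smul, TensorProduct.smul_tmul_smul, mul_smul,
      ← smul_sw, sw_eta]
    rw [hC.sw_counit_left (F := fun x => ε x • ΔD y) x (by fun_prop)]
  · simp

theorem isCoalgMap_counitRight (hD : IsCoalg ΔD εD) :
    IsCoalgMap (usualComul Δ ΔD) (tensorFun ε εD) Δ ε (counitRight C εD) := by
  refine IsCoalgMap.of_tmul (fun x y => ?_) (fun x y => ?_)
  · simp only [counitRight_tmul, map_smul, TensorProduct.smul_tmul_smul, mul_smul]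
    rw [sw_comm]
    simp only [← smul_sw, sw_eta]
    rw [hD.sw_counit_left (F := fun y => εD y • Δ x) y (by fun_prop)]
  · simp [mul_comm]

/-- Together with `conv_counit_tensorFun`: functionals living on different factors commute under the
convolution of a usual tensor product. This is the only commutation that the pentagon needs. -/
theorem conv_tensorFun_counit (hC : IsCoalg Δ ε) (hD : IsCoalg ΔD εD) (f : C →ₗ[K] K)
    (g : D →ₗ[K] K) : conv (usualComul Δ ΔD) (tensorFun f εD) (tensorFun ε g) = tensorFun f g := by
  refine TensorProduct.ext' fun x y => ?_
  rw [conv_apply, sw_usualComul _ _ _ _ (by fun_prop) (by fun_prop)]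
  simp only [tensorFun_tmul]
  have e : ∀ x₁ x₂ y₁ y₂, f x₁ * εD y₁ * (ε x₂ * g y₂) = (ε x₂ • f x₁) * (εD y₁ • g y₂) := by
    intros; simp only [smul_eq_mul]; ring
  simp only [e, ← mul_sw, ← sw_mul, hD.sw_counit_left y (lin_linearMap g),
    hC.sw_counit_right x (lin_linearMap f)]

theorem conv_counit_tensorFun (hC : IsCoalg Δ ε) (hD : IsCoalg ΔD εD) (f : C →ₗ[K] K)
    (g : D →ₗ[K] K) : conv (usualComul Δ ΔD) (tensorFun ε g) (tensorFun f εD) = tensorFun f g := by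
  refine TensorProduct.ext' fun x y => ?_
  rw [conv_apply, sw_usualComul _ _ _ _ (by fun_prop) (by fun_prop)]
  simp only [tensorFun_tmul]
  have e : ∀ x₁ x₂ y₁ y₂, ε x₁ * g y₁ * (f x₂ * εD y₂) = (ε x₁ • f x₂) * (εD y₂ • g y₁) := by
    intros; simp only [smul_eq_mul]; ring
  simp only [e, ← mul_sw, ← sw_mul, hD.sw_counit_right y (lin_linearMap g),
    hC.sw_counit_left x (lin_linearMap f)]

end TensorMaps

end Coalg

/-! ### Twisting an associative coalgebra map by a functional -/

section Conj

variable {K : Type*} [Field K]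
variable {A C D M N : Type*} [AddCommGroup A] [Module K A]
  [AddCommGroup C] [Module K C] [AddCommGroup D] [Module K D]
  [AddCommGroup M] [Module K M] [AddCommGroup N] [Module K N]
variable {Δ : C →ₗ[K] C ⊗[K] C} {ε : C →ₗ[K] K} {ΔD : D →ₗ[K] D ⊗[K] D} {εD : D →ₗ[K] K}

/-- The map `v * g * v'`. -/
def conj (Δ : C →ₗ[K] C ⊗[K] C) (v : C →ₗ[K] K) (g : C →ₗ[K] M) (v' : C →ₗ[K] K) : C →ₗ[K] M :=
  convRight Δ (convLeft Δ v g) v'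

theorem comp_conj (L : M →ₗ[K] N) (v v' : C →ₗ[K] K) (g : C →ₗ[K] M) :
    L ∘ₗ conj Δ v g v' = conj Δ v (L ∘ₗ g) v' := by
  rw [conj, comp_convRight, comp_convLeft, conj]

theorem conj_eq_conv (v v' g : C →ₗ[K] K) : conj Δ v g v' = conv Δ (conv Δ v g) v' := by
  rw [conj, convLeft_eq_conv, convRight_eq_conv]

theorem conj_comp {f : C →ₗ[K] D} (hf : IsCoalgMap Δ ε ΔD εD f) (v v' : D →ₗ[K] K)
    (g : D →ₗ[K] M) : conj ΔD v g v' ∘ₗ f = conj Δ (v ∘ₗ f) (g ∘ₗ f) (v' ∘ₗ f) := by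
  apply dual_ext
  intro φ
  rw [← LinearMap.comp_assoc, comp_conj, comp_conj, conj_eq_conv, conj_eq_conv, hf.conv_comp,
    hf.conv_comp]
  rfl

theorem convLeft_conv (h : IsCoalg Δ ε) (a b : C →ₗ[K] K) (f : C →ₗ[K] M) :
    convLeft Δ (conv Δ a b) f = convLeft Δ a (convLeft Δ b f) := by
  apply dual_ext
  intro φ
  simp only [comp_convLeft, convLeft_eq_conv, h.conv_assoc]

/-- The counits on the extra factor `C` absorb its comultiplications, so padding a twisted map
amounts to twisting the padded map by the padded functionals. -/
theorem lTensor_conj (hC : IsCoalg Δ ε) (v v' : D →ₗ[K] K) (g : D →ₗ[K] M) :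
    LinearMap.lTensor C (conj ΔD v g v') =
      conj (usualComul Δ ΔD) (tensorFun ε v) (LinearMap.lTensor C g) (tensorFun ε v') := by
  have hl : ∀ (v : D →ₗ[K] K) (g : D →ₗ[K] M), LinearMap.lTensor C (convLeft ΔD v g) =
      convLeft (usualComul Δ ΔD) (tensorFun ε v) (LinearMap.lTensor C g) := fun v g => by
    refine TensorProduct.ext' fun x y => ?_
    rw [convLeft_apply, sw_usualComul _ _ _ _ (by fun_prop) (by fun_prop)]
    simp only [LinearMap.lTensor_tmul, convLeft_apply, tensorFun_tmul, mul_smul, ← smul_sw]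
    rw [hC.sw_counit_left x (F := fun x => sw (ΔD y) fun a b => v a • x ⊗ₜ[K] g b) (by fun_prop)]
    simp only [tmul_sw, TensorProduct.tmul_smul]
  have hr : ∀ (v : D →ₗ[K] K) (g : D →ₗ[K] M), LinearMap.lTensor C (convRight ΔD g v) =
      convRight (usualComul Δ ΔD) (LinearMap.lTensor C g) (tensorFun ε v) := fun v g => by
    refine TensorProduct.ext' fun x y => ?_
    rw [convRight_apply, sw_usualComul _ _ _ _ (by fun_prop) (by fun_prop)]
    simp only [LinearMap.lTensor_tmul, convRight_apply, tensorFun_tmul, mul_smul, ← smul_sw]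
    rw [hC.sw_counit_right x (F := fun x => sw (ΔD y) fun a b => v b • x ⊗ₜ[K] g a) (by fun_prop)]
    simp only [tmul_sw, TensorProduct.tmul_smul]
  rw [conj, hr, hl, conj]

theorem rTensor_conj (hD : IsCoalg ΔD εD) (v v' : C →ₗ[K] K) (g : C →ₗ[K] M) :
    LinearMap.rTensor D (conj Δ v g v') =
      conj (usualComul Δ ΔD) (tensorFun v εD) (LinearMap.rTensor D g) (tensorFun v' εD) := by
  have hl : ∀ (v : C →ₗ[K] K) (g : C →ₗ[K] M), LinearMap.rTensor D (convLeft Δ v g) =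
      convLeft (usualComul Δ ΔD) (tensorFun v εD) (LinearMap.rTensor D g) := fun v g => by
    refine TensorProduct.ext' fun x y => ?_
    rw [convLeft_apply, sw_usualComul _ _ _ _ (by fun_prop) (by fun_prop), sw_comm]
    simp only [LinearMap.rTensor_tmul, convLeft_apply, tensorFun_tmul, mul_comm (v _), mul_smul,
      ← smul_sw]
    rw [hD.sw_counit_left y (F := fun y => sw (Δ x) fun a b => v a • g b ⊗ₜ[K] y) (by fun_prop)]
    simp only [sw_tmul_const, TensorProduct.smul_tmul']
  have hr : ∀ (v : C →ₗ[K] K) (g : C →ₗ[K] M), LinearMap.rTensor D (convRight Δ g v) =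
      convRight (usualComul Δ ΔD) (LinearMap.rTensor D g) (tensorFun v εD) := fun v g => by
    refine TensorProduct.ext' fun x y => ?_
    rw [convRight_apply, sw_usualComul _ _ _ _ (by fun_prop) (by fun_prop), sw_comm]
    simp only [LinearMap.rTensor_tmul, convRight_apply, tensorFun_tmul, mul_comm (v _), mul_smul,
      ← smul_sw]
    rw [hD.sw_counit_right y (F := fun y => sw (Δ x) fun a b => v b • g a ⊗ₜ[K] y) (by fun_prop)]
    simp only [sw_tmul_const, TensorProduct.smul_tmul']
  rw [conj, hr, hl, conj]

/-- The conjugate of a coalgebra map is a coalgebra map. -/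
theorem IsCoalgMap.conj (hC : IsCoalg Δ ε) {v v' : C →ₗ[K] K} (hv : IsConvInverse Δ ε v v')
    {g : C →ₗ[K] D} (hg : IsCoalgMap Δ ε ΔD εD g) : IsCoalgMap Δ ε ΔD εD (conj Δ v g v') := by
  refine IsCoalgMap.of_conv (fun φ ψ => ?_) ?_
  · simp only [comp_conj, conj_eq_conv, hg.conv_comp]
    simp only [hC.conv_assoc]
    -- Between the two conjugated factors `v' * v` appears and cancels.
    rw [← hC.conv_assoc v', hv.2, hC.one_conv]
  · rw [comp_conj, conj_eq_conv, hg.counit_comp, hC.conv_one, hv.1]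

end Conj

/-- Both sides reduce to `a * b * c * i * j * d'`. On the left `a'` must pass `d` before `d' * d`,
`a' * a` and `e' * e` cancel. On the right the letters `f`, `g`, `h` cancel without any commutation.
The letters are the values of the functional and of its inverse on the products occurring in the
pentagon. -/
theorem pentagon_of_inverses {G : Type*} [Monoid G]
    {a a' b c d d' e e' f f' g g' h h' i j : G} (ha : a' * a = 1) (hd : d' * d = 1)
    (he : e' * e = 1) (hf : f' * f = 1) (hg : g' * g = 1) (hh : h' * h = 1)
    (had : a' * d = d * a') :
    a * ((b * c) * (e' * d')) * a' * (d * ((a * e) * (i * j)) * d') =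
      ((a * b) * (f' * g')) * (g * ((f * c) * (i * h')) * g') * ((g * h) * (j * d')) := by
  have ha' : ∀ x, a' * (a * x) = x := fun x => by rw [← mul_assoc, ha, one_mul]
  have hd' : ∀ x, d' * (d * x) = x := fun x => by rw [← mul_assoc, hd, one_mul]
  have he' : ∀ x, e' * (e * x) = x := fun x => by rw [← mul_assoc, he, one_mul]
  have hf' : ∀ x, f' * (f * x) = x := fun x => by rw [← mul_assoc, hf, one_mul]
  have hg' : ∀ x, g' * (g * x) = x := fun x => by rw [← mul_assoc, hg, one_mul]
  have hh' : ∀ x, h' * (h * x) = x := fun x => by rw [← mul_assoc, hh, one_mul]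
  have had' : ∀ x, a' * (d * x) = d * (a' * x) := fun x => by rw [← mul_assoc, had, mul_assoc]
  simp only [mul_assoc, had', ha', hd', he', hf', hg', hh']

/-! ### Coboundary twists: quasi-associativity, the pentagon, normalization -/

section Twist

variable {K : Type*} [Field K] {A : Type*} [AddCommGroup A] [Module K A]
  {Δ : A →ₗ[K] A ⊗[K] A} {ε : A →ₗ[K] K} {m : A ⊗[K] A →ₗ[K] A} {w w' : A ⊗[K] A →ₗ[K] K}

theorem isCoalgMap_idMul (hm : IsCoalgMap (usualComul Δ Δ) (tensorFun ε ε) Δ ε m) :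
    IsCoalgMap (usualComul Δ (usualComul Δ Δ)) (tensorFun ε (tensorFun ε ε))
      (usualComul Δ Δ) (tensorFun ε ε) (idMul m) :=
  hm.lTensor

theorem isCoalgMap_mulId (hm : IsCoalgMap (usualComul Δ Δ) (tensorFun ε ε) Δ ε m) :
    IsCoalgMap (usualComul Δ (usualComul Δ Δ)) (tensorFun ε (tensorFun ε ε))
      (usualComul Δ Δ) (tensorFun ε ε) (mulId m) :=
  hm.rTensor.comp isCoalgMap_assoc_symm

theorem isCoalgMap_mulIdId (hm : IsCoalgMap (usualComul Δ Δ) (tensorFun ε ε) Δ ε m) :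
    IsCoalgMap (usualComul Δ (usualComul Δ (usualComul Δ Δ)))
      (tensorFun ε (tensorFun ε (tensorFun ε ε)))
      (usualComul Δ (usualComul Δ Δ)) (tensorFun ε (tensorFun ε ε))
      (LinearMap.rTensor (A ⊗[K] A) m ∘ₗ
        (TensorProduct.assoc K A A (A ⊗[K] A)).symm.toLinearMap) :=
  hm.rTensor.comp isCoalgMap_assoc_symm

theorem idMul_conj (hA : IsCoalg Δ ε) (w w' : A ⊗[K] A →ₗ[K] K) (m : A ⊗[K] A →ₗ[K] A) :
    idMul (conj (usualComul Δ Δ) w m w') =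
      conj (usualComul Δ (usualComul Δ Δ)) (tensorFun ε w) (idMul m) (tensorFun ε w') :=
  lTensor_conj hA _ _ _

theorem mulId_conj (hA : IsCoalg Δ ε) (w w' : A ⊗[K] A →ₗ[K] K) (m : A ⊗[K] A →ₗ[K] A) :
    mulId (conj (usualComul Δ Δ) w m w') =
      conj (usualComul Δ (usualComul Δ Δ)) (tensorCounit w ε) (mulId m) (tensorCounit w' ε) := by
  rw [mulId, rTensor_conj hA,
    conj_comp (isCoalgMap_assoc_symm (Δ := Δ) (ε := ε) (ΔD := Δ) (εD := ε) (ΔD' := Δ) (εD' := ε))]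
  rfl

theorem IsConvInverse.counit_tensorFun {C D : Type*} [AddCommGroup C] [Module K C]
    [AddCommGroup D] [Module K D] {ΔC : C →ₗ[K] C ⊗[K] C} {εC : C →ₗ[K] K}
    {ΔD : D →ₗ[K] D ⊗[K] D} {εD : D →ₗ[K] K} (hC : IsCoalg ΔC εC) {f g : D →ₗ[K] K}
    (h : IsConvInverse ΔD εD f g) :
    IsConvInverse (usualComul ΔC ΔD) (tensorFun εC εD) (tensorFun εC f) (tensorFun εC g) := by
  rw [tensorFun_eq_comp_counitLeft εC f, tensorFun_eq_comp_counitLeft εC g]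
  exact (isCoalgMap_counitLeft hC).isConvInverse_comp h

theorem IsConvInverse.tensorFun_counit {C D : Type*} [AddCommGroup C] [Module K C]
    [AddCommGroup D] [Module K D] {ΔC : C →ₗ[K] C ⊗[K] C} {εC : C →ₗ[K] K}
    {ΔD : D →ₗ[K] D ⊗[K] D} {εD : D →ₗ[K] K} (hD : IsCoalg ΔD εD) {f g : C →ₗ[K] K}
    (h : IsConvInverse ΔC εC f g) :
    IsConvInverse (usualComul ΔC ΔD) (tensorFun εC εD) (tensorFun f εD) (tensorFun g εD) := by
  rw [tensorFun_eq_comp_counitRight f, tensorFun_eq_comp_counitRight g]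
  exact (isCoalgMap_counitRight hD).isConvInverse_comp h

theorem IsConvInverse.tensorCounit (hA : IsCoalg Δ ε)
    (h : IsConvInverse (usualComul Δ Δ) (tensorFun ε ε) w w') :
    IsConvInverse (usualComul Δ (usualComul Δ Δ)) (tensorFun ε (tensorFun ε ε))
      (tensorCounit w ε) (tensorCounit w' ε) :=
  isCoalgMap_assoc_symm.isConvInverse_comp (h.tensorFun_counit hA)

theorem IsConvInverse.symm {C : Type*} [AddCommGroup C] [Module K C] {ΔC : C →ₗ[K] C ⊗[K] C}
    {εC f g : C →ₗ[K] K} (h : IsConvInverse ΔC εC f g) : IsConvInverse ΔC εC g f :=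
  ⟨h.2, h.1⟩

theorem coboundary₂_eq (hA : IsCoalg Δ ε)
    (hw : IsConvInverse (usualComul Δ Δ) (tensorFun ε ε) w w') :
    coboundary₂ Δ ε m w =
      conv (usualComul Δ (usualComul Δ Δ))
        (conv (usualComul Δ (usualComul Δ Δ)) (tensorFun ε w) (w ∘ₗ idMul m))
        (conv (usualComul Δ (usualComul Δ Δ)) (w' ∘ₗ mulId m) (tensorCounit w' ε)) := by
  simp only [coboundary₂, (hA.tensor hA).convInv_eq hw]

/-- The twisted multiplication is associative up to the coboundary. -/
theorem quasi_assoc_conj (hA : IsCoalg Δ ε)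
    (hm : IsCoalgMap (usualComul Δ Δ) (tensorFun ε ε) Δ ε m) (hassoc : m ∘ₗ idMul m = m ∘ₗ mulId m)
    (hw : IsConvInverse (usualComul Δ Δ) (tensorFun ε ε) w w') :
    convRight (usualComul Δ (usualComul Δ Δ))
        (conj (usualComul Δ Δ) w m w' ∘ₗ idMul (conj (usualComul Δ Δ) w m w'))
        (coboundary₂ Δ ε m w) =
      convLeft (usualComul Δ (usualComul Δ Δ)) (coboundary₂ Δ ε m w)
        (conj (usualComul Δ Δ) w m w' ∘ₗ mulId (conj (usualComul Δ Δ) w m w')) := by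
  rw [coboundary₂_eq hA hw]
  have h2 := hA.tensor hA
  have hmw := IsCoalgMap.conj h2 hw hm
  apply dual_ext
  intro φ
  rw [comp_convLeft, comp_convRight, convLeft_eq_conv, convRight_eq_conv,
    conj_comp (isCoalgMap_idMul hmw), conj_comp (isCoalgMap_mulId hmw), comp_conj, comp_conj,
    ← LinearMap.comp_assoc, ← LinearMap.comp_assoc, idMul_conj hA, mulId_conj hA]
  simp only [comp_conj, conj_eq_conv, LinearMap.comp_assoc, hassoc]
  have h3 := hA.tensor h2
  have ha := hw.counit_tensorFun hA
  have hd := hw.tensorCounit hA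
  have hb := (isCoalgMap_idMul hm).isConvInverse_comp hw
  have hc := (isCoalgMap_mulId hm).isConvInverse_comp hw
  let _ := h3.convMonoid
  have c1 : ∀ {x y : A ⊗[K] (A ⊗[K] A) →ₗ[K] K}, x * y = 1 → ∀ z, x * (y * z) = z := by
    intro x y h z; rw [← mul_assoc, h, one_mul]
  generalize tensorFun ε w = a at *
  generalize tensorFun ε w' = a' at *
  generalize tensorCounit w ε = d at *
  generalize tensorCounit w' ε = d' at *
  generalize w ∘ₗ idMul m = b at *
  generalize w' ∘ₗ idMul m = b' at *
  generalize w ∘ₗ mulId m = c at *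
  generalize w' ∘ₗ mulId m = c' at *
  generalize φ ∘ₗ m ∘ₗ mulId m = x at *
  -- Both sides are now words in the convolution monoid and reduce to `a * b * x * c' * d'`.
  -- Associativity of `m` makes the middle letter `x` the same on both sides.
  change (((a * b * a') * (a * x * a')) * (a * b' * a')) * ((a * b) * (c' * d')) =
    ((a * b) * (c' * d')) * (((d * c * d') * (d * x * d')) * (d * c' * d'))
  simp only [mul_assoc, c1 ha.2, c1 hb.2, c1 hd.2, c1 hc.2]

theorem ext_fourfold {A B C D M : Type*} [AddCommGroup A] [Module K A] [AddCommGroup B]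
    [Module K B] [AddCommGroup C] [Module K C] [AddCommGroup D] [Module K D] [AddCommGroup M]
    [Module K M] {f g : A ⊗[K] (B ⊗[K] (C ⊗[K] D)) →ₗ[K] M}
    (h : ∀ a b c d, f (a ⊗ₜ (b ⊗ₜ (c ⊗ₜ d))) = g (a ⊗ₜ (b ⊗ₜ (c ⊗ₜ d)))) : f = g := by
  refine TensorProduct.ext' fun a x => ?_
  revert x; apply lin_ext (by fun_prop) (by fun_prop); intro b x
  revert x; apply lin_ext (by fun_prop) (by fun_prop); intro c d
  exact h a b c d

theorem ext_threefold {A B C M : Type*} [AddCommGroup A] [Module K A] [AddCommGroup B]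
    [Module K B] [AddCommGroup C] [Module K C] [AddCommGroup M]
    [Module K M] {f g : A ⊗[K] (B ⊗[K] C) →ₗ[K] M}
    (h : ∀ a b c, f (a ⊗ₜ (b ⊗ₜ c)) = g (a ⊗ₜ (b ⊗ₜ c))) : f = g := by
  refine TensorProduct.ext' fun a x => ?_
  revert x; apply lin_ext (by fun_prop) (by fun_prop); intro b c
  exact h a b c

@[simp] theorem idMul_tmul (m : A ⊗[K] A →ₗ[K] A) (a b c : A) :
    idMul m (a ⊗ₜ (b ⊗ₜ c)) = a ⊗ₜ m (b ⊗ₜ c) := rfl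

@[simp] theorem mulId_tmul (m : A ⊗[K] A →ₗ[K] A) (a b c : A) :
    mulId m (a ⊗ₜ (b ⊗ₜ c)) = m (a ⊗ₜ b) ⊗ₜ c := rfl

@[simp] theorem tensorCounit_tmul (w : A ⊗[K] A →ₗ[K] K) (ε : A →ₗ[K] K) (a b c : A) :
    tensorCounit w ε (a ⊗ₜ (b ⊗ₜ c)) = w (a ⊗ₜ b) * ε c := by
  simp [tensorCounit, tensorFun_tmul]

@[simp] theorem tensorCounit₃_tmul (α : A ⊗[K] (A ⊗[K] A) →ₗ[K] K) (ε : A →ₗ[K] K)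
    (a b c d : A) :
    tensorCounit₃ α ε (a ⊗ₜ (b ⊗ₜ (c ⊗ₜ d))) = α (a ⊗ₜ (b ⊗ₜ c)) * ε d := by
  simp [tensorCounit₃, tensorFun_tmul]

/-- `E ⊗ E ⊗ E ⊗ ε : E ⊗ (E ⊗ (E ⊗ E)) → E ⊗ (E ⊗ E)`. -/
def counitLast (ε : A →ₗ[K] K) : A ⊗[K] (A ⊗[K] (A ⊗[K] A)) →ₗ[K] A ⊗[K] (A ⊗[K] A) :=
  LinearMap.lTensor A (LinearMap.lTensor A (counitRight A ε))

theorem tensorCounit₃_eq (α : A ⊗[K] (A ⊗[K] A) →ₗ[K] K) (ε : A →ₗ[K] K) :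
    tensorCounit₃ α ε = α ∘ₗ counitLast ε :=
  ext_fourfold fun a b c d => by
    simp [counitLast, mul_comm, TensorProduct.tmul_smul]

theorem isCoalgMap_counitLast (hA : IsCoalg Δ ε) :
    IsCoalgMap (usualComul Δ (usualComul Δ (usualComul Δ Δ)))
      (tensorFun ε (tensorFun ε (tensorFun ε ε)))
      (usualComul Δ (usualComul Δ Δ)) (tensorFun ε (tensorFun ε ε)) (counitLast ε) :=
  (isCoalgMap_counitRight hA).lTensor.lTensor

/-- The coboundary satisfies the `3`-cocycle condition for the twisted multiplication. -/
theorem pentagon_conj (hA : IsCoalg Δ ε)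
    (hm : IsCoalgMap (usualComul Δ Δ) (tensorFun ε ε) Δ ε m) (hassoc : m ∘ₗ idMul m = m ∘ₗ mulId m)
    (hw : IsConvInverse (usualComul Δ Δ) (tensorFun ε ε) w w') :
    let Δ₄ := usualComul Δ (usualComul Δ (usualComul Δ Δ))
    let mw := conj (usualComul Δ Δ) w m w'
    let α := coboundary₂ Δ ε m w
    conv Δ₄ (α ∘ₗ LinearMap.lTensor A (LinearMap.lTensor A mw))
        (α ∘ₗ LinearMap.rTensor (A ⊗[K] A) mw ∘ₗ
          (TensorProduct.assoc K A A (A ⊗[K] A)).symm.toLinearMap) =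
      conv Δ₄ (conv Δ₄ (tensorFun ε α) (α ∘ₗ LinearMap.lTensor A (mulId mw)))
        (tensorCounit₃ α ε) := by
  intro Δ₄ mw α
  have h2 := hA.tensor hA
  have h3 := hA.tensor h2
  have h4 := hA.tensor h3
  have hα : α = _ := coboundary₂_eq hA hw
  have g1 := (isCoalgMap_idMul hm).lTensor (Δ := Δ) (ε := ε)
  have g2 := isCoalgMap_mulIdId hm
  have g3 := (isCoalgMap_mulId hm).lTensor (Δ := Δ) (ε := ε)
  have g4 := isCoalgMap_counitLeft (ΔD := usualComul Δ (usualComul Δ Δ))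
    (εD := tensorFun ε (tensorFun ε ε)) hA
  have g5 := isCoalgMap_counitLast hA
  have e1 : LinearMap.lTensor A (LinearMap.lTensor A mw) =
      conj Δ₄ (tensorFun ε (tensorFun ε w)) (LinearMap.lTensor A (idMul m))
        (tensorFun ε (tensorFun ε w')) := by
    change LinearMap.lTensor A (idMul mw) = _
    rw [idMul_conj hA, lTensor_conj hA]
  have e2 : LinearMap.rTensor (A ⊗[K] A) mw ∘ₗ
      (TensorProduct.assoc K A A (A ⊗[K] A)).symm.toLinearMap = _ :=
    (congrArg (· ∘ₗ (TensorProduct.assoc K A A (A ⊗[K] A)).symm.toLinearMap)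
      (rTensor_conj h2 w w' m)).trans (conj_comp
        (isCoalgMap_assoc_symm (ε := ε) (εD := ε) (εD' := tensorFun ε ε)) _ _ _)
  have e3 : LinearMap.lTensor A (mulId mw) = _ :=
    (congrArg (LinearMap.lTensor A) (mulId_conj hA w w' m)).trans (lTensor_conj hA _ _ _)
  rw [e1, e2, e3, tensorFun_eq_comp_counitLeft ε α, tensorCounit₃_eq]
  simp only [comp_conj, conj_eq_conv]
  rw [hα]
  simp only [g1.conv_comp, g2.conv_comp, g3.conv_comp, g4.conv_comp, g5.conv_comp]
  have hε : ∀ a b, ε (m (a ⊗ₜ b)) = ε a * ε b := fun a b => by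
    rw [hm.counit, tensorFun_tmul]
  have hmm : ∀ a b c, m (a ⊗ₜ m (b ⊗ₜ c)) = m (m (a ⊗ₜ b) ⊗ₜ c) := fun a b c =>
    LinearMap.congr_fun hassoc (a ⊗ₜ (b ⊗ₜ c))
  -- `G₁`, …, `G₅` are the maps `A⁴ → A³` along which the five copies of `α` are pulled back. Each
  -- copy expands into four letters, and `s₁`–`s₁₃` identify or simplify letters coming from
  -- different faces. Associativity of `m` enters only in `s₇` and `s₈`; the remaining
  -- identifications use at most counitality.
  set J := (TensorProduct.assoc K A A (A ⊗[K] A)).symm.toLinearMap with hJ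
  set G₁ := LinearMap.lTensor A (idMul m) with hG₁
  set G₂ := LinearMap.rTensor (A ⊗[K] A) m ∘ₗ J with hG₂
  set G₃ := LinearMap.lTensor A (mulId m) with hG₃
  set G₄ := counitLeft ε (A ⊗[K] (A ⊗[K] A)) with hG₄
  set G₅ := counitLast ε with hG₅
  have s₁ : tensorFun ε w ∘ₗ G₁ = (w ∘ₗ idMul m) ∘ₗ G₄ := ext_fourfold fun a b c d => by
    simp [hG₁, hG₄, tensorFun_tmul]
  have s₂ : (w' ∘ₗ mulId m) ∘ₗ G₁ = (w' ∘ₗ idMul m) ∘ₗ G₂ := ext_fourfold fun a b c d => by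
    simp [hG₁, hG₂, hJ]
  have s₃ : tensorCounit w' ε ∘ₗ G₁ = tensorFun w' (tensorFun ε ε) ∘ₗ J :=
    ext_fourfold fun a b c d => by
      simp [hG₁, hJ, tensorFun_tmul, hε]
  have s₄ : tensorFun ε w ∘ₗ G₂ = tensorFun ε (tensorFun ε w) := ext_fourfold fun a b c d => by
    simp [hG₂, hJ, tensorFun_tmul, hε, mul_assoc]
  have s₅ : tensorCounit w' ε ∘ₗ G₂ = (w' ∘ₗ mulId m) ∘ₗ G₅ := ext_fourfold fun a b c d => by
    simp [hG₂, hJ, hG₅, counitLast, TensorProduct.tmul_smul, mul_comm]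
  have s₆ : tensorFun ε w ∘ₗ G₃ = (w ∘ₗ mulId m) ∘ₗ G₄ := ext_fourfold fun a b c d => by
    simp [hG₃, hG₄, tensorFun_tmul]
  have s₇ : (w ∘ₗ idMul m) ∘ₗ G₃ = (w ∘ₗ idMul m) ∘ₗ G₁ := ext_fourfold fun a b c d => by
    simp [hG₁, hG₃, hmm]
  have s₈ : (w' ∘ₗ mulId m) ∘ₗ G₃ = (w' ∘ₗ mulId m) ∘ₗ G₂ := ext_fourfold fun a b c d => by
    simp [hG₂, hG₃, hJ, hmm]
  have s₉ : tensorCounit w' ε ∘ₗ G₃ = (w' ∘ₗ idMul m) ∘ₗ G₅ := ext_fourfold fun a b c d => by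
    simp [hG₃, hG₅, counitLast, TensorProduct.tmul_smul, mul_comm]
  have s₁₀ : tensorFun ε w ∘ₗ G₄ = tensorFun ε (tensorFun ε w) :=
    (tensorFun_eq_comp_counitLeft ε (tensorFun ε w)).symm
  have s₁₁ : tensorCounit w' ε ∘ₗ G₄ = tensorFun ε (tensorCounit w' ε) :=
    (tensorFun_eq_comp_counitLeft ε (tensorCounit w' ε)).symm
  have s₁₂ : tensorFun ε w ∘ₗ G₅ = tensorFun ε (tensorCounit w ε) := ext_fourfold fun a b c d => by
    simp [hG₅, counitLast, TensorProduct.tmul_smul, mul_comm, tensorFun_tmul, mul_left_comm]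
  have s₁₃ : tensorCounit w' ε ∘ₗ G₅ = tensorFun w' (tensorFun ε ε) ∘ₗ J :=
    ext_fourfold fun a b c d => by
      simp [hG₅, hJ, counitLast, TensorProduct.tmul_smul, tensorFun_tmul]
      ring
  rw [s₁, s₂, s₃, s₄, s₅, s₆, s₇, s₈, s₉, s₁₀, s₁₁, s₁₂, s₁₃]
  have ha := (hw.counit_tensorFun hA).counit_tensorFun hA
  have hd := isCoalgMap_assoc_symm.isConvInverse_comp (hw.tensorFun_counit h2)
  have he := g2.isConvInverse_comp ((isCoalgMap_idMul hm).isConvInverse_comp hw)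
  have hf := g4.isConvInverse_comp ((isCoalgMap_mulId hm).isConvInverse_comp hw)
  have hg := (hw.tensorCounit hA).counit_tensorFun hA
  have hh := g5.isConvInverse_comp ((isCoalgMap_idMul hm).isConvInverse_comp hw)
  -- One functional lives on the last two tensor factors and the other on the first two.
  have hcomm : conv Δ₄ (tensorFun ε (tensorFun ε w')) (tensorFun w (tensorFun ε ε) ∘ₗ J) =
      conv Δ₄ (tensorFun w (tensorFun ε ε) ∘ₗ J) (tensorFun ε (tensorFun ε w')) := by
    have hJm : IsCoalgMap Δ₄ (tensorFun ε (tensorFun ε (tensorFun ε ε))) _ _ J :=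
      isCoalgMap_assoc_symm (εD' := tensorFun ε ε)
    have e : tensorFun ε (tensorFun ε w') = tensorFun (tensorFun ε ε) w' ∘ₗ J :=
      ext_fourfold fun a b c d => by simp [hJ, tensorFun_tmul, mul_assoc]
    rw [e, ← hJm.conv_comp, ← hJm.conv_comp, conv_counit_tensorFun h2 h2,
      conv_tensorFun_counit h2 h2]
  let _ := h4.convMonoid
  exact pentagon_of_inverses ha.2 hd.2 he.2 hf.2 hg.2 hh.2 hcomm

/-! Values of the coboundary at a group-like unit. -/

section Unit

variable {D : Type*} [AddCommGroup D] [Module K D] {ΔD : D →ₗ[K] D ⊗[K] D} {εD : D →ₗ[K] K}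

theorem isCoalgMap_mk {e : A} (he : Δ e = e ⊗ₜ e) (he' : ε e = 1) :
    IsCoalgMap ΔD εD (usualComul Δ ΔD) (tensorFun ε εD) (TensorProduct.mk K A D e) where
  comul y := by
    simp (disch := fun_prop) only [TensorProduct.mk_apply, usualComul_tmul, he, sw_tmul]
    conv_rhs => rw [← sw_eta (ΔD y), linearMap_sw]
    rfl
  counit y := by simp [tensorFun_tmul, he']

theorem isCoalgMap_mk_flip {e : A} (he : Δ e = e ⊗ₜ e) (he' : ε e = 1) :
    IsCoalgMap ΔD εD (usualComul ΔD Δ) (tensorFun εD ε) ((TensorProduct.mk K D A).flip e) where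
  comul y := by
    simp (disch := fun_prop) only [LinearMap.flip_apply, TensorProduct.mk_apply, usualComul_tmul,
      he, sw_tmul]
    conv_rhs => rw [← sw_eta (ΔD y), linearMap_sw]
    rfl
  counit y := by simp [tensorFun_tmul, he']

/-- An inverse of a normalized functional is normalized. -/
theorem IsConvInverse.normalized {E : Type*} [AddCommGroup E] [Module K E]
    {ΔE : E →ₗ[K] E ⊗[K] E} {εE f f' : E →ₗ[K] K} (hD : IsCoalg ΔD εD)
    (h : IsConvInverse ΔE εE f f') {j : D →ₗ[K] E} (hj : IsCoalgMap ΔD εD ΔE εE j)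
    (hf : f ∘ₗ j = εD) : f' ∘ₗ j = εD := by
  rw [← hD.one_conv (f' ∘ₗ j), ← hf, ← hj.conv_comp, h.1, hj.counit_comp, hf]

variable {e : A}

/-- Inserting a group-like `e` in one slot is a coalgebra map, so it may be applied to the four
factors of `∂²(w)` separately. Two of them become counits and the other two become `w` and `w'`,
which cancel. -/
theorem coboundary₂_unit (hA : IsCoalg Δ ε) (he : Δ e = e ⊗ₜ e) (he' : ε e = 1)
    (hl : ∀ a, m (e ⊗ₜ a) = a) (hr : ∀ a, m (a ⊗ₜ e) = a)
    (hm : IsCoalgMap (usualComul Δ Δ) (tensorFun ε ε) Δ ε m)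
    (hw : IsConvInverse (usualComul Δ Δ) (tensorFun ε ε) w w')
    (hwl : ∀ a, w' (e ⊗ₜ a) = ε a) (hwr : ∀ a, w' (a ⊗ₜ e) = ε a) (a b : A) :
    coboundary₂ Δ ε m w (e ⊗ₜ (a ⊗ₜ b)) = ε a * ε b ∧
    coboundary₂ Δ ε m w (a ⊗ₜ (e ⊗ₜ b)) = ε a * ε b ∧
    coboundary₂ Δ ε m w (a ⊗ₜ (b ⊗ₜ e)) = ε a * ε b := by
  have h2 := hA.tensor hA
  have hε : ∀ a b, ε (m (a ⊗ₜ b)) = ε a * ε b := fun a b => by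
    rw [hm.counit, tensorFun_tmul]
  have wl : ∀ a, w (e ⊗ₜ a) = ε a := LinearMap.congr_fun
    (hw.symm.normalized hA (isCoalgMap_mk he he') (LinearMap.ext hwl))
  have wr : ∀ a, w (a ⊗ₜ e) = ε a := LinearMap.congr_fun
    (hw.symm.normalized hA (isCoalgMap_mk_flip he he') (LinearMap.ext hwr))
  have j₁ := isCoalgMap_mk (ΔD := usualComul Δ Δ) (εD := tensorFun ε ε) he he'
  have j₂ := (isCoalgMap_mk (ΔD := Δ) (εD := ε) he he').lTensor (Δ := Δ) (ε := ε)
  have j₃ := (isCoalgMap_mk_flip (ΔD := Δ) (εD := ε) he he').lTensor (Δ := Δ) (ε := ε)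
  have key : ∀ (f : A ⊗[K] (A ⊗[K] A) →ₗ[K] K) (j : A ⊗[K] A →ₗ[K] A ⊗[K] (A ⊗[K] A)),
      f ∘ₗ j = tensorFun ε ε → f (j (a ⊗ₜ b)) = ε a * ε b := fun f j h => by
    rw [← LinearMap.comp_apply, h, tensorFun_tmul]
  rw [coboundary₂_eq hA hw]
  refine ⟨?_, ?_, ?_⟩
  · refine key _ (TensorProduct.mk K A (A ⊗[K] A) e) ?_
    have e₁ : tensorFun ε w ∘ₗ TensorProduct.mk K A (A ⊗[K] A) e = w :=
      TensorProduct.ext' fun a b => by simp [tensorFun_tmul, he']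
    have e₂ : (w ∘ₗ idMul m) ∘ₗ TensorProduct.mk K A (A ⊗[K] A) e = tensorFun ε ε :=
      TensorProduct.ext' fun a b => by simp [tensorFun_tmul, wl, hε]
    have e₃ : (w' ∘ₗ mulId m) ∘ₗ TensorProduct.mk K A (A ⊗[K] A) e = w' :=
      TensorProduct.ext' fun a b => by simp [hl]
    have e₄ : tensorCounit w' ε ∘ₗ TensorProduct.mk K A (A ⊗[K] A) e = tensorFun ε ε :=
      TensorProduct.ext' fun a b => by simp [tensorFun_tmul, hwl]
    simp only [j₁.conv_comp, e₁, e₂, e₃, e₄, h2.conv_one, hw.1]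
  · refine key _ (LinearMap.lTensor A (TensorProduct.mk K A A e)) ?_
    have e₁ : tensorFun ε w ∘ₗ LinearMap.lTensor A (TensorProduct.mk K A A e) = tensorFun ε ε :=
      TensorProduct.ext' fun a b => by simp [tensorFun_tmul, wl]
    have e₂ : (w ∘ₗ idMul m) ∘ₗ LinearMap.lTensor A (TensorProduct.mk K A A e) = w :=
      TensorProduct.ext' fun a b => by simp [hl]
    have e₃ : (w' ∘ₗ mulId m) ∘ₗ LinearMap.lTensor A (TensorProduct.mk K A A e) = w' :=
      TensorProduct.ext' fun a b => by simp [hr]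
    have e₄ : tensorCounit w' ε ∘ₗ LinearMap.lTensor A (TensorProduct.mk K A A e) =
        tensorFun ε ε :=
      TensorProduct.ext' fun a b => by simp [tensorFun_tmul, hwr]
    simp only [j₂.conv_comp, e₁, e₂, e₃, e₄, h2.conv_one, h2.one_conv, hw.1]
  · refine key _ (LinearMap.lTensor A ((TensorProduct.mk K A A).flip e)) ?_
    have e₁ : tensorFun ε w ∘ₗ LinearMap.lTensor A ((TensorProduct.mk K A A).flip e) =
        tensorFun ε ε :=
      TensorProduct.ext' fun a b => by simp [tensorFun_tmul, wr]
    have e₂ : (w ∘ₗ idMul m) ∘ₗ LinearMap.lTensor A ((TensorProduct.mk K A A).flip e) = w :=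
      TensorProduct.ext' fun a b => by simp [hr]
    have e₃ : (w' ∘ₗ mulId m) ∘ₗ LinearMap.lTensor A ((TensorProduct.mk K A A).flip e) =
        tensorFun ε ε :=
      TensorProduct.ext' fun a b => by simp [tensorFun_tmul, hwr, hε]
    have e₄ : tensorCounit w' ε ∘ₗ LinearMap.lTensor A ((TensorProduct.mk K A A).flip e) = w' :=
      TensorProduct.ext' fun a b => by simp [he']
    simp only [j₃.conv_comp, e₁, e₂, e₃, e₄, h2.one_conv, hw.1]

end Unit

end Twist

/-! ### Sweedler forms of the structure maps -/

section Forms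


theorem sw_congr {K : Type*} [Field K] {M N P : Type*} [AddCommGroup M] [Module K M]
    [AddCommGroup N] [Module K N] [AddCommGroup P] {t : M ⊗[K] N} {f g : M → N → P}
    (h : ∀ a b, f a b = g a b) : sw t f = sw t g := by
  rw [funext fun a => funext (h a)]

variable {K : Type*} [Field K] {H : Type*} [Ring H] [HopfAlgebra K H]
local notation "δ" => CoalgebraStruct.comul (R := K)
local notation "ϵ" => CoalgebraStruct.counit (R := K)

variable {V W M : Type*} [AddCommGroup V] [Module K V] [AddCommGroup W] [Module K W]
  [AddCommGroup M] [Module K M]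

theorem isCoalg_hopf (K : Type*) [Field K] (H : Type*) [Ring H] [HopfAlgebra K H] :
    IsCoalg (Coalgebra.comul : H →ₗ[K] H ⊗[K] H) Coalgebra.counit :=
  ⟨LinearMap.congr_fun Coalgebra.coassoc,
    LinearMap.congr_fun Coalgebra.rTensor_counit_comp_comul,
    LinearMap.congr_fun Coalgebra.lTensor_counit_comp_comul⟩

theorem sw_comul_mul (g h : H) {F : H → H → M} (h₁ : ∀ b, Lin K (fun a => F a b))
    (h₂ : ∀ a, Lin K (F a)) :
    sw (δ (g * h)) F =
      sw (δ g) fun g₁ g₂ => sw (δ h) fun k₁ k₂ =>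
        F (g₁ * k₁) (g₂ * k₂) := by
  rw [Bialgebra.comul_mul]
  generalize δ g = t
  generalize δ h = t'
  revert t; apply lin_ext (by fun_prop) (by fun_prop); intro x₁ x₂
  rw [sw_tmul _ _ (by fun_prop) (by fun_prop)]
  revert t'; apply lin_ext (by fun_prop) (by fun_prop); intro y₁ y₂
  simp (disch := fun_prop) only [sw_tmul, Algebra.TensorProduct.tmul_mul_tmul]

theorem sw_comul_one {F : H → H → M} (h₁ : ∀ b, Lin K (fun a => F a b))
    (h₂ : ∀ a, Lin K (F a)) : sw (δ (1 : H)) F = F 1 1 := by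
  rw [Bialgebra.comul_one, Algebra.TensorProduct.one_def, sw_tmul _ _ h₁ h₂]

theorem sw_antipode_mul (h : H) :
    (sw (δ h) fun a b => HopfAlgebra.antipode K a * b) =
      ϵ h • (1 : H) := by
  have := HopfAlgebra.mul_antipode_rTensor_comul_apply (R := K) h
  rw [Algebra.algebraMap_eq_smul_one] at this
  rw [← this]
  generalize δ h = t
  revert t; apply lin_ext (by fun_prop) (by fun_prop); intro x₁ x₂
  simp (disch := fun_prop) [sw_tmul]

theorem sandwich_tmul (a b x : H) : sandwich K H (a ⊗ₜ b) x = a * x * b := by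
  simp [sandwich, mul_assoc]

theorem leftAdjoint_apply (h x : H) :
    leftAdjoint K H h x = sw (δ h) fun a b => a * x * HopfAlgebra.antipode K b := by
  simp only [leftAdjoint, LinearMap.comp_apply]
  generalize δ h = t
  revert t; apply lin_ext (by fun_prop) (by fun_prop); intro x₁ x₂
  simp (disch := fun_prop) only [sw_tmul, LinearMap.lTensor_tmul, sandwich_tmul]

theorem braiding_tmul (coact : V →ₗ[K] H ⊗[K] V) (act : H →ₗ[K] W →ₗ[K] W) (v : V) (w : W) :
    braiding coact act (v ⊗ₜ w) = sw (coact v) fun k v₀ => act k w ⊗ₜ v₀ := by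
  simp only [braiding, LinearMap.comp_apply, LinearMap.rTensor_tmul]
  generalize coact v = t
  revert t; apply lin_ext (by fun_prop) (by fun_prop); intro x₁ x₂
  simp (disch := fun_prop) [sw_tmul]

theorem tensorAct_tmul (actV : H →ₗ[K] V →ₗ[K] V) (actW : H →ₗ[K] W →ₗ[K] W) (h : H) (v : V)
    (w : W) : tensorAct actV actW h (v ⊗ₜ w) =
      sw (δ h) fun h₁ h₂ => actV h₁ v ⊗ₜ actW h₂ w := by
  simp only [tensorAct, LinearMap.comp_apply]
  generalize δ h = t
  revert t; apply lin_ext (by fun_prop) (by fun_prop); intro x₁ x₂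
  simp (disch := fun_prop) [sw_tmul]

theorem tensorCoact_tmul (coactV : V →ₗ[K] H ⊗[K] V) (coactW : W →ₗ[K] H ⊗[K] W) (v : V) (w : W) :
    tensorCoact coactV coactW (v ⊗ₜ w) =
      sw (coactV v) fun k v₀ => sw (coactW w) fun l w₀ => (k * l) ⊗ₜ (v₀ ⊗ₜ w₀) := by
  simp only [tensorCoact, LinearMap.comp_apply, TensorProduct.map_tmul]
  generalize coactV v = t
  generalize coactW w = t'
  revert t; apply lin_ext (by fun_prop) (by fun_prop); intro x₁ x₂
  rw [sw_tmul _ _ (by fun_prop) (by fun_prop)]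
  revert t'; apply lin_ext (by fun_prop) (by fun_prop); intro y₁ y₂
  simp (disch := fun_prop) [sw_tmul]

theorem ydAct_apply (act : H →ₗ[K] V →ₗ[K] V) (h : H) (t : H ⊗[K] V) :
    ydAct act h t = sw (δ h) fun x c => sw (δ x) fun a b =>
      sw t fun g v => (a * g * HopfAlgebra.antipode K c) ⊗ₜ act b v := by
  simp only [ydAct, LinearMap.comp_apply]
  revert t; apply lin_ext (by fun_prop) (by fun_prop); intro g v
  simp (disch := fun_prop) only [sw_tmul]
  generalize δ h = t
  revert t; apply lin_ext (by fun_prop) (by fun_prop); intro x c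
  simp (disch := fun_prop) only [sw_tmul, LinearMap.rTensor_tmul]
  generalize δ x = t
  revert t; apply lin_ext (by fun_prop) (by fun_prop); intro a b
  simp (disch := fun_prop) [sw_tmul, sandwich_tmul]

namespace YDCoalgebraData.IsCoalgebra

variable {C : Type*} [AddCommGroup C] [Module K C] {X : YDCoalgebraData K H C}

theorem isCoalg (hX : X.IsCoalgebra) : IsCoalg X.comul X.counit :=
  ⟨LinearMap.congr_fun hX.coassoc, LinearMap.congr_fun hX.rTensor_counit,
    LinearMap.congr_fun hX.lTensor_counit⟩

theorem sw_coact_coassoc (hX : X.IsCoalgebra) (c : C) {F : H → H → C → M}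
    (h₁ : ∀ b c, Lin K (fun a => F a b c)) (h₂ : ∀ a c, Lin K (fun b => F a b c))
    (h₃ : ∀ a b, Lin K (F a b)) :
    (sw (X.coact c) fun h d => sw (δ h) fun h₁ h₂ => F h₁ h₂ d) =
      sw (X.coact c) fun h d => sw (X.coact d) fun k e => F h k e := by
  have := congrArg (fun t => sw t fun a s => sw s (F a)) (LinearMap.congr_fun hX.coact_coassoc c)
  simp (disch := fun_prop) only [LinearMap.comp_apply, LinearEquiv.coe_coe, sw_assoc, sw_lTensor,
    sw_rTensor] at this
  exact this

theorem sw_coact_counit (hX : X.IsCoalgebra) (c : C) {F : C → M} (hF : Lin K F) :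
    (sw (X.coact c) fun h d => ϵ h • F d) = F c := by
  have := congrArg (fun t => sw t fun (a : K) b => a • F b)
    (LinearMap.congr_fun hX.coact_counit c)
  simp (disch := fun_prop) only [LinearMap.comp_apply, sw_rTensor, TensorProduct.mk_apply,
    sw_tmul] at this
  simpa using this

theorem comul_act (hX : X.IsCoalgebra) (h : H) (c : C) : X.comul (X.act h c) =
    sw (δ h) fun h₁ h₂ => sw (X.comul c) fun c₁ c₂ =>
      X.act h₁ c₁ ⊗ₜ X.act h₂ c₂ := by
  rw [hX.comul_linear]
  change tensorAct X.act X.act h _ = _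
  generalize X.comul c = t
  revert t; apply lin_ext (by fun_prop) (by fun_prop); intro a b
  simp (disch := fun_prop) only [sw_tmul, tensorAct_tmul]

theorem sw_coact_comul (hX : X.IsCoalgebra) (c : C) {F : H → C → C → M}
    (h₁ : ∀ b c, Lin K (fun a => F a b c)) (h₂ : ∀ a c, Lin K (fun b => F a b c))
    (h₃ : ∀ a b, Lin K (F a b)) :
    (sw (X.coact c) fun h d => sw (X.comul d) fun d₁ d₂ => F h d₁ d₂) =
      sw (X.comul c) fun c₁ c₂ => sw (X.coact c₁) fun h d₁ => sw (X.coact c₂) fun k d₂ =>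
        F (h * k) d₁ d₂ := by
  have := congrArg (fun t => sw t fun a s => sw s (F a))
    (LinearMap.congr_fun hX.comul_colinear c)
  simp (disch := fun_prop) only [LinearMap.comp_apply, sw_lTensor] at this
  rw [← this]
  change sw (tensorCoact X.coact X.coact (X.comul c)) _ = _
  generalize X.comul c = t
  revert t; apply lin_ext (by fun_prop) (by fun_prop); intro a b
  simp (disch := fun_prop) only [sw_tmul, tensorCoact_tmul, sw_sw]

theorem counit_act (hX : X.IsCoalgebra) (h : H) (c : C) :
    X.counit (X.act h c) = ϵ h * X.counit c :=
  hX.counit_linear h c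

theorem sw_coact_counit' (hX : X.IsCoalgebra) (c : C) {F : H → M} (hF : Lin K F) :
    (sw (X.coact c) fun h d => X.counit d • F h) = X.counit c • F 1 := by
  have := congrArg (fun t => sw t fun h (k : K) => k • F h)
    (LinearMap.congr_fun hX.counit_colinear c)
  simp (disch := fun_prop) only [LinearMap.comp_apply, sw_lTensor] at this
  rw [← this]
  change sw ((1 : H) ⊗ₜ[K] X.counit c) _ = _
  rw [sw_tmul _ _ (by fun_prop) (by fun_prop)]

/-- The Yetter-Drinfeld condition `(h₁ c)₋₁ h₂ ⊗ (h₁ c)₀ = h₁ c₋₁ ⊗ h₂ c₀`. -/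
theorem sw_coact_act (hX : X.IsCoalgebra) (h : H) (c : C) {F : H → C → M}
    (h₁ : ∀ b, Lin K (fun a => F a b)) (h₂ : ∀ a, Lin K (F a)) :
    (sw (δ h) fun h₁ h₂ => sw (X.coact (X.act h₁ c)) fun k d => F (k * h₂) d) =
      sw (δ h) fun h₁ h₂ => sw (X.coact c) fun k d => F (h₁ * k) (X.act h₂ d) := by
  simp (disch := fun_prop) only [hX.yetter_drinfeld, ydAct_apply, sw_sw, sw_tmul]
  -- Regrouping brings the antipode `S(h₃)` of the Yetter-Drinfeld formula next to the extra factor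
  -- `h₄`, and `S(h₃) h₄` collapses to a counit.
  rw [(isCoalg_hopf K H).sw_coassoc h (F := fun x q z => sw (δ x) fun a b =>
    sw (X.coact c) fun g v => F (a * g * HopfAlgebra.antipode K q * z) (X.act b v))
    (by fun_prop) (by fun_prop) (by fun_prop)]
  have e : ∀ x y : H, (sw (δ y) fun q z => sw (δ x) fun a b =>
      sw (X.coact c) fun g v => F (a * g * HopfAlgebra.antipode K q * z) (X.act b v)) =
      ϵ y • (sw (δ x) fun a b =>
        sw (X.coact c) fun g v => F (a * g) (X.act b v)) := fun x y => by
    have hL : Lin K (fun s : H => sw (δ x) fun a b =>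
      sw (X.coact c) fun g v => F (a * g * s) (X.act b v)) := by fun_prop
    have := map_sw hL (δ y) (fun q z => HopfAlgebra.antipode K q * z)
    rw [sw_antipode_mul, hL.smul] at this
    simp only [← mul_assoc, mul_one] at this
    exact this.symm
  simp only [e]
  rw [(isCoalg_hopf K H).sw_counit_right h (F := fun x => sw (δ x) fun a b =>
      sw (X.coact c) fun g v => F (a * g) (X.act b v)) (by fun_prop)]

end YDCoalgebraData.IsCoalgebra

end Forms

/-! ### Moving an inner Sweedler sum to the front -/

section SwComm

variable {K : Type*} [Field K] {M₁ N₁ M₂ N₂ M₃ N₃ M₄ N₄ M N P : Type*}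
  [AddCommGroup M₁] [Module K M₁] [AddCommGroup N₁] [Module K N₁]
  [AddCommGroup M₂] [Module K M₂] [AddCommGroup N₂] [Module K N₂]
  [AddCommGroup M₃] [Module K M₃] [AddCommGroup N₃] [Module K N₃]
  [AddCommGroup M₄] [Module K M₄] [AddCommGroup N₄] [Module K N₄]
  [AddCommGroup M] [Module K M] [AddCommGroup N] [Module K N] [AddCommGroup P]

theorem sw_comm₂ (t₁ : M₁ ⊗[K] N₁) (t₂ : M₁ → N₁ → M₂ ⊗[K] N₂) (s : M ⊗[K] N)
    (F : M₁ → N₁ → M₂ → N₂ → M → N → P) :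
    (sw t₁ fun a b => sw (t₂ a b) fun c d => sw s fun x y => F a b c d x y) =
      sw s fun x y => sw t₁ fun a b => sw (t₂ a b) fun c d => F a b c d x y :=
  (sw_congr fun _ _ => sw_comm _ _ _).trans (sw_comm _ _ _)

theorem sw_comm₃ (t₁ : M₁ ⊗[K] N₁) (t₂ : M₁ → N₁ → M₂ ⊗[K] N₂)
    (t₃ : M₁ → N₁ → M₂ → N₂ → M₃ ⊗[K] N₃) (s : M ⊗[K] N)
    (F : M₁ → N₁ → M₂ → N₂ → M₃ → N₃ → M → N → P) :
    (sw t₁ fun a b => sw (t₂ a b) fun c d => sw (t₃ a b c d) fun e f => sw s fun x y =>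
      F a b c d e f x y) =
      sw s fun x y => sw t₁ fun a b => sw (t₂ a b) fun c d => sw (t₃ a b c d) fun e f =>
        F a b c d e f x y :=
  (sw_congr fun _ _ => sw_comm₂ _ _ _ _).trans (sw_comm _ _ _)

theorem sw_comm₄ (t₁ : M₁ ⊗[K] N₁) (t₂ : M₁ → N₁ → M₂ ⊗[K] N₂)
    (t₃ : M₁ → N₁ → M₂ → N₂ → M₃ ⊗[K] N₃)
    (t₄ : M₁ → N₁ → M₂ → N₂ → M₃ → N₃ → M₄ ⊗[K] N₄) (s : M ⊗[K] N)
    (F : M₁ → N₁ → M₂ → N₂ → M₃ → N₃ → M₄ → N₄ → M → N → P) :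
    (sw t₁ fun a b => sw (t₂ a b) fun c d => sw (t₃ a b c d) fun e f =>
      sw (t₄ a b c d e f) fun g h => sw s fun x y => F a b c d e f g h x y) =
      sw s fun x y => sw t₁ fun a b => sw (t₂ a b) fun c d => sw (t₃ a b c d) fun e f =>
        sw (t₄ a b c d e f) fun g h => F a b c d e f g h x y :=
  (sw_congr fun _ _ => sw_comm₃ _ _ _ _ _).trans (sw_comm _ _ _)

end SwComm

/-! ### The smash coproduct -/

section Smash

variable {K : Type*} [Field K] {H : Type*} [Ring H] [HopfAlgebra K H]

local notation "δ" => CoalgebraStruct.comul (R := K)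
local notation "ϵ" => CoalgebraStruct.counit (R := K)

variable {R M : Type*} [AddCommGroup R] [Module K R] [AddCommGroup M] [Module K M]
  {X : YDCoalgebraData K H R}

theorem smashComul_tmul (X : YDCoalgebraData K H R) (r : R) (h : H) : smashComul X (r ⊗ₜ h) =
    sw (X.comul r) fun r₁ r₂ => sw (X.coact r₂) fun k r₀ => sw (δ h) fun h₁ h₂ =>
      (r₁ ⊗ₜ (k * h₁)) ⊗ₜ (r₀ ⊗ₜ h₂) := by
  rw [smashComul, tensorComul_tmul]
  simp (disch := fun_prop) only [braidRH, braiding_tmul, sw_sw, sw_tmul, LinearMap.mul_apply']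
  exact sw_congr fun r₁ r₂ => sw_comm _ _ _

theorem sw_smashComul (X : YDCoalgebraData K H R) (r : R) (h : H) {F : R ⊗[K] H → R ⊗[K] H → M}
    (h₁ : ∀ b, Lin K (fun a => F a b)) (h₂ : ∀ a, Lin K (F a)) :
    sw (smashComul X (r ⊗ₜ h)) F =
      sw (X.comul r) fun r₁ r₂ => sw (X.coact r₂) fun k r₀ => sw (δ h) fun h₁ h₂ =>
        F (r₁ ⊗ₜ (k * h₁)) (r₀ ⊗ₜ h₂) := by
  simp (disch := fun_prop) only [smashComul_tmul, sw_sw, sw_tmul]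

theorem smashCounit_tmul (X : YDCoalgebraData K H R) (r : R) (h : H) :
    smashCounit X (r ⊗ₜ h) = X.counit r * ϵ h :=
  tensorFun_tmul _ _ _ _

/-- Coassociativity combines coassociativity of `R` and `H`, multiplicativity of `Δ_H`, and the fact
that `Δ_R` and the coaction are compatible. -/
theorem isCoalg_smash (hX : X.IsCoalgebra) : IsCoalg (smashComul X) (smashCounit X) := by
  refine IsCoalg.of_conv (fun f g k => ?_) (fun f => ?_) (fun f => ?_)
  · refine TensorProduct.ext' fun r h => ?_
    rw [conv_apply, conv_apply, sw_smashComul _ _ _ (by fun_prop) (by fun_prop),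
      sw_smashComul _ _ _ (by fun_prop) (by fun_prop)]
    simp only [conv_apply, mul_sw, sw_mul]
    simp (disch := fun_prop) only [sw_smashComul]
    simp (disch := fun_prop) only [sw_comul_mul]
    -- A common normal form, reached from the left bracketing by coassociativity of `Δ_R` and `Δ_H`,
    -- and from the right one by colinearity of `Δ_R` and coassociativity of the coaction.
    trans sw (X.comul r) fun a y => sw (X.comul y) fun b c => sw (X.coact b) fun l b₀ =>
      sw (X.coact c) fun q c₀ => sw (δ q) fun q₁ q₂ => sw (δ h) fun h₁ z => sw (δ z) fun h₂ h₃ =>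
        f (a ⊗ₜ (l * (q₁ * h₁))) * g (b₀ ⊗ₜ (q₂ * h₂)) * k (c₀ ⊗ₜ h₃)
    · rw [← hX.isCoalg.sw_coassoc r (by fun_prop) (by fun_prop) (by fun_prop)]
      refine sw_congr fun y c => ?_
      refine (sw_comm₂ _ _ _ _).trans ?_
      refine sw_congr fun a b => ?_
      refine (sw_comm₂ _ _ _ _).trans ?_
      refine sw_congr fun l b₀ => sw_congr fun q c₀ => (sw_comm _ _ _).trans ?_
      refine sw_congr fun q₁ q₂ => ?_
      rw [← (isCoalg_hopf K H).sw_coassoc h (by fun_prop) (by fun_prop) (by fun_prop)]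
    · refine sw_congr fun a y => ?_
      refine Eq.trans ?_ (sw_congr fun _ _ => sw_comm _ _ _).symm
      rw [hX.sw_coact_comul y (by fun_prop) (by fun_prop) (by fun_prop)]
      refine sw_congr fun b c => sw_congr fun l b₀ => ?_
      rw [hX.sw_coact_coassoc c (by fun_prop) (by fun_prop) (by fun_prop)]
      refine sw_congr fun q d => ?_
      refine (sw_comm _ _ _).trans (sw_congr fun h₁ z => sw_congr fun q' c₀ =>
        sw_congr fun h₂ h₃ => ?_)
      simp only [mul_assoc]
  · refine TensorProduct.ext' fun r h => ?_
    rw [conv_apply, sw_smashComul _ _ _ (by fun_prop) (by fun_prop)]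
    simp only [smashCounit_tmul, Bialgebra.counit_mul, mul_assoc, ← mul_sw]
    simp only [← smul_eq_mul]
    rw [hX.isCoalg.sw_counit_left r (by fun_prop)]
    rw [hX.sw_coact_counit r (by fun_prop), (isCoalg_hopf K H).sw_counit_left h (by fun_prop)]
  · refine TensorProduct.ext' fun r h => ?_
    rw [conv_apply, sw_smashComul _ _ _ (by fun_prop) (by fun_prop)]
    have e : ∀ (r₁ : R) (k : H) (r₀ : R), (sw (δ h) fun h₁ h₂ =>
        f (r₁ ⊗ₜ (k * h₁)) * smashCounit X (r₀ ⊗ₜ h₂)) = X.counit r₀ • f (r₁ ⊗ₜ (k * h)) := by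
      intro r₁ k r₀
      rw [← (isCoalg_hopf K H).sw_counit_right h
        (F := fun x => X.counit r₀ • f (r₁ ⊗ₜ (k * x))) (by fun_prop)]
      refine sw_congr fun h₁ h₂ => ?_
      simp only [smashCounit_tmul, smul_eq_mul]
      ring
    simp only [e]
    have e' : ∀ r₁ r₂ : R, (sw (X.coact r₂) fun k r₀ => X.counit r₀ • f (r₁ ⊗ₜ[K] (k * h))) =
        X.counit r₂ • f (r₁ ⊗ₜ (1 * h)) := fun r₁ r₂ =>
      hX.sw_coact_counit' r₂ (F := fun k => f (r₁ ⊗ₜ[K] (k * h))) (by fun_prop)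
    simp only [e', one_mul]
    rw [hX.isCoalg.sw_counit_right r (by fun_prop)]

/-- `D` is a left `H`-module coalgebra. -/
structure IsModuleCoalg {D : Type*} [AddCommGroup D] [Module K D] (act : H →ₗ[K] D →ₗ[K] D)
    (ΔD : D →ₗ[K] D ⊗[K] D) (εD : D →ₗ[K] K) : Prop where
  coalg : IsCoalg ΔD εD
  one_act : ∀ d, act 1 d = d
  mul_act : ∀ g h d, act (g * h) d = act g (act h d)
  comul_act : ∀ h d, ΔD (act h d) =
    sw (δ h) fun h₁ h₂ => sw (ΔD d) fun d₁ d₂ => act h₁ d₁ ⊗ₜ act h₂ d₂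
  counit_act : ∀ h d, εD (act h d) = ϵ h * εD d

theorem YDCoalgebraData.IsCoalgebra.isModuleCoalg (hX : X.IsCoalgebra) :
    IsModuleCoalg X.act X.comul X.counit :=
  ⟨hX.isCoalg, hX.one_act, hX.mul_act, hX.comul_act, hX.counit_act⟩

/-- The left action `h (r # l) = h₁ r # h₂ l`. -/
def smashAct (X : YDCoalgebraData K H R) : H →ₗ[K] R ⊗[K] H →ₗ[K] R ⊗[K] H :=
  tensorAct X.act (LinearMap.mul K H)

theorem smashAct_tmul (X : YDCoalgebraData K H R) (h : H) (r : R) (l : H) :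
    smashAct X h (r ⊗ₜ l) = sw (δ h) fun h₁ h₂ => X.act h₁ r ⊗ₜ (h₂ * l) :=
  tensorAct_tmul _ _ _ _ _

section TensorModule

variable {V W : Type*} [AddCommGroup V] [Module K V] [AddCommGroup W] [Module K W]
  {actV : H →ₗ[K] V →ₗ[K] V} {actW : H →ₗ[K] W →ₗ[K] W}

theorem tensorAct_one (hV : ∀ v, actV 1 v = v) (hW : ∀ w, actW 1 w = w) (x : V ⊗[K] W) :
    tensorAct actV actW 1 x = x := by
  revert x; apply lin_ext (by fun_prop) (by fun_prop); intro v w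
  rw [tensorAct_tmul, sw_comul_one (by fun_prop) (by fun_prop), hV, hW]

theorem tensorAct_mul (hV : ∀ g h v, actV (g * h) v = actV g (actV h v))
    (hW : ∀ g h w, actW (g * h) w = actW g (actW h w)) (g h : H) (x : V ⊗[K] W) :
    tensorAct actV actW (g * h) x = tensorAct actV actW g (tensorAct actV actW h x) := by
  revert x; apply lin_ext (by fun_prop) (by fun_prop); intro v w
  rw [tensorAct_tmul, sw_comul_mul _ _ (by fun_prop) (by fun_prop), tensorAct_tmul, linearMap_sw]
  simp only [tensorAct_tmul, hV, hW]
  rw [sw_comm]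

end TensorModule

/-- The Yetter-Drinfeld condition, in the antipode-free form `sw_coact_act`, lets the action pass
through the coaction occurring in the smash coproduct. The other ingredients are coassociativity of
`H` and linearity of `Δ_R`. -/
theorem isModuleCoalg_smash (hX : X.IsCoalgebra) :
    IsModuleCoalg (smashAct X) (smashComul X) (smashCounit X) where
  coalg := isCoalg_smash hX
  one_act := tensorAct_one hX.one_act (by simp)
  mul_act := tensorAct_mul hX.mul_act (by simp [mul_assoc])
  comul_act h := by
    apply lin_ext (by fun_prop) (by fun_prop); intro r l
    simp (disch := fun_prop) only [smashAct_tmul, linearMap_sw, smashComul_tmul, hX.comul_act,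
      sw_sw, sw_tmul, sw_comul_mul]
    simp only [tmul_sw, sw_tmul_const]
    trans sw (X.comul r) fun r₁ r₂ => sw (δ l) fun l₁ l₂ => sw (δ h) fun a z =>
      sw (δ z) fun w d => sw (δ w) fun b c => sw (X.coact r₂) fun k r₀ =>
        (X.act a r₁ ⊗ₜ ((b * k) * l₁)) ⊗ₜ (X.act c r₀ ⊗ₜ (d * l₂))
    · refine (sw_comm₂ _ _ _ _).trans (sw_congr fun r₁ r₂ => ?_)
      refine (sw_comm₄ _ _ _ _ _ _).trans (sw_congr fun l₁ l₂ => ?_)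
      rw [(isCoalg_hopf K H).sw_coassoc h (by fun_prop) (by fun_prop) (by fun_prop)]
      refine sw_congr fun a z => ?_
      refine (sw_congr fun _ _ => sw_comm _ _ _).trans ?_
      rw [← (isCoalg_hopf K H).sw_coassoc z (by fun_prop) (by fun_prop) (by fun_prop)]
      refine sw_congr fun w d => ?_
      simp only [← mul_assoc]
      exact hX.sw_coact_act w r₂ (F := fun k r₀ =>
        (X.act a r₁ ⊗ₜ[K] (k * l₁)) ⊗ₜ[K] (r₀ ⊗ₜ[K] (d * l₂))) (by fun_prop) (by fun_prop)
    · refine Eq.trans (sw_congr fun r₁ r₂ => ?_) (sw_comm _ _ _)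
      refine Eq.trans (sw_congr fun l₁ l₂ => ?_) (sw_comm₂ _ _ _ _).symm
      refine Eq.trans ?_ (sw_congr fun x y => (sw_comm₂ _ _ _ _).symm)
      rw [(isCoalg_hopf K H).sw_coassoc h (by fun_prop) (by fun_prop) (by fun_prop)]
      refine sw_congr fun a z => ?_
      refine Eq.trans ?_ (sw_congr fun x y => sw_comm _ _ _)
      rw [← (isCoalg_hopf K H).sw_coassoc z (by fun_prop) (by fun_prop) (by fun_prop)]
      refine sw_congr fun w d => sw_congr fun b c => sw_congr fun k r₀ => ?_
      simp only [mul_assoc]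
  counit_act h := by
    apply lin_ext (by fun_prop) (by fun_prop); intro r l
    rw [smashAct_tmul, linearMap_sw, smashCounit_tmul]
    simp only [smashCounit_tmul, hX.counit_act, Bialgebra.counit_mul]
    rw [← (isCoalg_hopf K H).sw_counit_left h (F := fun x => ϵ x * (X.counit r * ϵ l))
      (by fun_prop)]
    refine sw_congr fun a b => ?_
    simp only [smul_eq_mul]
    ring

end Smash

/-! ### The projection `(R # H) ⊗ D → R ⊗ D` -/

section ActFirst

variable {K : Type*} [Field K] {H : Type*} [Ring H] [HopfAlgebra K H]

local notation "δ" => CoalgebraStruct.comul (R := K)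
local notation "ϵ" => CoalgebraStruct.counit (R := K)

variable {R D E M : Type*} [AddCommGroup R] [Module K R] [AddCommGroup M] [Module K M]
  [AddCommGroup D] [Module K D] [AddCommGroup E] [Module K E]
  {X : YDCoalgebraData K H R} {act : H →ₗ[K] D →ₗ[K] D} {ΔD : D →ₗ[K] D ⊗[K] D} {εD : D →ₗ[K] K}

/-- `(r # h) ⊗ d ↦ r ⊗ h d`. -/
def actFirst (R : Type*) [AddCommGroup R] [Module K R] (act : H →ₗ[K] D →ₗ[K] D) :
    (R ⊗[K] H) ⊗[K] D →ₗ[K] R ⊗[K] D :=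
  LinearMap.lTensor R (TensorProduct.lift act) ∘ₗ (TensorProduct.assoc K R H D).toLinearMap

@[simp] theorem actFirst_tmul (act : H →ₗ[K] D →ₗ[K] D) (r : R) (h : H) (d : D) :
    actFirst R act ((r ⊗ₜ h) ⊗ₜ d) = r ⊗ₜ act h d := by
  simp [actFirst]

theorem actFirst_surjective (h1 : ∀ d, act 1 d = d) : Function.Surjective (actFirst R act) := by
  intro y
  refine ⟨LinearMap.rTensor D ((TensorProduct.mk K R H).flip 1) y, ?_⟩
  revert y; apply lin_ext (by fun_prop) (by fun_prop); intro r d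
  simp [h1]

theorem actFirst_natural {actE : H →ₗ[K] E →ₗ[K] E} {f : D →ₗ[K] E}
    (hf : ∀ h d, f (act h d) = actE h (f d)) (a : R ⊗[K] H) (d : D) :
    LinearMap.lTensor R f (actFirst R act (a ⊗ₜ d)) = actFirst R actE (a ⊗ₜ f d) := by
  revert a; apply lin_ext (by fun_prop) (by fun_prop); intro r h
  simp [hf]

/-- The braided comultiplication on `R ⊗ D`. -/
def braidComul (X : YDCoalgebraData K H R) (act : H →ₗ[K] D →ₗ[K] D) (ΔD : D →ₗ[K] D ⊗[K] D) :
    R ⊗[K] D →ₗ[K] (R ⊗[K] D) ⊗[K] (R ⊗[K] D) :=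
  tensorComul (braiding X.coact act) X.comul ΔD

theorem braidComul_tmul (X : YDCoalgebraData K H R) (act : H →ₗ[K] D →ₗ[K] D)
    (ΔD : D →ₗ[K] D ⊗[K] D) (r : R) (d : D) : braidComul X act ΔD (r ⊗ₜ d) =
      sw (X.comul r) fun r₁ r₂ => sw (ΔD d) fun d₁ d₂ => sw (X.coact r₂) fun k r₀ =>
        (r₁ ⊗ₜ act k d₁) ⊗ₜ (r₀ ⊗ₜ d₂) := by
  rw [braidComul, tensorComul_tmul]
  simp (disch := fun_prop) only [braiding_tmul, sw_sw, sw_tmul]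

theorem sw_braidComul (X : YDCoalgebraData K H R) (act : H →ₗ[K] D →ₗ[K] D)
    (ΔD : D →ₗ[K] D ⊗[K] D) (r : R) (d : D) {F : R ⊗[K] D → R ⊗[K] D → M}
    (h₁ : ∀ b, Lin K (fun a => F a b)) (h₂ : ∀ a, Lin K (F a)) :
    sw (braidComul X act ΔD (r ⊗ₜ d)) F =
      sw (X.comul r) fun r₁ r₂ => sw (ΔD d) fun d₁ d₂ => sw (X.coact r₂) fun k r₀ =>
        F (r₁ ⊗ₜ act k d₁) (r₀ ⊗ₜ d₂) := by
  simp (disch := fun_prop) only [braidComul_tmul, sw_sw, sw_tmul]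

/-- In `Δ_A(r # h)` the coaction of the second leg of `r` is multiplied into the `H`-part of the
first leg. Letting that part act on the first leg of `d` reproduces the braiding, so the braided
coalgebra is a quotient of an ordinary one. -/
theorem isCoalgMap_actFirst (X : YDCoalgebraData K H R) (hD : IsModuleCoalg act ΔD εD) :
    IsCoalgMap (usualComul (smashComul X) ΔD) (tensorFun (smashCounit X) εD)
      (braidComul X act ΔD) (tensorFun X.counit εD) (actFirst R act) := by
  refine IsCoalgMap.of_tmul (fun a d => ?_) (fun a d => ?_)
  · revert a; apply lin_ext (by fun_prop) (by fun_prop); intro r h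
    rw [actFirst_tmul, sw_smashComul _ _ _ (by fun_prop) (by fun_prop), braidComul_tmul]
    simp (disch := fun_prop) only [actFirst_tmul, hD.comul_act, sw_sw, sw_tmul, hD.mul_act]
    refine sw_congr fun r₁ r₂ => (sw_comm₂ _ _ _ _)
  · revert a; apply lin_ext (by fun_prop) (by fun_prop); intro r h
    rw [actFirst_tmul, tensorFun_tmul, hD.counit_act, smashCounit_tmul, mul_assoc]

theorem actFirst_smashAct (X : YDCoalgebraData K H R) (hD : IsModuleCoalg act ΔD εD) (h : H)
    (a : R ⊗[K] H) (d : D) :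
    actFirst R act (smashAct X h a ⊗ₜ d) = tensorAct X.act act h (actFirst R act (a ⊗ₜ d)) := by
  revert a; apply lin_ext (by fun_prop) (by fun_prop); intro r l
  simp only [smashAct_tmul, sw_tmul_const, linearMap_sw, actFirst_tmul, tensorAct_tmul, hD.mul_act]

/-- The coalgebra laws descend along the surjection `actFirst`. The result is again a module
coalgebra, so the construction can be iterated to all tensor powers of `R`. -/
theorem isModuleCoalg_braid (hX : X.IsCoalgebra) (hD : IsModuleCoalg act ΔD εD) :
    IsModuleCoalg (tensorAct X.act act) (braidComul X act ΔD) (tensorFun X.counit εD) where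
  coalg := (isCoalgMap_actFirst X hD).isCoalg_of_surjective (actFirst_surjective hD.one_act)
    ((isCoalg_smash hX).tensor hD.coalg)
  one_act := tensorAct_one hX.one_act hD.one_act
  mul_act := tensorAct_mul hX.mul_act hD.mul_act
  comul_act h := by
    have hP := isCoalgMap_actFirst X hD
    apply lin_ext (by fun_prop) (by fun_prop); intro r d
    -- A lift to `A ⊗ D`, where the coproduct is the ordinary one and `H` acts on the first factor
    -- alone.
    have e : r ⊗ₜ[K] d = actFirst R act ((r ⊗ₜ 1) ⊗ₜ d) := by rw [actFirst_tmul, hD.one_act]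
    rw [e, ← actFirst_smashAct X hD, hP.comul_eq_sw]
    simp (disch := fun_prop) only [hP.sw_comul, sw_usualComul, sw_sw, sw_tmul,
      (isModuleCoalg_smash hX).comul_act, actFirst_smashAct X hD]
  counit_act h := by
    apply lin_ext (by fun_prop) (by fun_prop); intro r d
    rw [tensorAct_tmul, linearMap_sw, tensorFun_tmul]
    simp only [tensorFun_tmul, hX.counit_act, hD.counit_act]
    rw [← (isCoalg_hopf K H).sw_counit_left h (F := fun x => ϵ x * (X.counit r * εD d))
      (by fun_prop)]
    refine sw_congr fun a b => ?_
    simp only [smul_eq_mul]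
    ring

end ActFirst

/-! ### The projections `A^{⊗ n} → R^{⊗ n}` -/

section Proj

variable {K : Type*} [Field K] {H : Type*} [Ring H] [HopfAlgebra K H]

local notation "δ" => CoalgebraStruct.comul (R := K)
local notation "ϵ" => CoalgebraStruct.counit (R := K)

variable {R M : Type*} [AddCommGroup R] [Module K R] [AddCommGroup M] [Module K M]
  {X : YDCoalgebraData K H R}

/-- `r # h ↦ r ε(h)`. -/
def smashFst (K : Type*) [Field K] (R : Type*) [AddCommGroup R] [Module K R] (H : Type*) [Ring H]
    [HopfAlgebra K H] : R ⊗[K] H →ₗ[K] R :=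
  counitRight R CoalgebraStruct.counit

/-- `r # h ↦ ε(r) h`. -/
def smashSnd (X : YDCoalgebraData K H R) : R ⊗[K] H →ₗ[K] H :=
  counitLeft X.counit H

@[simp] theorem smashFst_tmul (r : R) (h : H) : smashFst K R H (r ⊗ₜ h) = ϵ h • r :=
  counitRight_tmul _ _ _

@[simp] theorem smashSnd_tmul (r : R) (h : H) : smashSnd X (r ⊗ₜ h) = X.counit r • h :=
  counitLeft_tmul _ _ _

/-- The reconstruction `a = p(a₁) # π(a₂)`. Hence a coalgebra map into `A` is known from its two
components. -/
theorem sw_smash_fst_snd (hX : X.IsCoalgebra) (a : R ⊗[K] H) :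
    (sw (smashComul X a) fun x y => smashFst K R H x ⊗ₜ[K] smashSnd X y) = a := by
  revert a; apply lin_ext (by fun_prop) (by fun_prop); intro r h
  rw [sw_smashComul _ _ _ (by fun_prop) (by fun_prop)]
  simp only [smashFst_tmul, smashSnd_tmul, Bialgebra.counit_mul]
  have e : ∀ (k h₁ h₂ : H) (r₁ r₀ : R), ((ϵ k * ϵ h₁) • r₁) ⊗ₜ[K] (X.counit r₀ • h₂) =
      X.counit r₀ • (ϵ k • (ϵ h₁ • (r₁ ⊗ₜ[K] h₂))) := by
    intro k h₁ h₂ r₁ r₀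
    rw [TensorProduct.smul_tmul_smul, smul_smul, smul_smul]
    congr 1; ring
  simp only [e, ← smul_sw]
  simp (disch := fun_prop) only [(isCoalg_hopf K H).sw_counit_left]
  have e' : ∀ r₁ r₂ : R, (sw (X.coact r₂) fun k r₀ => X.counit r₀ • ϵ k • r₁ ⊗ₜ[K] h) =
      X.counit r₂ • r₁ ⊗ₜ h := fun r₁ r₂ => by
    rw [hX.sw_coact_counit' r₂ (F := fun k => ϵ k • r₁ ⊗ₜ[K] h) (by fun_prop),
      Bialgebra.counit_one, one_smul]
  simp only [e']
  exact hX.isCoalg.sw_counit_right r (F := fun x => x ⊗ₜ[K] h) (by fun_prop)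

/-- With `h = 1` this reads the coaction of `R` off the coproduct of `A`; colinearity on `R` is
later deduced from it. -/
theorem sw_smash_snd_fst (hX : X.IsCoalgebra) (r : R) (h : H) :
    (sw (smashComul X (r ⊗ₜ h)) fun x y => smashSnd X x ⊗ₜ[K] smashFst K R H y) =
      sw (X.coact r) fun k r₀ => (k * h) ⊗ₜ r₀ := by
  rw [sw_smashComul _ _ _ (by fun_prop) (by fun_prop)]
  simp only [smashFst_tmul, smashSnd_tmul]
  have e : ∀ (k h₁ h₂ : H) (r₁ r₀ : R), (X.counit r₁ • (k * h₁)) ⊗ₜ[K] (ϵ h₂ • r₀) =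
      X.counit r₁ • (ϵ h₂ • ((k * h₁) ⊗ₜ[K] r₀)) := by
    intro k h₁ h₂ r₁ r₀
    rw [TensorProduct.smul_tmul_smul, smul_smul]
  simp only [e, ← smul_sw]
  simp (disch := fun_prop) only [(isCoalg_hopf K H).sw_counit_right]
  exact hX.isCoalg.sw_counit_left r (F := fun x => sw (X.coact x) fun k r₀ => (k * h) ⊗ₜ[K] r₀)
    (by fun_prop)

theorem smashFst_comul (hX : X.IsCoalgebra) (r : R) (h : H) :
    (sw (smashComul X (r ⊗ₜ h)) fun x y => smashFst K R H x ⊗ₜ[K] smashFst K R H y) =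
      ϵ h • X.comul r := by
  rw [sw_smashComul _ _ _ (by fun_prop) (by fun_prop)]
  simp only [smashFst_tmul, Bialgebra.counit_mul]
  have e : ∀ (k h₁ h₂ : H) (r₁ r₀ : R), ((ϵ k * ϵ h₁) • r₁) ⊗ₜ[K] (ϵ h₂ • r₀) =
      ϵ k • (ϵ h₁ • (ϵ h₂ • (r₁ ⊗ₜ[K] r₀))) := by
    intro k h₁ h₂ r₁ r₀
    rw [TensorProduct.smul_tmul_smul, smul_smul, smul_smul, mul_assoc]
  simp only [e, ← smul_sw]
  simp (disch := fun_prop) only [(isCoalg_hopf K H).sw_counit_left h (F := fun x => ϵ x • _),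
    hX.sw_coact_counit]
  rw [← smul_sw, sw_eta]

theorem isCoalgMap_smashFst (hX : X.IsCoalgebra) :
    IsCoalgMap (smashComul X) (smashCounit X) X.comul X.counit (smashFst K R H) where
  comul := by
    apply lin_ext (by fun_prop) (by fun_prop); intro r h
    rw [smashFst_tmul, map_smul, ← smashFst_comul hX, smashComul_tmul]
    simp (disch := fun_prop) only [linearMap_sw, sw_sw, sw_tmul, TensorProduct.map_tmul]
  counit := by
    apply lin_ext (by fun_prop) (by fun_prop); intro r h
    simp [smashCounit_tmul, mul_comm]

theorem isCoalgMap_smashSnd (hX : X.IsCoalgebra) :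
    IsCoalgMap (smashComul X) (smashCounit X) (Coalgebra.comul (R := K) (A := H))
      (Coalgebra.counit (R := K) (A := H)) (smashSnd X) where
  comul := by
    apply lin_ext (by fun_prop) (by fun_prop); intro r h
    rw [smashSnd_tmul, map_smul, smashComul_tmul]
    simp only [linearMap_sw, TensorProduct.map_tmul, smashSnd_tmul,
      TensorProduct.smul_tmul_smul, mul_smul, ← smul_sw]
    rw [hX.isCoalg.sw_counit_left r (F := fun x => sw (X.coact x) fun k r₀ => X.counit r₀ •
      sw (δ h) fun h₁ h₂ => (k * h₁) ⊗ₜ[K] h₂) (by fun_prop),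
      hX.sw_coact_counit' r (F := fun k => sw (δ h) fun h₁ h₂ => (k * h₁) ⊗ₜ[K] h₂) (by fun_prop)]
    simp only [one_mul, sw_eta]
  counit := by
    apply lin_ext (by fun_prop) (by fun_prop); intro r h
    simp [smashCounit_tmul]

end Proj

/-! ### The multiplication of `R #_ξ H` -/

section Mul

variable {K : Type*} [Field K] {H : Type*} [Ring H] [HopfAlgebra K H]

local notation "δ" => CoalgebraStruct.comul (R := K)
local notation "ϵ" => CoalgebraStruct.counit (R := K)

variable {R M : Type*} [AddCommGroup R] [Module K R] [AddCommGroup M] [Module K M]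
  {X : YDCoalgebraData K H R} {m : R ⊗[K] R →ₗ[K] R} {u : K →ₗ[K] R} {ξ : R ⊗[K] R →ₗ[K] H}

theorem isModuleCoalg_sq (hX : X.IsCoalgebra) :
    IsModuleCoalg (tensorSq X).act (tensorSq X).comul (tensorSq X).counit :=
  isModuleCoalg_braid hX hX.isModuleCoalg

theorem sw_sq_comul (X : YDCoalgebraData K H R) (r s : R) {F : R ⊗[K] R → R ⊗[K] R → M}
    (h₁ : ∀ b, Lin K (fun a => F a b)) (h₂ : ∀ a, Lin K (F a)) :
    sw ((tensorSq X).comul (r ⊗ₜ s)) F =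
      sw (X.comul r) fun r₁ r₂ => sw (X.comul s) fun s₁ s₂ => sw (X.coact r₂) fun k r₀ =>
        F (r₁ ⊗ₜ X.act k s₁) (r₀ ⊗ₜ s₂) :=
  sw_braidComul X X.act X.comul r s h₁ h₂

theorem sw_sq_coact (X : YDCoalgebraData K H R) (r s : R) {F : H → R ⊗[K] R → M}
    (h₁ : ∀ b, Lin K (fun a => F a b)) (h₂ : ∀ a, Lin K (F a)) :
    sw ((tensorSq X).coact (r ⊗ₜ s)) F =
      sw (X.coact r) fun k r₀ => sw (X.coact s) fun l s₀ => F (k * l) (r₀ ⊗ₜ s₀) := by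
  change sw (tensorCoact X.coact X.coact (r ⊗ₜ s)) F = _
  simp (disch := fun_prop) only [tensorCoact_tmul, sw_sw, sw_tmul]

/-- The comultiplication of the tensor square is colinear. -/
theorem sw_sq_coact_comul (hX : X.IsCoalgebra) (z : R ⊗[K] R) {F : H → R ⊗[K] R → R ⊗[K] R → M}
    (h₁ : ∀ b c, Lin K (fun a => F a b c)) (h₂ : ∀ a c, Lin K (fun b => F a b c))
    (h₃ : ∀ a b, Lin K (F a b)) :
    (sw ((tensorSq X).coact z) fun h d => sw ((tensorSq X).comul d) fun d₁ d₂ => F h d₁ d₂) =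
      sw ((tensorSq X).comul z) fun c₁ c₂ => sw ((tensorSq X).coact c₁) fun h d₁ =>
        sw ((tensorSq X).coact c₂) fun k d₂ => F (h * k) d₁ d₂ := by
  revert z; apply lin_ext (by fun_prop) (by fun_prop); intro r s
  simp (disch := fun_prop) only [sw_sq_coact, sw_sq_comul]
  refine (sw_congr fun _ _ => sw_comm _ _ _).trans ?_
  rw [hX.sw_coact_comul r (by fun_prop) (by fun_prop) (by fun_prop)]
  refine sw_congr fun r₁ r₂ => ?_
  simp (disch := fun_prop) only [hX.sw_coact_comul]
  refine (sw_comm₂ _ _ _ _).trans (sw_congr fun s₁ s₂ => ?_)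
  refine Eq.trans (sw_congr fun k r₁' => ?_) (sw_comm _ _ _)
  refine (sw_comm₂ _ _ _ _).trans (Eq.trans (sw_congr fun l s₂' => ?_) (sw_comm₃ _ _ _ _ _).symm)
  refine (sw_congr fun _ _ => sw_comm _ _ _).trans
    (Eq.trans ?_ (sw_congr fun _ _ => sw_comm _ _ _))
  rw [← hX.sw_coact_coassoc r₂ (by fun_prop) (by fun_prop) (by fun_prop),
    ← hX.sw_coact_coassoc r₂ (by fun_prop) (by fun_prop) (by fun_prop)]
  refine sw_congr fun w r₀ => ?_
  -- The Yetter-Drinfeld condition: the braiding of the second leg of `r` past the first leg of `s`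
  -- is colinear.
  have := hX.sw_coact_act w s₁ (F := fun x y => F (k * x * l) (r₁' ⊗ₜ y) (r₀ ⊗ₜ s₂'))
    (by fun_prop) (by fun_prop)
  simp only [mul_assoc] at this ⊢
  exact this.symm

/-- Right multiplication of `R # H` by elements of `H`. -/
def smashRmul (K : Type*) [Field K] (R : Type*) [AddCommGroup R] [Module K R] (H : Type*) [Ring H]
    [HopfAlgebra K H] : R ⊗[K] H →ₗ[K] H →ₗ[K] R ⊗[K] H :=
  TensorProduct.curry
    (LinearMap.lTensor R (LinearMap.mul' K H) ∘ₗ (TensorProduct.assoc K R H H).toLinearMap)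

@[simp] theorem smashRmul_tmul (r : R) (h l : H) :
    smashRmul K R H (r ⊗ₜ h) l = r ⊗ₜ (h * l) := by
  simp [smashRmul]

theorem smashRmul_mul (a : R ⊗[K] H) (h l : H) :
    smashRmul K R H a (h * l) = smashRmul K R H (smashRmul K R H a h) l := by
  revert a; apply lin_ext (by fun_prop) (by fun_prop); intro r k
  simp [mul_assoc]

theorem smashAct_rmul (X : YDCoalgebraData K H R) (h l : H) (a : R ⊗[K] H) :
    smashAct X h (smashRmul K R H a l) = smashRmul K R H (smashAct X h a) l := by
  revert a; apply lin_ext (by fun_prop) (by fun_prop); intro r k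
  simp only [smashRmul_tmul, smashAct_tmul, linearMap_sw, sw_apply, mul_assoc]

theorem smashComul_rmul (X : YDCoalgebraData K H R) (a : R ⊗[K] H) (l : H) :
    smashComul X (smashRmul K R H a l) = sw (smashComul X a) fun x y => sw (δ l) fun l₁ l₂ =>
      smashRmul K R H x l₁ ⊗ₜ smashRmul K R H y l₂ := by
  revert a; apply lin_ext (by fun_prop) (by fun_prop); intro r k
  simp (disch := fun_prop) only [smashRmul_tmul, smashComul_tmul, sw_comul_mul, sw_sw, sw_tmul,
    mul_assoc]

@[simp] theorem smashFst_rmul (a : R ⊗[K] H) (l : H) :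
    smashFst K R H (smashRmul K R H a l) = ϵ l • smashFst K R H a := by
  revert a; apply lin_ext (by fun_prop) (by fun_prop); intro r k
  rw [smashRmul_tmul, smashFst_tmul, smashFst_tmul, Bialgebra.counit_mul, mul_comm, mul_smul]

@[simp] theorem smashSnd_rmul (a : R ⊗[K] H) (l : H) :
    smashSnd X (smashRmul K R H a l) = smashSnd X a * l := by
  revert a; apply lin_ext (by fun_prop) (by fun_prop); intro r k
  simp

theorem mulXi_apply (X : YDCoalgebraData K H R) (m : R ⊗[K] R →ₗ[K] R) (ξ : R ⊗[K] R →ₗ[K] H)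
    (z : R ⊗[K] R) : mulXi X m ξ z = sw ((tensorSq X).comul z) fun a b => m a ⊗ₜ ξ b := by
  rw [mulXi, LinearMap.comp_apply]
  conv_lhs => rw [← sw_eta ((tensorSq X).comul z), linearMap_sw]
  simp only [TensorProduct.map_tmul]

/-- `r ⊗ (s # l) ↦ (r # 1) (s # l)`. -/
def mulFirst (X : YDCoalgebraData K H R) (m : R ⊗[K] R →ₗ[K] R) (ξ : R ⊗[K] R →ₗ[K] H) :
    R ⊗[K] (R ⊗[K] H) →ₗ[K] R ⊗[K] H :=
  TensorProduct.lift (smashRmul K R H) ∘ₗ LinearMap.rTensor H (mulXi X m ξ) ∘ₗ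
    (TensorProduct.assoc K R R H).symm.toLinearMap

@[simp] theorem mulFirst_tmul (r s : R) (l : H) :
    mulFirst X m ξ (r ⊗ₜ (s ⊗ₜ l)) = smashRmul K R H (mulXi X m ξ (r ⊗ₜ s)) l := by
  simp [mulFirst]

/-- Separates the action of `h` on the second factor from the genuinely cocyclic part `r ⊗ b ↦ (r #
1) b`, so that linearity and coalgebra properties can be checked on each piece. -/
theorem smashMul_eq (X : YDCoalgebraData K H R) (m : R ⊗[K] R →ₗ[K] R) (ξ : R ⊗[K] R →ₗ[K] H) :
    smashMul X m ξ = mulFirst X m ξ ∘ₗ actFirst R (smashAct X) := by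
  refine TensorProduct.ext' fun a b => ?_
  revert a; apply lin_ext (by fun_prop) (by fun_prop); intro r h
  revert b; apply lin_ext (by fun_prop) (by fun_prop); intro s l
  rw [LinearMap.comp_apply, actFirst_tmul, smashAct_tmul, tmul_sw, linearMap_sw]
  simp only [mulFirst_tmul]
  simp only [smashMul, middle, LinearMap.comp_apply, LinearEquiv.coe_coe, TensorProduct.assoc_tmul,
    LinearMap.lTensor_tmul, TensorProduct.assoc_symm_tmul, LinearMap.rTensor_tmul, braidHR,
    braiding_tmul]
  generalize δ h = t
  revert t; apply lin_ext (by fun_prop) (by fun_prop); intro h₁ h₂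
  simp (disch := fun_prop) only [sw_tmul, TensorProduct.assoc_tmul, TensorProduct.assoc_symm_tmul,
    TensorProduct.map_tmul, LinearMap.mul'_apply]
  generalize mulXi X m ξ (r ⊗ₜ X.act h₁ s) = t
  revert t; apply lin_ext (by fun_prop) (by fun_prop); intro x y
  simp

/-- `(h₁ ⇀ g) h₂ = h g` for the left adjoint action. -/
theorem sw_leftAdjoint_mul (h g : H) :
    (sw (δ h) fun x y => leftAdjoint K H x g * y) = h * g := by
  simp only [leftAdjoint_apply, sw_mul]
  rw [(isCoalg_hopf K H).sw_coassoc h (by fun_prop) (by fun_prop) (by fun_prop)]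
  simp only [mul_assoc]
  simp only [← mul_sw]
  simp only [sw_antipode_mul]
  simp only [mul_smul_comm, mul_one]
  exact (isCoalg_hopf K H).sw_counit_right h (F := fun x => x * g) (by fun_prop)

namespace IsCocycle

theorem sw_comul_xi (hξ : IsCocycle X m u ξ) (z : R ⊗[K] R) {F : H → H → M}
    (h₁ : ∀ b, Lin K (fun a => F a b)) (h₂ : ∀ a, Lin K (F a)) :
    sw (δ (ξ z)) F = sw ((tensorSq X).comul z) fun a b => sw ((tensorSq X).coact b) fun k b₀ =>
      F (ξ a * k) (ξ b₀) := by
  have := congrArg (fun t => sw t F) (LinearMap.congr_fun hξ.comul_comp z)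
  simp only [LinearMap.comp_apply] at this
  refine this.trans ?_
  generalize (tensorSq X).comul z = t
  revert t; apply lin_ext (by fun_prop) (by fun_prop); intro a b
  simp (disch := fun_prop) only [sw_tmul, TensorProduct.map_tmul]
  generalize (tensorSq X).coact b = t
  revert t; apply lin_ext (by fun_prop) (by fun_prop); intro k b₀
  simp (disch := fun_prop) [sw_tmul]

theorem sw_braid (hξ : IsCocycle X m u ξ) (z : R ⊗[K] R) {F : H → R → M}
    (h₁ : ∀ b, Lin K (fun a => F a b)) (h₂ : ∀ a, Lin K (F a)) :
    (sw ((tensorSq X).comul z) fun a b => sw (X.coact (m a)) fun k r₀ => F (k * ξ b) r₀) =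
    sw ((tensorSq X).comul z) fun a b => sw ((tensorSq X).coact b) fun k b₀ =>
      F (ξ a * k) (m b₀) := by
  have := congrArg (fun t => sw t F) (LinearMap.congr_fun hξ.braid_comp z)
  simp only [LinearMap.comp_apply] at this
  refine Eq.trans ?_ (this.trans ?_)
  · rw [mulXi_apply, linearMap_sw]
    simp (disch := fun_prop) only [sw_sw, braidRH, braiding_tmul, sw_tmul, LinearMap.mul_apply']
  · generalize (tensorSq X).comul z = t
    revert t; apply lin_ext (by fun_prop) (by fun_prop); intro a b
    simp (disch := fun_prop) only [sw_tmul, TensorProduct.map_tmul]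
    generalize (tensorSq X).coact b = t
    revert t; apply lin_ext (by fun_prop) (by fun_prop); intro k b₀
    simp (disch := fun_prop) [sw_tmul]

theorem counit_xi (hξ : IsCocycle X m u ξ) (z : R ⊗[K] R) : ϵ (ξ z) = (tensorSq X).counit z :=
  LinearMap.congr_fun hξ.counit_comp z

end IsCocycle

theorem isCoalgMap_mul (hR : IsPreBialgebra X m u) :
    IsCoalgMap (tensorSq X).comul (tensorSq X).counit X.comul X.counit m :=
  ⟨LinearMap.congr_fun hR.mul_coalgHom.1, LinearMap.congr_fun hR.mul_coalgHom.2⟩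

@[simp] theorem smashFst_mulXi (hR : IsPreBialgebra X m u) (hξ : IsCocycle X m u ξ)
    (z : R ⊗[K] R) : smashFst K R H (mulXi X m ξ z) = m z := by
  simp only [mulXi_apply, linearMap_sw, smashFst_tmul, hξ.counit_xi]
  exact (isModuleCoalg_sq hR.coalgebra).coalg.sw_counit_right z (by fun_prop)

@[simp] theorem smashSnd_mulXi (hR : IsPreBialgebra X m u) (z : R ⊗[K] R) :
    smashSnd X (mulXi X m ξ z) = ξ z := by
  simp only [mulXi_apply, linearMap_sw, smashSnd_tmul, (isCoalgMap_mul hR).counit]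
  exact (isModuleCoalg_sq hR.coalgebra).coalg.sw_counit_left z (by fun_prop)

theorem smashCounit_mulXi (hR : IsPreBialgebra X m u) (hξ : IsCocycle X m u ξ) (z : R ⊗[K] R) :
    smashCounit X (mulXi X m ξ z) = (tensorSq X).counit z := by
  rw [← hξ.counit_xi, ← smashSnd_mulXi (ξ := ξ) hR z,
    (isCoalgMap_smashSnd hR.coalgebra).counit]

/-- The coproduct of `m(z₁) # ξ(z₂)` contains `Δ_H ξ`, which `comul_comp` splits, and the coaction
on a value of `m`, which `braid_comp` moves across the neighbouring `ξ`. Colinearity of the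
coproduct of `R ⊗ R` then collects the coactions. -/
theorem smashComul_mulXi (hR : IsPreBialgebra X m u) (hξ : IsCocycle X m u ξ) (z : R ⊗[K] R) :
    smashComul X (mulXi X m ξ z) = sw ((tensorSq X).comul z) fun a b =>
      sw ((tensorSq X).coact b) fun k b₀ =>
        smashRmul K R H (mulXi X m ξ a) k ⊗ₜ mulXi X m ξ b₀ := by
  have hX := hR.coalgebra
  have hsq := (isModuleCoalg_sq hX).coalg
  simp (disch := fun_prop) only [mulXi_apply, linearMap_sw, smashComul_tmul,
    (isCoalgMap_mul hR).sw_comul, hξ.sw_comul_xi]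
  simp only [sw_apply, tmul_sw, sw_tmul_const, smashRmul_tmul]
  trans sw ((tensorSq X).comul z) fun a w => sw ((tensorSq X).comul w) fun v d =>
    sw ((tensorSq X).comul v) fun b c => sw ((tensorSq X).coact c) fun k c₀ =>
    sw ((tensorSq X).coact d) fun l d₀ => (m a ⊗ₜ (ξ b * k * l)) ⊗ₜ[K] (m c₀ ⊗ₜ[K] ξ d₀)
  · rw [hsq.sw_coassoc z (by fun_prop) (by fun_prop) (by fun_prop)]
    refine sw_congr fun a w => ?_
    refine (sw_congr fun _ _ => sw_comm _ _ _).trans ?_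
    rw [← hsq.sw_coassoc w (by fun_prop) (by fun_prop) (by fun_prop)]
    refine sw_congr fun v d => ?_
    simp only [← mul_assoc]
    exact hξ.sw_braid v (F := fun k c₀ => sw ((tensorSq X).coact d) fun l d₀ =>
      (m a ⊗ₜ[K] (k * l)) ⊗ₜ[K] (c₀ ⊗ₜ[K] ξ d₀)) (by fun_prop) (by fun_prop)
  · simp (disch := fun_prop) only [sw_sq_coact_comul hX]
    refine Eq.trans ?_ (sw_congr fun _ _ => (sw_comm₃ _ _ _ _ _).symm)
    rw [hsq.sw_coassoc z (by fun_prop) (by fun_prop) (by fun_prop)]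
    refine sw_congr fun a w => ?_
    rw [hsq.sw_coassoc w (by fun_prop) (by fun_prop) (by fun_prop)]
    simp only [mul_assoc]

end Mul

/-! ### The bosonization: coalgebra map property, associativity, unit -/

section MulLaws

variable {K : Type*} [Field K] {H : Type*} [Ring H] [HopfAlgebra K H]

local notation "δ" => CoalgebraStruct.comul (R := K)
local notation "ϵ" => CoalgebraStruct.counit (R := K)

variable {R M : Type*} [AddCommGroup R] [Module K R] [AddCommGroup M] [Module K M]
  {X : YDCoalgebraData K H R} {m : R ⊗[K] R →ₗ[K] R} {u : K →ₗ[K] R} {ξ : R ⊗[K] R →ₗ[K] H}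

/-- `ξ` is linear for the adjoint action, and `(h₁ ⇀ g) h₂ = h g` turns the adjoint action into left
multiplication at the price of a factor on the right. -/
theorem smashAct_mulXi (hR : IsPreBialgebra X m u) (hξ : IsCocycle X m u ξ) (h : H)
    (z : R ⊗[K] R) : smashAct X h (mulXi X m ξ z) = sw (δ h) fun h₁ h₂ =>
      smashRmul K R H (mulXi X m ξ ((tensorSq X).act h₁ z)) h₂ := by
  simp (disch := fun_prop) only [mulXi_apply, (isModuleCoalg_sq hR.coalgebra).comul_act,
    linearMap_sw, sw_sw, sw_tmul, hR.mul_linear _ _, hξ.linear, smashAct_tmul, sw_apply,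
    smashRmul_tmul]
  rw [(isCoalg_hopf K H).sw_coassoc h (F := fun a b c => sw ((tensorSq X).comul z) fun z₁ z₂ =>
    X.act a (m z₁) ⊗ₜ[K] (leftAdjoint K H b (ξ z₂) * c)) (by fun_prop) (by fun_prop) (by fun_prop)]
  rw [sw_comm]
  refine sw_congr fun a w => ?_
  rw [sw_comm]
  refine sw_congr fun z₁ z₂ => ?_
  rw [← tmul_sw, sw_leftAdjoint_mul]

theorem mulFirst_act (hR : IsPreBialgebra X m u) (hξ : IsCocycle X m u ξ) (h : H)
    (x : R ⊗[K] (R ⊗[K] H)) :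
    mulFirst X m ξ (tensorAct X.act (smashAct X) h x) = smashAct X h (mulFirst X m ξ x) := by
  revert x; apply lin_ext (by fun_prop) (by fun_prop); intro r b
  revert b; apply lin_ext (by fun_prop) (by fun_prop); intro s l
  rw [mulFirst_tmul, smashAct_rmul, smashAct_mulXi hR hξ, tensorAct_tmul]
  simp only [smashAct_tmul, tmul_sw, linearMap_sw, mulFirst_tmul, smashRmul_mul]
  rw [← (isCoalg_hopf K H).sw_coassoc h (by fun_prop) (by fun_prop) (by fun_prop), sw_apply]
  refine sw_congr fun a b => ?_
  change _ = smashRmul K R H (smashRmul K R H (mulXi X m ξ (tensorAct X.act X.act a (r ⊗ₜ s))) b) l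
  simp only [tensorAct_tmul, linearMap_sw, sw_apply]

theorem IsCoalgMap.of_sw {C D : Type*} [AddCommGroup C] [Module K C] [AddCommGroup D] [Module K D]
    {ΔC : C →ₗ[K] C ⊗[K] C} {εC : C →ₗ[K] K} {ΔD : D →ₗ[K] D ⊗[K] D} {εD : D →ₗ[K] K}
    {f : C →ₗ[K] D} (h₁ : ∀ x, ΔD (f x) = sw (ΔC x) fun a b => f a ⊗ₜ f b)
    (h₂ : ∀ x, εD (f x) = εC x) : IsCoalgMap ΔC εC ΔD εD f := by
  refine ⟨fun x => (h₁ x).trans ?_, h₂⟩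
  conv_rhs => rw [← sw_eta (ΔC x), linearMap_sw]
  simp only [TensorProduct.map_tmul]

theorem smashCounit_rmul (X : YDCoalgebraData K H R) (a : R ⊗[K] H) (l : H) :
    smashCounit X (smashRmul K R H a l) = smashCounit X a * ϵ l := by
  revert a; apply lin_ext (by fun_prop) (by fun_prop); intro r k
  rw [smashRmul_tmul, smashCounit_tmul, smashCounit_tmul, Bialgebra.counit_mul, mul_assoc]

/-- `smashComul_mulXi` leaves a factor `r₋₁ s₋₁` on its first leg. There `s₋₁` belongs to the
coproduct of `s # l`, while `r₋₁` joins the coaction already acting on `s` to form the braiding of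
`r` past the first leg of `s # l`. -/
theorem isCoalgMap_mulFirst (hR : IsPreBialgebra X m u) (hξ : IsCocycle X m u ξ) :
    IsCoalgMap (braidComul X (smashAct X) (smashComul X)) (tensorFun X.counit (smashCounit X))
      (smashComul X) (smashCounit X) (mulFirst X m ξ) := by
  have hX := hR.coalgebra
  refine IsCoalgMap.of_sw ?_ ?_
  · apply lin_ext (by fun_prop) (by fun_prop); intro r b
    revert b; apply lin_ext (by fun_prop) (by fun_prop); intro s l
    rw [mulFirst_tmul, smashComul_rmul, smashComul_mulXi hR hξ,
      sw_braidComul _ _ _ _ _ (by fun_prop) (by fun_prop)]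
    simp (disch := fun_prop) only [sw_sw, sw_tmul, sw_sq_comul, sw_sq_coact, sw_smashComul,
      smashAct_tmul, tmul_sw, linearMap_sw, sw_tmul_const, mulFirst_tmul]
    refine sw_congr fun r₁ r₂ => sw_congr fun s₁ s₂ => ?_
    refine (sw_comm₂ _ _ _ _).trans (sw_congr fun p s₀ => ?_)
    refine (sw_comm₂ _ _ _ _).trans (sw_congr fun l₁ l₂ => ?_)
    rw [← hX.sw_coact_coassoc r₂ (by fun_prop) (by fun_prop) (by fun_prop)]
    simp only [← smashRmul_mul, mul_assoc]
  · apply lin_ext (by fun_prop) (by fun_prop); intro r b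
    revert b; apply lin_ext (by fun_prop) (by fun_prop); intro s l
    rw [mulFirst_tmul, smashCounit_rmul, smashCounit_mulXi hR hξ, tensorFun_tmul,
      smashCounit_tmul, ← mul_assoc]
    congr 1

theorem isCoalgMap_smashMul (hR : IsPreBialgebra X m u) (hξ : IsCocycle X m u ξ) :
    IsCoalgMap (usualComul (smashComul X) (smashComul X))
      (tensorFun (smashCounit X) (smashCounit X)) (smashComul X) (smashCounit X)
      (smashMul X m ξ) := by
  rw [smashMul_eq]
  exact (isCoalgMap_mulFirst hR hξ).comp (isCoalgMap_actFirst X (isModuleCoalg_smash hR.coalgebra))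

theorem smashMul_tmul_tmul (r : R) (h : H) (b : R ⊗[K] H) :
    smashMul X m ξ ((r ⊗ₜ h) ⊗ₜ b) = mulFirst X m ξ (r ⊗ₜ smashAct X h b) := by
  rw [smashMul_eq, LinearMap.comp_apply, actFirst_tmul]

theorem smashMul_act_left (hR : IsPreBialgebra X m u) (hξ : IsCocycle X m u ξ) (h : H)
    (a b : R ⊗[K] H) :
    smashMul X m ξ (smashAct X h a ⊗ₜ b) = smashAct X h (smashMul X m ξ (a ⊗ₜ b)) := by
  rw [smashMul_eq, LinearMap.comp_apply, LinearMap.comp_apply,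
    actFirst_smashAct X (isModuleCoalg_smash hR.coalgebra), mulFirst_act hR hξ]

theorem mulFirst_rmul (r : R) (b : R ⊗[K] H) (l : H) :
    mulFirst X m ξ (r ⊗ₜ smashRmul K R H b l) = smashRmul K R H (mulFirst X m ξ (r ⊗ₜ b)) l := by
  revert b; apply lin_ext (by fun_prop) (by fun_prop); intro s k
  simp only [smashRmul_tmul, mulFirst_tmul, smashRmul_mul]

theorem smashMul_rmul_right (a b : R ⊗[K] H) (l : H) :
    smashMul X m ξ (a ⊗ₜ smashRmul K R H b l) = smashRmul K R H (smashMul X m ξ (a ⊗ₜ b)) l := by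
  revert a; apply lin_ext (by fun_prop) (by fun_prop); intro r h
  rw [smashMul_tmul_tmul, smashMul_tmul_tmul, smashAct_rmul, mulFirst_rmul]

theorem smashMul_rmul_left (hX : X.IsCoalgebra) (a b : R ⊗[K] H) (l : H) :
    smashMul X m ξ (smashRmul K R H a l ⊗ₜ b) = smashMul X m ξ (a ⊗ₜ smashAct X l b) := by
  revert a; apply lin_ext (by fun_prop) (by fun_prop); intro r h
  rw [smashRmul_tmul, smashMul_tmul_tmul, smashMul_tmul_tmul, (isModuleCoalg_smash hX).mul_act]

theorem smashFst_act (X : YDCoalgebraData K H R) (h : H) (a : R ⊗[K] H) :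
    smashFst K R H (smashAct X h a) = X.act h (smashFst K R H a) := by
  revert a; apply lin_ext (by fun_prop) (by fun_prop); intro r l
  simp only [smashAct_tmul, linearMap_sw, smashFst_tmul, Bialgebra.counit_mul, map_smul, mul_smul]
  rw [(isCoalg_hopf K H).sw_counit_right h (F := fun x => ϵ l • X.act x r) (by fun_prop)]

theorem smashFst_mulFirst (hR : IsPreBialgebra X m u) (hξ : IsCocycle X m u ξ)
    (x : R ⊗[K] (R ⊗[K] H)) :
    smashFst K R H (mulFirst X m ξ x) = m (LinearMap.lTensor R (smashFst K R H) x) := by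
  revert x; apply lin_ext (by fun_prop) (by fun_prop); intro r b
  revert b; apply lin_ext (by fun_prop) (by fun_prop); intro s l
  rw [mulFirst_tmul, smashFst_rmul, smashFst_mulXi hR hξ, LinearMap.lTensor_tmul, smashFst_tmul,
    TensorProduct.tmul_smul, map_smul]

theorem smashSnd_mulFirst_tmul (hR : IsPreBialgebra X m u) (r s : R) (l : H) :
    smashSnd X (mulFirst X m ξ (r ⊗ₜ (s ⊗ₜ l))) = ξ (r ⊗ₜ s) * l := by
  rw [mulFirst_tmul, smashSnd_rmul, smashSnd_mulXi hR]

/-- Coalgebra maps to `R # H` are determined by their components. -/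
theorem coalgMap_smash_ext {C : Type*} [AddCommGroup C] [Module K C] (hX : X.IsCoalgebra)
    {ΔC : C →ₗ[K] C ⊗[K] C} {εC : C →ₗ[K] K} {f g : C →ₗ[K] R ⊗[K] H}
    (hf : IsCoalgMap ΔC εC (smashComul X) (smashCounit X) f)
    (hg : IsCoalgMap ΔC εC (smashComul X) (smashCounit X) g)
    (h₁ : ∀ x, smashFst K R H (f x) = smashFst K R H (g x))
    (h₂ : ∀ x, smashSnd X (f x) = smashSnd X (g x)) : f = g := by
  ext x
  rw [← sw_smash_fst_snd hX (f x), ← sw_smash_fst_snd hX (g x),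
    hf.sw_comul _ (by fun_prop) (by fun_prop), hg.sw_comul _ (by fun_prop) (by fun_prop)]
  simp only [h₁, h₂]

/-- `m_A` is left `H`-linear in its first argument and `H`-balanced in the middle, so all elements
of `H` can be moved to the right, leaving `r # 1`, `s # 1` and `t # l`. -/
theorem smashMul_assoc_aux (hR : IsPreBialgebra X m u) (hξ : IsCocycle X m u ξ)
    (g : R ⊗[K] H →ₗ[K] M)
    (hg : ∀ r s t l, g (mulFirst X m ξ (r ⊗ₜ smashRmul K R H (mulXi X m ξ (s ⊗ₜ t)) l)) =
      g (smashMul X m ξ (mulXi X m ξ (r ⊗ₜ s) ⊗ₜ (t ⊗ₜ l)))) (a b c : R ⊗[K] H) :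
    g (smashMul X m ξ (a ⊗ₜ smashMul X m ξ (b ⊗ₜ c))) =
      g (smashMul X m ξ (smashMul X m ξ (a ⊗ₜ b) ⊗ₜ c)) := by
  have hX := hR.coalgebra
  revert a; apply lin_ext (by fun_prop) (by fun_prop); intro r h
  rw [smashMul_tmul_tmul, smashMul_tmul_tmul, ← smashMul_act_left hR hξ]
  generalize smashAct X h b = b
  revert b; apply lin_ext (by fun_prop) (by fun_prop); intro s k
  rw [smashMul_tmul_tmul, mulFirst_tmul, smashMul_rmul_left hX]
  generalize smashAct X k c = c
  revert c; apply lin_ext (by fun_prop) (by fun_prop); intro t l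
  rw [mulFirst_tmul, hg]

theorem IsCocycle.mul_mul (hξ : IsCocycle X m u ξ) (r s t : R) :
    m (r ⊗ₜ m (s ⊗ₜ t)) = m (actFirst R X.act (mulXi X m ξ (r ⊗ₜ s) ⊗ₜ t)) := by
  have := LinearMap.congr_fun hξ.mul_assoc ((r ⊗ₜ s) ⊗ₜ t)
  simp only [LinearMap.comp_apply, LinearEquiv.coe_coe, TensorProduct.assoc_tmul,
    LinearMap.lTensor_tmul] at this
  rw [this]
  simp only [Phi, LinearMap.comp_apply, LinearMap.rTensor_tmul, mulXi]
  generalize (tensorSq X).comul (r ⊗ₜ s) = z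
  revert z; apply lin_ext (by fun_prop) (by fun_prop); intro a b
  simp

theorem IsCocycle.xi_mulXi (hR : IsPreBialgebra X m u) (hξ : IsCocycle X m u ξ) (r s t : R) :
    smashSnd X (mulFirst X m ξ (r ⊗ₜ mulXi X m ξ (s ⊗ₜ t))) =
      smashSnd X (smashMul X m ξ (mulXi X m ξ (r ⊗ₜ s) ⊗ₜ (t ⊗ₜ 1))) := by
  have := LinearMap.congr_fun hξ.cocycle ((r ⊗ₜ s) ⊗ₜ t)
  simp only [LinearMap.comp_apply, LinearEquiv.coe_coe, TensorProduct.assoc_tmul,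
    LinearMap.lTensor_tmul, LinearMap.rTensor_tmul] at this
  refine Eq.trans ?_ (this.trans ?_)
  · generalize mulXi X m ξ (s ⊗ₜ t) = z
    revert z; apply lin_ext (by fun_prop) (by fun_prop); intro a b
    rw [smashSnd_mulFirst_tmul hR]
    simp
  · generalize mulXi X m ξ (r ⊗ₜ s) = z
    revert z; apply lin_ext (by fun_prop) (by fun_prop); intro a b
    rw [smashMul_tmul_tmul]
    simp only [TensorProduct.assoc_tmul, LinearMap.lTensor_tmul, braidHR, braiding_tmul,
      smashAct_tmul, tmul_sw, linearMap_sw, linearEquiv_sw, smashSnd_mulFirst_tmul hR, mul_one]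
    refine sw_congr fun x y => ?_
    simp

/-- Both bracketings are coalgebra maps into `A`, so it suffices to compare components. The
`R`-component is the twisted associativity `mul_assoc` of `m`, and the `H`-component is the cocycle
identity for `ξ`. -/
theorem smashMul_assoc (hR : IsPreBialgebra X m u) (hξ : IsCocycle X m u ξ) :
    smashMul X m ξ ∘ₗ idMul (smashMul X m ξ) = smashMul X m ξ ∘ₗ mulId (smashMul X m ξ) := by
  have hX := hR.coalgebra
  have hm := isCoalgMap_smashMul hR hξ
  refine coalgMap_smash_ext hX (hm.comp (isCoalgMap_idMul hm)) (hm.comp (isCoalgMap_mulId hm)) ?_ ?_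
  · refine LinearMap.congr_fun (f := smashFst K R H ∘ₗ smashMul X m ξ ∘ₗ idMul (smashMul X m ξ))
      (g := smashFst K R H ∘ₗ smashMul X m ξ ∘ₗ mulId (smashMul X m ξ))
      (ext_threefold fun a b c => ?_)
    simp only [LinearMap.comp_apply, idMul_tmul, mulId_tmul]
    refine smashMul_assoc_aux hR hξ _ (fun r s t l => ?_) a b c
    rw [mulFirst_rmul, smashFst_rmul, smashFst_mulFirst hR hξ, LinearMap.lTensor_tmul,
      smashFst_mulXi hR hξ, hξ.mul_mul, smashMul_eq, LinearMap.comp_apply,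
      smashFst_mulFirst hR hξ, actFirst_natural (smashFst_act X), smashFst_tmul,
      TensorProduct.tmul_smul, map_smul, map_smul]
  · refine LinearMap.congr_fun (f := smashSnd X ∘ₗ smashMul X m ξ ∘ₗ idMul (smashMul X m ξ))
      (g := smashSnd X ∘ₗ smashMul X m ξ ∘ₗ mulId (smashMul X m ξ))
      (ext_threefold fun a b c => ?_)
    simp only [LinearMap.comp_apply, idMul_tmul, mulId_tmul]
    refine smashMul_assoc_aux hR hξ _ (fun r s t l => ?_) a b c
    have e : t ⊗ₜ[K] l = smashRmul K R H (t ⊗ₜ 1) l := by simp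
    rw [mulFirst_rmul, smashSnd_rmul, IsCocycle.xi_mulXi hR hξ, e, smashMul_rmul_right,
      smashSnd_rmul]

/-! ### The unit of the bosonization -/

section Unit

theorem comul_unit (hR : IsPreBialgebra X m u) : X.comul (u 1) = u 1 ⊗ₜ u 1 := by
  have := LinearMap.congr_fun hR.unit_coalgHom.1 1
  simpa [YDCoalgebraData.unit] using this

theorem counit_unit (hR : IsPreBialgebra X m u) : X.counit (u 1) = 1 := by
  have := LinearMap.congr_fun hR.unit_coalgHom.2 1
  simpa [YDCoalgebraData.unit] using this

theorem coact_unit (hR : IsPreBialgebra X m u) : X.coact (u 1) = 1 ⊗ₜ u 1 := by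
  have := LinearMap.congr_fun hR.unit_colinear 1
  simpa [YDCoalgebraData.unit] using this

theorem act_unit (hR : IsPreBialgebra X m u) (h : H) : X.act h (u 1) = ϵ h • u 1 := by
  have := hR.unit_linear h 1
  rw [← this]
  simp [YDCoalgebraData.unit, ← map_smul]

theorem mulXi_one_left (hR : IsPreBialgebra X m u) (hξ : IsCocycle X m u ξ) (s : R) :
    mulXi X m ξ (u 1 ⊗ₜ s) = s ⊗ₜ 1 := by
  rw [mulXi_apply, sw_sq_comul _ _ _ (by fun_prop) (by fun_prop)]
  simp (disch := fun_prop) only [comul_unit hR, sw_tmul, coact_unit hR, hR.coalgebra.one_act,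
    hR.one_mul, hξ.map_one_tmul, Algebra.algebraMap_eq_smul_one, TensorProduct.tmul_smul]
  exact hR.coalgebra.isCoalg.sw_counit_right s (F := fun x => x ⊗ₜ[K] (1 : H)) (by fun_prop)

theorem sq_comul_tmul_one (hR : IsPreBialgebra X m u) (r : R) {F : R ⊗[K] R → R ⊗[K] R → M}
    (h₁ : ∀ b, Lin K (fun a => F a b)) (h₂ : ∀ a, Lin K (F a)) :
    sw ((tensorSq X).comul (r ⊗ₜ u 1)) F =
      sw (X.comul r) fun r₁ r₂ => F (r₁ ⊗ₜ u 1) (r₂ ⊗ₜ u 1) := by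
  rw [sw_sq_comul _ _ _ (by fun_prop) (by fun_prop)]
  refine sw_congr fun r₁ r₂ => ?_
  simp (disch := fun_prop) only [comul_unit hR, sw_tmul, act_unit hR, TensorProduct.tmul_smul]
  have e : ∀ (k : H) (r₀ : R), F (ϵ k • (r₁ ⊗ₜ u 1)) (r₀ ⊗ₜ u 1) =
      ϵ k • F (r₁ ⊗ₜ u 1) (r₀ ⊗ₜ u 1) := fun k r₀ => (h₁ _).smul _ _
  simp only [e]
  exact hR.coalgebra.sw_coact_counit r₂ (F := fun x => F (r₁ ⊗ₜ u 1) (x ⊗ₜ u 1)) (by fun_prop)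

theorem mulXi_one_right (hR : IsPreBialgebra X m u) (hξ : IsCocycle X m u ξ) (r : R) :
    mulXi X m ξ (r ⊗ₜ u 1) = r ⊗ₜ 1 := by
  rw [mulXi_apply, sq_comul_tmul_one hR _ (by fun_prop) (by fun_prop)]
  simp (disch := fun_prop) only [hR.mul_one, hξ.map_tmul_one, Algebra.algebraMap_eq_smul_one,
    TensorProduct.tmul_smul]
  exact hR.coalgebra.isCoalg.sw_counit_right r (F := fun x => x ⊗ₜ[K] (1 : H)) (by fun_prop)

theorem smashMul_one_left (hR : IsPreBialgebra X m u) (hξ : IsCocycle X m u ξ) (b : R ⊗[K] H) :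
    smashMul X m ξ ((u 1 ⊗ₜ 1) ⊗ₜ b) = b := by
  rw [smashMul_tmul_tmul, (isModuleCoalg_smash hR.coalgebra).one_act]
  revert b; apply lin_ext (by fun_prop) (by fun_prop); intro s l
  rw [mulFirst_tmul, mulXi_one_left hR hξ, smashRmul_tmul, one_mul]

theorem smashMul_one_right (hR : IsPreBialgebra X m u) (hξ : IsCocycle X m u ξ) (a : R ⊗[K] H) :
    smashMul X m ξ (a ⊗ₜ (u 1 ⊗ₜ 1)) = a := by
  revert a; apply lin_ext (by fun_prop) (by fun_prop); intro r h
  rw [smashMul_tmul_tmul, smashAct_tmul, tmul_sw, linearMap_sw]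
  simp only [act_unit hR, mul_one, mulFirst_tmul, TensorProduct.tmul_smul, map_smul,
    mulXi_one_right hR hξ, LinearMap.smul_apply, smashRmul_tmul, one_mul]
  exact (isCoalg_hopf K H).sw_counit_left h (F := fun x => r ⊗ₜ[K] x) (by fun_prop)

theorem smashComul_one (hR : IsPreBialgebra X m u) :
    smashComul X (u 1 ⊗ₜ 1) = (u 1 ⊗ₜ 1) ⊗ₜ (u 1 ⊗ₜ 1) := by
  rw [smashComul_tmul]
  simp (disch := fun_prop) only [comul_unit hR, sw_tmul, coact_unit hR, sw_comul_one, mul_one]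

theorem smashCounit_one (hR : IsPreBialgebra X m u) : smashCounit X (u 1 ⊗ₜ 1) = 1 := by
  rw [smashCounit_tmul, counit_unit hR, Bialgebra.counit_one, mul_one]

end Unit

end MulLaws

/-! ### The projections `A ⊗ ⋯ ⊗ A → R ⊗ ⋯ ⊗ R` -/

section Projections

variable {K : Type*} [Field K] {H : Type*} [Ring H] [HopfAlgebra K H]

local notation "δ" => CoalgebraStruct.comul (R := K)
local notation "ϵ" => CoalgebraStruct.counit (R := K)

variable {R D E M : Type*} [AddCommGroup R] [Module K R] [AddCommGroup D] [Module K D]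
  [AddCommGroup E] [Module K E] [AddCommGroup M] [Module K M]
  {X : YDCoalgebraData K H R}

/-- `(r # h) ⊗ (s # l) ↦ r ⊗ h ε(l) s`. -/
def smashProj₂ (X : YDCoalgebraData K H R) : (R ⊗[K] H) ⊗[K] (R ⊗[K] H) →ₗ[K] R ⊗[K] R :=
  actFirst R X.act ∘ₗ LinearMap.lTensor (R ⊗[K] H) (smashFst K R H)

/-- The projection `A ⊗ A ⊗ A → R ⊗ R ⊗ R`. -/
def smashProj₃ (X : YDCoalgebraData K H R) :
    (R ⊗[K] H) ⊗[K] ((R ⊗[K] H) ⊗[K] (R ⊗[K] H)) →ₗ[K] R ⊗[K] (R ⊗[K] R) :=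
  actFirst R (tensorSq X).act ∘ₗ LinearMap.lTensor (R ⊗[K] H) (smashProj₂ X)

/-- The projection `A ⊗ A ⊗ A ⊗ A → R ⊗ R ⊗ R ⊗ R`. -/
def smashProj₄ (X : YDCoalgebraData K H R) :
    (R ⊗[K] H) ⊗[K] ((R ⊗[K] H) ⊗[K] ((R ⊗[K] H) ⊗[K] (R ⊗[K] H))) →ₗ[K]
      R ⊗[K] (R ⊗[K] (R ⊗[K] R)) :=
  actFirst R (tensorCube X).act ∘ₗ LinearMap.lTensor (R ⊗[K] H) (smashProj₃ X)

@[simp] theorem smashProj₂_tmul (X : YDCoalgebraData K H R) (a b : R ⊗[K] H) :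
    smashProj₂ X (a ⊗ₜ b) = actFirst R X.act (a ⊗ₜ smashFst K R H b) := rfl

@[simp] theorem smashProj₃_tmul (X : YDCoalgebraData K H R) (a : R ⊗[K] H)
    (y : (R ⊗[K] H) ⊗[K] (R ⊗[K] H)) :
    smashProj₃ X (a ⊗ₜ y) = actFirst R (tensorSq X).act (a ⊗ₜ smashProj₂ X y) := rfl

@[simp] theorem smashProj₄_tmul (X : YDCoalgebraData K H R) (a : R ⊗[K] H)
    (y : (R ⊗[K] H) ⊗[K] ((R ⊗[K] H) ⊗[K] (R ⊗[K] H))) :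
    smashProj₄ X (a ⊗ₜ y) = actFirst R (tensorCube X).act (a ⊗ₜ smashProj₃ X y) := rfl

theorem isModuleCoalg_cube (hX : X.IsCoalgebra) :
    IsModuleCoalg (tensorCube X).act (tensorCube X).comul (tensorCube X).counit :=
  isModuleCoalg_braid hX (isModuleCoalg_sq hX)

theorem isCoalgMap_smashProj₂ (hX : X.IsCoalgebra) :
    IsCoalgMap (usualComul (smashComul X) (smashComul X))
      (tensorFun (smashCounit X) (smashCounit X)) (tensorSq X).comul (tensorSq X).counit
      (smashProj₂ X) :=
  (isCoalgMap_actFirst X hX.isModuleCoalg).comp (isCoalgMap_smashFst hX).lTensor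

theorem isCoalgMap_smashProj₃ (hX : X.IsCoalgebra) :
    IsCoalgMap (usualComul (smashComul X) (usualComul (smashComul X) (smashComul X)))
      (tensorFun (smashCounit X) (tensorFun (smashCounit X) (smashCounit X)))
      (tensorCube X).comul (tensorCube X).counit (smashProj₃ X) :=
  (isCoalgMap_actFirst X (isModuleCoalg_sq hX)).comp (isCoalgMap_smashProj₂ hX).lTensor

theorem isCoalgMap_smashProj₄ (hX : X.IsCoalgebra) :
    IsCoalgMap (usualComul (smashComul X)
        (usualComul (smashComul X) (usualComul (smashComul X) (smashComul X))))
      (tensorFun (smashCounit X)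
        (tensorFun (smashCounit X) (tensorFun (smashCounit X) (smashCounit X))))
      (tensorFourth X).comul (tensorFourth X).counit (smashProj₄ X) :=
  (isCoalgMap_actFirst X (isModuleCoalg_cube hX)).comp (isCoalgMap_smashProj₃ hX).lTensor

theorem smashFst_surjective : Function.Surjective (smashFst K R H) := fun r =>
  ⟨r ⊗ₜ 1, by simp⟩

theorem smashProj₂_surjective (hX : X.IsCoalgebra) : Function.Surjective (smashProj₂ X) :=
  (actFirst_surjective hX.one_act).comp (LinearMap.lTensor_surjective _ smashFst_surjective)

theorem smashProj₃_surjective (hX : X.IsCoalgebra) : Function.Surjective (smashProj₃ X) :=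
  (actFirst_surjective (isModuleCoalg_sq hX).one_act).comp
    (LinearMap.lTensor_surjective _ (smashProj₂_surjective hX))

theorem smashProj₄_surjective (hX : X.IsCoalgebra) : Function.Surjective (smashProj₄ X) :=
  (actFirst_surjective (isModuleCoalg_cube hX).one_act).comp
    (LinearMap.lTensor_surjective _ (smashProj₃_surjective hX))

theorem smashProj₂_one (hX : X.IsCoalgebra) (r s : R) :
    smashProj₂ X ((r ⊗ₜ (1 : H)) ⊗ₜ (s ⊗ₜ (1 : H))) = r ⊗ₜ s := by
  simp [hX.one_act]

theorem smashProj₃_one (hX : X.IsCoalgebra) (r s t : R) :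
    smashProj₃ X ((r ⊗ₜ (1 : H)) ⊗ₜ ((s ⊗ₜ (1 : H)) ⊗ₜ (t ⊗ₜ (1 : H)))) = r ⊗ₜ (s ⊗ₜ t) := by
  rw [smashProj₃_tmul, smashProj₂_one hX, actFirst_tmul, (isModuleCoalg_sq hX).one_act]

/-- The form on `A` is a pull-back along a coalgebra map, and so inherits convolution inverses from
`R ⊗ R`. -/
theorem mho₂_eq (X : YDCoalgebraData K H R) (v : R ⊗[K] R →ₗ[K] K) :
    mho₂ X v = v ∘ₗ smashProj₂ X := by
  refine TensorProduct.ext' fun a b => ?_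
  revert a; apply lin_ext (by fun_prop) (by fun_prop); intro r h
  revert b; apply lin_ext (by fun_prop) (by fun_prop); intro s l
  simp [mho₂, tensorFun_tmul, mul_comm]

/-! Invariant functionals on module coalgebras -/

section Invariant

variable {act : H →ₗ[K] D →ₗ[K] D} {ΔD : D →ₗ[K] D ⊗[K] D} {εD : D →ₗ[K] K}
  {actE : H →ₗ[K] E →ₗ[K] E}

/-- `f(h d) = ε(h) f(d)`. -/
def IsInvariant (act : H →ₗ[K] D →ₗ[K] D) (f : D →ₗ[K] K) : Prop :=
  ∀ h d, f (act h d) = ϵ h * f d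

theorem IsModuleCoalg.isCoalgMap_lift (hD : IsModuleCoalg act ΔD εD) :
    IsCoalgMap (usualComul (δ : H →ₗ[K] H ⊗[K] H) ΔD) (tensorFun ϵ εD) ΔD εD
      (TensorProduct.lift act) :=
  IsCoalgMap.of_tmul (fun h d => by simp only [TensorProduct.lift.tmul, hD.comul_act])
    (fun h d => by simp only [TensorProduct.lift.tmul, hD.counit_act])

theorem isInvariant_iff {f : D →ₗ[K] K} :
    IsInvariant act f ↔ f ∘ₗ TensorProduct.lift act = tensorFun ϵ f := by
  refine ⟨fun h => TensorProduct.ext' fun x d => ?_, fun h x d => ?_⟩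
  · rw [LinearMap.comp_apply, TensorProduct.lift.tmul, h, tensorFun_tmul]
  · have := LinearMap.congr_fun h (x ⊗ₜ d)
    rwa [LinearMap.comp_apply, TensorProduct.lift.tmul, tensorFun_tmul] at this

/-- The action is a coalgebra map `H ⊗ D → D`, so `g ∘ act` and `ε ⊗ g` are inverses of `f ∘ act`
and `ε ⊗ f`. The latter two agree, hence so do their inverses. -/
theorem IsInvariant.inverse (hD : IsModuleCoalg act ΔD εD) {f g : D →ₗ[K] K}
    (hf : IsInvariant act f) (hfg : IsConvInverse ΔD εD f g) : IsInvariant act g := by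
  rw [isInvariant_iff] at hf ⊢
  have h₁ := hD.isCoalgMap_lift.isConvInverse_comp hfg
  have h₂ := hfg.counit_tensorFun (isCoalg_hopf K H)
  rw [hf] at h₁
  have hc := (isCoalg_hopf K H).tensor hD.coalg
  exact (hc.convInv_eq h₁).symm.trans (hc.convInv_eq h₂)

theorem IsInvariant.conv (hD : IsModuleCoalg act ΔD εD) {f g : D →ₗ[K] K}
    (hf : IsInvariant act f) (hg : IsInvariant act g) : IsInvariant act (conv ΔD f g) := by
  intro h d
  simp (disch := fun_prop) only [conv_apply, hD.comul_act, sw_sw, sw_tmul, hf _ _, hg _ _]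
  rw [mul_sw, sw_comm]
  refine sw_congr fun a b => ?_
  rw [← (isCoalg_hopf K H).sw_counit_left h (F := fun x => ϵ x * (f a * g b)) (by fun_prop)]
  refine sw_congr fun x y => ?_
  simp only [smul_eq_mul]
  ring

theorem conj_linear (hD : IsModuleCoalg act ΔD εD) {f g : D →ₗ[K] K}
    (hf : IsInvariant act f) (hg : IsInvariant act g) {n : D →ₗ[K] E}
    (hn : ∀ h d, n (act h d) = actE h (n d)) (h : H) (d : D) :
    conj ΔD f n g (act h d) = actE h (conj ΔD f n g d) := by
  have e₁ : ∀ (n : D →ₗ[K] E) (hn : ∀ h d, n (act h d) = actE h (n d)) (h : H) (d : D),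
      convLeft ΔD f n (act h d) = actE h (convLeft ΔD f n d) := by
    intro n hn h d
    simp (disch := fun_prop) only [convLeft_apply, hD.comul_act, sw_sw, sw_tmul, hf _ _, hn,
      linearMap_sw, map_smul]
    rw [sw_comm]
    refine sw_congr fun a b => ?_
    simp only [mul_smul]
    exact (isCoalg_hopf K H).sw_counit_left h (F := fun x => f a • actE x (n b)) (by fun_prop)
  have e₂ : ∀ (n : D →ₗ[K] E) (hn : ∀ h d, n (act h d) = actE h (n d)) (h : H) (d : D),
      convRight ΔD n g (act h d) = actE h (convRight ΔD n g d) := by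
    intro n hn h d
    simp (disch := fun_prop) only [convRight_apply, hD.comul_act, sw_sw, sw_tmul, hg _ _, hn,
      linearMap_sw, map_smul]
    rw [sw_comm]
    refine sw_congr fun a b => ?_
    simp only [mul_smul]
    exact (isCoalg_hopf K H).sw_counit_right h (F := fun x => g b • actE x (n a)) (by fun_prop)
  exact e₂ _ (e₁ _ hn) h d

/-- Invariance is exactly what lets `ε ⊗ f` on `R ⊗ D` correspond to `ε_A ⊗ f` on `A ⊗ D`. This is
why the coboundary descends to `R` only for invariant forms. -/
theorem tensorFun_actFirst (X : YDCoalgebraData K H R) {f : D →ₗ[K] K} (hf : IsInvariant act f)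
    (a : R ⊗[K] H) (d : D) :
    tensorFun X.counit f (actFirst R act (a ⊗ₜ d)) = smashCounit X a * f d := by
  revert a; apply lin_ext (by fun_prop) (by fun_prop); intro r h
  rw [actFirst_tmul, tensorFun_tmul, hf, smashCounit_tmul, mul_assoc]

end Invariant

/-! Multiplications of `A` that are determined by a map `R ⊗ R → A` -/

/-- `r ⊗ (s ⊗ d) ↦ g(r ⊗ s) d`. -/
def mulActFirst (act : H →ₗ[K] D →ₗ[K] D) (g : R ⊗[K] R →ₗ[K] R ⊗[K] H) :
    R ⊗[K] (R ⊗[K] D) →ₗ[K] R ⊗[K] D :=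
  actFirst R act ∘ₗ LinearMap.rTensor D g ∘ₗ (TensorProduct.assoc K R R D).symm.toLinearMap

@[simp] theorem mulActFirst_tmul (act : H →ₗ[K] D →ₗ[K] D) (g : R ⊗[K] R →ₗ[K] R ⊗[K] H) (r s : R)
    (d : D) : mulActFirst act g (r ⊗ₜ (s ⊗ₜ d)) = actFirst R act (g (r ⊗ₜ s) ⊗ₜ d) := by
  simp [mulActFirst]

/-- `N((r # h) ⊗ (s # k)) = g(r ⊗ h₁ s) h₂ k`. -/
def IsSmashMul (X : YDCoalgebraData K H R) (g : R ⊗[K] R →ₗ[K] R ⊗[K] H)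
    (N : (R ⊗[K] H) ⊗[K] (R ⊗[K] H) →ₗ[K] R ⊗[K] H) : Prop :=
  ∀ r h s k, N ((r ⊗ₜ h) ⊗ₜ (s ⊗ₜ k)) =
    sw (δ h) fun h₁ h₂ => smashRmul K R H (g (r ⊗ₜ X.act h₁ s)) (h₂ * k)

theorem isSmashMul_smashMul (X : YDCoalgebraData K H R) (m : R ⊗[K] R →ₗ[K] R)
    (ξ : R ⊗[K] R →ₗ[K] H) : IsSmashMul X (mulXi X m ξ) (smashMul X m ξ) := by
  intro r h s k
  simp only [smashMul_tmul_tmul, smashAct_tmul, tmul_sw, linearMap_sw, mulFirst_tmul]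

theorem actFirst_rmul {act : H →ₗ[K] D →ₗ[K] D} (hmul : ∀ g h d, act (g * h) d = act g (act h d))
    (a : R ⊗[K] H) (l : H) (d : D) :
    actFirst R act (smashRmul K R H a l ⊗ₜ d) = actFirst R act (a ⊗ₜ act l d) := by
  revert a; apply lin_ext (by fun_prop) (by fun_prop); intro r h
  rw [smashRmul_tmul, actFirst_tmul, actFirst_tmul, hmul]

/-- Multiplying the first two factors of `A ⊗ A ⊗ D` descends to `R ⊗ R ⊗ D`. Only the shape of the
multiplication is used, so the statement serves both `m_A` and its twist. -/
theorem IsSmashMul.actFirst {act : H →ₗ[K] D →ₗ[K] D}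
    (hmul : ∀ g h d, act (g * h) d = act g (act h d)) {g : R ⊗[K] R →ₗ[K] R ⊗[K] H}
    {N : (R ⊗[K] H) ⊗[K] (R ⊗[K] H) →ₗ[K] R ⊗[K] H} (hN : IsSmashMul X g N) (a b : R ⊗[K] H)
    (d : D) : actFirst R act (N (a ⊗ₜ b) ⊗ₜ d) =
      mulActFirst act g (actFirst R (tensorAct X.act act) (a ⊗ₜ actFirst R act (b ⊗ₜ d))) := by
  revert a; apply lin_ext (by fun_prop) (by fun_prop); intro r h
  revert b; apply lin_ext (by fun_prop) (by fun_prop); intro s k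
  simp only [hN r h s k, sw_tmul_const, linearMap_sw, actFirst_rmul hmul, actFirst_tmul,
    tensorAct_tmul, tmul_sw, mulActFirst_tmul, hmul]

end Projections

/-! ### The twisted multiplication of `A` -/

section Twisted

variable {K : Type*} [Field K] {H : Type*} [Ring H] [HopfAlgebra K H]

local notation "δ" => CoalgebraStruct.comul (R := K)
local notation "ϵ" => CoalgebraStruct.counit (R := K)

section General

variable {C D M : Type*} [AddCommGroup C] [Module K C] [AddCommGroup D] [Module K D]
  [AddCommGroup M] [Module K M] {Δ : C →ₗ[K] C ⊗[K] C} {ε : C →ₗ[K] K}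
  {ΔD : D →ₗ[K] D ⊗[K] D} {εD : D →ₗ[K] K}

theorem IsCoalgMap.convLeft_comp {f : C →ₗ[K] D} (hf : IsCoalgMap Δ ε ΔD εD f) (v : D →ₗ[K] K)
    (g : D →ₗ[K] M) : convLeft ΔD v g ∘ₗ f = convLeft Δ (v ∘ₗ f) (g ∘ₗ f) := by
  ext x
  simp only [LinearMap.comp_apply, convLeft_apply]
  exact hf.sw_comul x (by fun_prop) (by fun_prop)

theorem IsCoalgMap.convRight_comp {f : C →ₗ[K] D} (hf : IsCoalgMap Δ ε ΔD εD f) (v : D →ₗ[K] K)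
    (g : D →ₗ[K] M) : convRight ΔD g v ∘ₗ f = convRight Δ (g ∘ₗ f) (v ∘ₗ f) := by
  ext x
  simp only [LinearMap.comp_apply, convRight_apply]
  exact hf.sw_comul x (by fun_prop) (by fun_prop)

theorem IsCoalg.convLeft_convRight (h : IsCoalg Δ ε) (v v' : C →ₗ[K] K) (g : C →ₗ[K] M) :
    conj Δ v g v' = convLeft Δ v (convRight Δ g v') := by
  refine dual_ext fun φ => ?_
  rw [comp_conj, comp_convLeft, comp_convRight, conj_eq_conv, convLeft_eq_conv, convRight_eq_conv,
    h.conv_assoc]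

theorem IsCoalg.counit_convLeft (h : IsCoalg Δ ε) (g : C →ₗ[K] M) : convLeft Δ ε g = g := by
  refine dual_ext fun φ => ?_
  rw [comp_convLeft, convLeft_eq_conv, h.one_conv]

/-- If `g * v' = v' * k` then `v * g * v' = k`. -/
theorem IsConvInverse.conj_eq (hC : IsCoalg Δ ε) {v v' : C →ₗ[K] K} (h : IsConvInverse Δ ε v v')
    {g k : C →ₗ[K] M} (hg : convRight Δ g v' = convLeft Δ v' k) : conj Δ v g v' = k := by
  rw [hC.convLeft_convRight, hg, ← convLeft_conv hC, h.1, hC.counit_convLeft]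

end General

variable {R M : Type*} [AddCommGroup R] [Module K R] [AddCommGroup M] [Module K M]
  {X : YDCoalgebraData K H R} {m : R ⊗[K] R →ₗ[K] R} {u : K →ₗ[K] R} {ξ : R ⊗[K] R →ₗ[K] H}
  {l : H →ₗ[K] K} {v : R ⊗[K] R →ₗ[K] K}

theorem IsAdInvariantIntegral.sw_left (hl : IsAdInvariantIntegral l) (h : H) {F : H → M}
    (hF : Lin K F) : (sw (δ h) fun x y => l y • F x) = l h • F 1 := by
  have := congrArg (fun t => sw t fun x (k : K) => k • F x) (hl.left_integral h)
  simp (disch := fun_prop) only [sw_lTensor, sw_tmul] at this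
  exact this

theorem IsCocycle.isInvariant (hl : IsAdInvariantIntegral l) (hξ : IsCocycle X m u ξ) :
    IsInvariant (tensorSq X).act (l ∘ₗ ξ) := fun h z => by
  rw [LinearMap.comp_apply, hξ.linear, hl.left_adjoint]; rfl

theorem twist_eq (hX : X.IsCoalgebra) {v' : R ⊗[K] R →ₗ[K] K}
    (hv : IsConvInverse (tensorSq X).comul (tensorSq X).counit v' v) :
    twist X m v = conj (tensorSq X).comul v m v' := by
  rw [twist, sqInv, (isModuleCoalg_sq hX).coalg.convInv_eq hv.symm]
  rfl

theorem sw_smash_snd (hX : X.IsCoalgebra) (r : R) (h : H) {F : R ⊗[K] H → H → M}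
    (h₁ : ∀ b, Lin K (fun a => F a b)) (h₂ : ∀ a, Lin K (F a)) :
    (sw (smashComul X (r ⊗ₜ h)) fun x y => F x (smashSnd X y)) =
      sw (δ h) fun x y => F (r ⊗ₜ x) y := by
  rw [sw_smashComul _ _ _ (by fun_prop) (by fun_prop)]
  simp only [smashSnd_tmul, (h₂ _).smul]
  simp only [← smul_sw]
  have e : ∀ r₁ r₂ : R, (sw (X.coact r₂) fun k r₀ => X.counit r₀ •
      sw (δ h) fun x y => F (r₁ ⊗ₜ (k * x)) y) =
      X.counit r₂ • sw (δ h) fun x y => F (r₁ ⊗ₜ (1 * x)) y := fun r₁ r₂ =>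
    hX.sw_coact_counit' r₂ (F := fun k => sw (δ h) fun x y => F (r₁ ⊗ₜ (k * x)) y) (by fun_prop)
  simp only [e, one_mul]
  exact hX.isCoalg.sw_counit_right r (F := fun r => sw (δ h) fun x y => F (r ⊗ₜ x) y) (by fun_prop)

theorem sw_smash_snd_left (hX : X.IsCoalgebra) (r : R) (h : H) {F : H → R ⊗[K] H → M}
    (h₁ : ∀ b, Lin K (fun a => F a b)) (h₂ : ∀ a, Lin K (F a)) :
    (sw (smashComul X (r ⊗ₜ h)) fun x y => F (smashSnd X x) y) =
      sw (X.coact r) fun k r₀ => sw (δ h) fun x y => F (k * x) (r₀ ⊗ₜ y) := by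
  rw [sw_smashComul _ _ _ (by fun_prop) (by fun_prop)]
  simp only [smashSnd_tmul, (h₁ _).smul]
  simp only [← smul_sw]
  exact hX.isCoalg.sw_counit_left r (F := fun r => sw (X.coact r) fun k r₀ =>
    sw (δ h) fun x y => F (k * x) (r₀ ⊗ₜ y)) (by fun_prop)

theorem smashSnd_act (hX : X.IsCoalgebra) (h : H) (a : R ⊗[K] H) :
    smashSnd X (smashAct X h a) = h * smashSnd X a := by
  revert a; apply lin_ext (by fun_prop) (by fun_prop); intro r k
  simp only [smashAct_tmul, linearMap_sw, smashSnd_tmul, hX.counit_act, mul_smul_comm,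
    mul_comm (ϵ _), mul_smul]
  simp only [← smul_sw]
  rw [(isCoalg_hopf K H).sw_counit_left h (F := fun x => x * k) (by fun_prop)]

/-- The point where the integral is used: `ξ(z)₁ λ(ξ(z)₂) = λ(ξ(z)) 1`, with `Δ_H ξ` given by the
second cocycle condition. It says that `λξ` intertwines the `H`-component of the product with the
product of `H`-components. -/
theorem smashSnd_mulFirst_integral (hl : IsAdInvariantIntegral l) (hR : IsPreBialgebra X m u)
    (hξ : IsCocycle X m u ξ) :
    convRight (braidComul X (smashAct X) (smashComul X)) (smashSnd X ∘ₗ mulFirst X m ξ)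
        ((l ∘ₗ ξ) ∘ₗ LinearMap.lTensor R (smashFst K R H)) =
      convLeft (braidComul X (smashAct X) (smashComul X))
        ((l ∘ₗ ξ) ∘ₗ LinearMap.lTensor R (smashFst K R H))
        (counitLeft X.counit H ∘ₗ LinearMap.lTensor R (smashSnd X)) := by
  have hX := hR.coalgebra
  refine TensorProduct.ext' fun r b => ?_
  revert b; apply lin_ext (by fun_prop) (by fun_prop); intro s k
  -- The common value of both sides on `r ⊗ (s # k)`.
  trans l (ξ (r ⊗ₜ s)) • k
  · rw [convRight_apply, sw_braidComul _ _ _ _ _ (by fun_prop) (by fun_prop)]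
    simp (disch := fun_prop) only [sw_smashComul, LinearMap.comp_apply, LinearMap.lTensor_tmul,
      smashFst_tmul]
    simp only [smashAct_tmul, tmul_sw, linearMap_sw, smashSnd_mulFirst_tmul hR, smul_sw,
      TensorProduct.tmul_smul, map_smul, smul_eq_mul]
    -- The second cocycle condition, read backwards, gathers the sum into the coproduct of `ξ(r ⊗
    -- s)`.
    trans sw (δ (ξ (r ⊗ₜ s))) fun x y => l y • (x * k)
    · rw [hξ.sw_comul_xi _ (by fun_prop) (by fun_prop)]
      simp (disch := fun_prop) only [sw_sq_comul, sw_sq_coact]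
      refine sw_congr fun r₁ r₂ => sw_congr fun s₁ s₂ => ?_
      refine Eq.trans (sw_congr fun q s₀ => ?_) (sw_comm₂ _ _ _ _).symm
      simp only [mul_smul, ← smul_sw]
      rw [(isCoalg_hopf K H).sw_counit_right k (F := fun x => sw (X.coact r₂) fun p r₀ =>
        l (ξ (r₀ ⊗ₜ s₀)) • sw (δ p) fun a b => ξ (r₁ ⊗ₜ X.act a s₁) * (b * (q * x)))
        (by fun_prop)]
      simp only [smul_sw]
      rw [hX.sw_coact_coassoc r₂ (by fun_prop) (by fun_prop) (by fun_prop)]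
      simp only [mul_assoc]
    · rw [hl.sw_left _ (F := fun x => x * k) (by fun_prop), one_mul]
  · symm
    rw [convLeft_apply, sw_braidComul _ _ _ _ _ (by fun_prop) (by fun_prop)]
    simp only [LinearMap.comp_apply, LinearMap.lTensor_tmul, smashFst_act, counitLeft_tmul]
    have e : ∀ (r₁ r₂ : R) (d₁ d₂ : R ⊗[K] H), (sw (X.coact r₂) fun q r₀ =>
        l (ξ (r₁ ⊗ₜ X.act q (smashFst K R H d₁))) • X.counit r₀ • smashSnd X d₂) =
        X.counit r₂ • l (ξ (r₁ ⊗ₜ smashFst K R H d₁)) • smashSnd X d₂ := fun r₁ r₂ d₁ d₂ => by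
      simp only [smul_comm _ (X.counit _)]
      rw [hX.sw_coact_counit' r₂ (F := fun q =>
        l (ξ (r₁ ⊗ₜ X.act q (smashFst K R H d₁))) • smashSnd X d₂) (by fun_prop), hX.one_act]
    simp only [e]
    simp only [← smul_sw]
    rw [hX.isCoalg.sw_counit_right r (F := fun r₁ => sw (smashComul X (s ⊗ₜ k)) fun d₁ d₂ =>
      l (ξ (r₁ ⊗ₜ smashFst K R H d₁)) • smashSnd X d₂) (by fun_prop),
      sw_smash_snd hX s k (F := fun x y => l (ξ (r ⊗ₜ smashFst K R H x)) • y)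
        (by fun_prop) (by fun_prop)]
    simp only [smashFst_tmul, TensorProduct.tmul_smul, map_smul, smul_assoc]
    exact (isCoalg_hopf K H).sw_counit_left k (F := fun y => l (ξ (r ⊗ₜ s)) • y) (by fun_prop)

/-- The pull-back of `smashSnd_mulFirst_integral` along `actFirst`, where the convolution becomes
that of the usual coalgebra `A ⊗ A`. -/
theorem smashSnd_smashMul_integral (hl : IsAdInvariantIntegral l) (hR : IsPreBialgebra X m u)
    (hξ : IsCocycle X m u ξ) :
    convRight (usualComul (smashComul X) (smashComul X)) (smashSnd X ∘ₗ smashMul X m ξ)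
        ((l ∘ₗ ξ) ∘ₗ smashProj₂ X) =
      convLeft (usualComul (smashComul X) (smashComul X)) ((l ∘ₗ ξ) ∘ₗ smashProj₂ X)
        (LinearMap.mul' K H ∘ₗ TensorProduct.map (smashSnd X) (smashSnd X)) := by
  have hX := hR.coalgebra
  have hc := isCoalgMap_actFirst X (isModuleCoalg_smash hX)
  have e₁ : (l ∘ₗ ξ) ∘ₗ smashProj₂ X =
      ((l ∘ₗ ξ) ∘ₗ LinearMap.lTensor R (smashFst K R H)) ∘ₗ actFirst R (smashAct X) := by
    refine TensorProduct.ext' fun a b => ?_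
    rw [LinearMap.comp_apply, smashProj₂_tmul, ← actFirst_natural (smashFst_act X)]
    rfl
  have e₂ : LinearMap.mul' K H ∘ₗ TensorProduct.map (smashSnd X) (smashSnd X) =
      (counitLeft X.counit H ∘ₗ LinearMap.lTensor R (smashSnd X)) ∘ₗ actFirst R (smashAct X) := by
    refine TensorProduct.ext' fun a b => ?_
    revert a; apply lin_ext (by fun_prop) (by fun_prop); intro r h
    simp [smashSnd_act hX]
  rw [e₁, e₂, smashMul_eq, ← LinearMap.comp_assoc, ← hc.convRight_comp, ← hc.convLeft_comp,
    smashSnd_mulFirst_integral hl hR hξ]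

/-- The multiplication of `A` twisted by `v` is that of the smash product without cocycle. -/
def twistedMul (X : YDCoalgebraData K H R) (m : R ⊗[K] R →ₗ[K] R) (ξ : R ⊗[K] R →ₗ[K] H)
    (v v' : R ⊗[K] R →ₗ[K] K) : (R ⊗[K] H) ⊗[K] (R ⊗[K] H) →ₗ[K] R ⊗[K] H :=
  conj (usualComul (smashComul X) (smashComul X)) (v ∘ₗ smashProj₂ X) (smashMul X m ξ)
    (v' ∘ₗ smashProj₂ X)

theorem isCoalg_smash_sq (hX : X.IsCoalgebra) :
    IsCoalg (usualComul (smashComul X) (smashComul X))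
      (tensorFun (smashCounit X) (smashCounit X)) :=
  (isCoalg_smash hX).tensor (isCoalg_smash hX)

theorem isConvInverse_smashProj₂ (hX : X.IsCoalgebra) {v' : R ⊗[K] R →ₗ[K] K}
    (hv : IsConvInverse (tensorSq X).comul (tensorSq X).counit v' v) :
    IsConvInverse (usualComul (smashComul X) (smashComul X))
      (tensorFun (smashCounit X) (smashCounit X)) (v ∘ₗ smashProj₂ X) (v' ∘ₗ smashProj₂ X) :=
  (isCoalgMap_smashProj₂ hX).isConvInverse_comp hv.symm

theorem isCoalgMap_twistedMul (hR : IsPreBialgebra X m u) (hξ : IsCocycle X m u ξ)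
    {v' : R ⊗[K] R →ₗ[K] K}
    (hv : IsConvInverse (tensorSq X).comul (tensorSq X).counit v' v) :
    IsCoalgMap (usualComul (smashComul X) (smashComul X))
      (tensorFun (smashCounit X) (smashCounit X)) (smashComul X) (smashCounit X)
      (twistedMul X m ξ v v') :=
  (isCoalgMap_smashMul hR hξ).conj (isCoalg_smash_sq hR.coalgebra)
    (isConvInverse_smashProj₂ hR.coalgebra hv)

/-- Cancelling `λξ` in the intertwining relation by its inverse `v` makes `π` multiplicative for the
twisted product. -/
theorem smashSnd_twistedMul (hl : IsAdInvariantIntegral l) (hR : IsPreBialgebra X m u)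
    (hξ : IsCocycle X m u ξ)
    (hv : IsConvInverse (tensorSq X).comul (tensorSq X).counit (l ∘ₗ ξ) v) (a b : R ⊗[K] H) :
    smashSnd X (twistedMul X m ξ v (l ∘ₗ ξ) (a ⊗ₜ b)) = smashSnd X a * smashSnd X b := by
  have := (isConvInverse_smashProj₂ hR.coalgebra hv).conj_eq (isCoalg_smash_sq hR.coalgebra)
    (smashSnd_smashMul_integral hl hR hξ)
  rw [← comp_conj] at this
  exact LinearMap.congr_fun this (a ⊗ₜ b)

theorem smashFst_smashMul (hR : IsPreBialgebra X m u) (hξ : IsCocycle X m u ξ) :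
    smashFst K R H ∘ₗ smashMul X m ξ = m ∘ₗ smashProj₂ X := by
  refine TensorProduct.ext' fun a b => ?_
  rw [LinearMap.comp_apply, smashMul_eq, LinearMap.comp_apply, smashFst_mulFirst hR hξ,
    actFirst_natural (smashFst_act X)]
  rfl

theorem smashFst_twistedMul (hR : IsPreBialgebra X m u) (hξ : IsCocycle X m u ξ)
    {v' : R ⊗[K] R →ₗ[K] K}
    (hv : IsConvInverse (tensorSq X).comul (tensorSq X).counit v' v)
    (y : (R ⊗[K] H) ⊗[K] (R ⊗[K] H)) :
    smashFst K R H (twistedMul X m ξ v v' y) = twist X m v (smashProj₂ X y) := by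
  have : smashFst K R H ∘ₗ twistedMul X m ξ v v' = twist X m v ∘ₗ smashProj₂ X := by
    rw [twistedMul, comp_conj, smashFst_smashMul hR hξ, twist_eq hR.coalgebra hv,
      conj_comp (isCoalgMap_smashProj₂ hR.coalgebra)]
  exact LinearMap.congr_fun this y

/-- The twisted product is a coalgebra map with components `m^v ∘ P₂` and `π · π`. Reassembling them
by `sw_smash_fst_snd` gives a smash product without cocycle. -/
theorem isSmashMul_twistedMul (hl : IsAdInvariantIntegral l) (hR : IsPreBialgebra X m u)
    (hξ : IsCocycle X m u ξ)
    (hv : IsConvInverse (tensorSq X).comul (tensorSq X).counit (l ∘ₗ ξ) v) :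
    IsSmashMul X ((TensorProduct.mk K R H).flip 1 ∘ₗ twist X m v)
      (twistedMul X m ξ v (l ∘ₗ ξ)) := by
  have hX := hR.coalgebra
  intro r h s k
  rw [← sw_smash_fst_snd hX (twistedMul X m ξ v (l ∘ₗ ξ) _),
    (isCoalgMap_twistedMul hR hξ hv).sw_comul _ (by fun_prop) (by fun_prop),
    sw_usualComul _ _ _ _ (by fun_prop) (by fun_prop)]
  simp only [smashSnd_twistedMul hl hR hξ hv, smashFst_twistedMul hR hξ hv]
  have e : ∀ a₁ a₂ : R ⊗[K] H, (sw (smashComul X (s ⊗ₜ k)) fun x y =>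
      twist X m v (smashProj₂ X (a₁ ⊗ₜ x)) ⊗ₜ[K] (smashSnd X a₂ * smashSnd X y)) =
      sw (δ k) fun x y => twist X m v (smashProj₂ X (a₁ ⊗ₜ (s ⊗ₜ x))) ⊗ₜ[K] (smashSnd X a₂ * y) :=
    fun a₁ a₂ => sw_smash_snd hX s k (F := fun x y => twist X m v (smashProj₂ X (a₁ ⊗ₜ x)) ⊗ₜ[K]
      (smashSnd X a₂ * y)) (by fun_prop) (by fun_prop)
  simp only [e]
  rw [sw_smash_snd hX r h (F := fun x' y' => sw (δ k) fun x y => twist X m v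
    (smashProj₂ X (x' ⊗ₜ (s ⊗ₜ x))) ⊗ₜ[K] (y' * y)) (by fun_prop) (by fun_prop)]
  refine sw_congr fun h₁ h₂ => ?_
  simp only [smashProj₂_tmul, smashFst_tmul, actFirst_tmul, map_smul, TensorProduct.tmul_smul,
    LinearMap.comp_apply, LinearMap.flip_apply, TensorProduct.mk_apply, smashRmul_tmul, one_mul,
    ← TensorProduct.smul_tmul']
  exact (isCoalg_hopf K H).sw_counit_left k (F := fun y => twist X m v (r ⊗ₜ X.act h₁ s) ⊗ₜ[K]
    (h₂ * y)) (by fun_prop)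

end Twisted

/-! ### The coboundary on `R` -/

section Coboundary

variable {K : Type*} [Field K] {H : Type*} [Ring H] [HopfAlgebra K H]

local notation "δ" => CoalgebraStruct.comul (R := K)
local notation "ϵ" => CoalgebraStruct.counit (R := K)

section General

variable {C D : Type*} [AddCommGroup C] [Module K C] [AddCommGroup D] [Module K D]
  {Δ : C →ₗ[K] C ⊗[K] C} {ε : C →ₗ[K] K} {ΔD : D →ₗ[K] D ⊗[K] D} {εD : D →ₗ[K] K}

theorem IsConvInverse.conv (hC : IsCoalg Δ ε) {f f' g g' : C →ₗ[K] K}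
    (hf : IsConvInverse Δ ε f f') (hg : IsConvInverse Δ ε g g') :
    IsConvInverse Δ ε (conv Δ f g) (conv Δ g' f') := by
  constructor
  · rw [hC.conv_assoc, ← hC.conv_assoc g, hg.1, hC.one_conv, hf.1]
  · rw [hC.conv_assoc, ← hC.conv_assoc f', hf.2, hC.one_conv, hg.2]

theorem IsConvInverse.of_comp_surjective {p : C →ₗ[K] D} (hp : IsCoalgMap Δ ε ΔD εD p)
    (hs : Function.Surjective p) {f g : D →ₗ[K] K} (h : IsConvInverse Δ ε (f ∘ₗ p) (g ∘ₗ p)) :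
    IsConvInverse ΔD εD f g := by
  constructor <;> refine (LinearMap.cancel_right hs).1 ?_
  · rw [hp.conv_comp, h.1, hp.counit_comp]
  · rw [hp.conv_comp, h.2, hp.counit_comp]

variable {V W W' : Type*} [AddCommGroup V] [Module K V] [AddCommGroup W] [Module K W]
  [AddCommGroup W'] [Module K W']

theorem lTensor_tensorAct {actV : H →ₗ[K] V →ₗ[K] V} {actW : H →ₗ[K] W →ₗ[K] W}
    {actW' : H →ₗ[K] W' →ₗ[K] W'} {f : W →ₗ[K] W'} (hf : ∀ h w, f (actW h w) = actW' h (f w))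
    (h : H) (x : V ⊗[K] W) : LinearMap.lTensor V f (tensorAct actV actW h x) =
      tensorAct actV actW' h (LinearMap.lTensor V f x) := by
  revert x; apply lin_ext (by fun_prop) (by fun_prop); intro a b
  simp only [tensorAct_tmul, linearMap_sw, LinearMap.lTensor_tmul, hf]

theorem IsInvariant.tensorFun {actV : H →ₗ[K] V →ₗ[K] V} {actW : H →ₗ[K] W →ₗ[K] W}
    {f : V →ₗ[K] K} {g : W →ₗ[K] K} (hf : IsInvariant actV f) (hg : IsInvariant actW g) :
    IsInvariant (tensorAct actV actW) (tensorFun f g) := by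
  intro h
  apply lin_ext (by fun_prop) (by fun_prop); intro a b
  simp only [tensorAct_tmul, linearMap_sw, tensorFun_tmul, hf _ _, hg _ _]
  rw [← (isCoalg_hopf K H).sw_counit_left h (F := fun x => ϵ x * (f a * g b)) (by fun_prop)]
  refine sw_congr fun x y => ?_
  simp only [smul_eq_mul]
  ring

end General

variable {R D M : Type*} [AddCommGroup R] [Module K R] [AddCommGroup D] [Module K D]
  [AddCommGroup M] [Module K M]
  {X : YDCoalgebraData K H R}

section Projections

variable {N : (R ⊗[K] H) ⊗[K] (R ⊗[K] H) →ₗ[K] R ⊗[K] H} {n : R ⊗[K] R →ₗ[K] R}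
  {g : R ⊗[K] R →ₗ[K] R ⊗[K] H}

theorem smashProj₂_idMul (hN : ∀ y, smashFst K R H (N y) = n (smashProj₂ X y))
    (hn : ∀ h z, n ((tensorSq X).act h z) = X.act h (n z)) :
    smashProj₂ X ∘ₗ idMul N = idMul n ∘ₗ smashProj₃ X := by
  refine TensorProduct.ext' fun a y => ?_
  rw [LinearMap.comp_apply, LinearMap.comp_apply, idMul, LinearMap.lTensor_tmul, smashProj₂_tmul,
    hN, smashProj₃_tmul, idMul, actFirst_natural hn]

/-- Unlike `idMul`, multiplying on the left leaves an `H`-part that acts on the third factor. So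
`mulActFirst` appears, and it becomes a plain `mulId` only when `g` takes values in `R # 1`, as
happens after twisting. -/
theorem smashProj₂_mulId (hX : X.IsCoalgebra) (hN : IsSmashMul X g N) :
    smashProj₂ X ∘ₗ mulId N = mulActFirst X.act g ∘ₗ smashProj₃ X :=
  ext_threefold fun a b c => by
    rw [LinearMap.comp_apply, LinearMap.comp_apply, mulId_tmul, smashProj₂_tmul,
      hN.actFirst hX.mul_act]
    rfl

theorem smashProj₃_mulIdId (hX : X.IsCoalgebra) (hN : IsSmashMul X g N) :
    smashProj₃ X ∘ₗ LinearMap.rTensor ((R ⊗[K] H) ⊗[K] (R ⊗[K] H)) N ∘ₗ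
        (TensorProduct.assoc K _ _ _).symm.toLinearMap =
      mulActFirst (tensorSq X).act g ∘ₗ smashProj₄ X :=
  ext_fourfold fun a b c d => by
    rw [LinearMap.comp_apply, LinearMap.comp_apply, LinearMap.comp_apply, LinearEquiv.coe_coe,
      TensorProduct.assoc_symm_tmul, LinearMap.rTensor_tmul, smashProj₃_tmul,
      hN.actFirst (isModuleCoalg_sq hX).mul_act]
    rfl

theorem smashProj₃_idIdMul (hN : ∀ y, smashFst K R H (N y) = n (smashProj₂ X y))
    (hn : ∀ h z, n ((tensorSq X).act h z) = X.act h (n z)) :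
    smashProj₃ X ∘ₗ LinearMap.lTensor (R ⊗[K] H) (LinearMap.lTensor (R ⊗[K] H) N) =
      LinearMap.lTensor R (LinearMap.lTensor R n) ∘ₗ smashProj₄ X := by
  refine TensorProduct.ext' fun a y => ?_
  have := LinearMap.congr_fun (smashProj₂_idMul hN hn) y
  rw [LinearMap.comp_apply, LinearMap.comp_apply, LinearMap.lTensor_tmul, smashProj₃_tmul,
    smashProj₄_tmul]
  refine (congrArg (fun z => actFirst R (tensorSq X).act (a ⊗ₜ z)) this).trans ?_
  rw [LinearMap.comp_apply]
  exact (actFirst_natural (fun h d => lTensor_tensorAct hn h d) a _).symm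

/-- Lifted to `A ⊗ A ⊗ D`, linearity is the left `H`-linearity of `N` in its first argument. -/
theorem mulActFirst_act (hX : X.IsCoalgebra) {act : H →ₗ[K] D →ₗ[K] D} {ΔD : D →ₗ[K] D ⊗[K] D}
    {εD : D →ₗ[K] K} (hD : IsModuleCoalg act ΔD εD) (hN : IsSmashMul X g N)
    (hNl : ∀ h a b, N (smashAct X h a ⊗ₜ b) = smashAct X h (N (a ⊗ₜ b))) (h : H)
    (x : R ⊗[K] (R ⊗[K] D)) :
    mulActFirst act g (tensorAct X.act (tensorAct X.act act) h x) =
      tensorAct X.act act h (mulActFirst act g x) := by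
  have hRD := isModuleCoalg_braid hX hD
  revert x; apply lin_ext (by fun_prop) (by fun_prop); intro r y
  revert y; apply lin_ext (by fun_prop) (by fun_prop); intro s d
  have e : r ⊗ₜ[K] (s ⊗ₜ[K] d) = actFirst R (tensorAct X.act act)
      ((r ⊗ₜ (1 : H)) ⊗ₜ actFirst R act ((s ⊗ₜ (1 : H)) ⊗ₜ d)) := by
    simp only [actFirst_tmul, hRD.one_act, hD.one_act]
  rw [e, ← actFirst_smashAct X hRD, ← hN.actFirst hD.mul_act, hNl, actFirst_smashAct X hD,
    hN.actFirst hD.mul_act]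

theorem smashProj₃_idMulId (hX : X.IsCoalgebra) (hN : IsSmashMul X g N)
    (hg : ∀ h z, mulActFirst X.act g ((tensorCube X).act h z) =
      (tensorSq X).act h (mulActFirst X.act g z)) :
    smashProj₃ X ∘ₗ LinearMap.lTensor (R ⊗[K] H) (mulId N) =
      LinearMap.lTensor R (mulActFirst X.act g) ∘ₗ smashProj₄ X := by
  refine TensorProduct.ext' fun a y => ?_
  have := LinearMap.congr_fun (smashProj₂_mulId hX hN) y
  rw [LinearMap.comp_apply, LinearMap.comp_apply, LinearMap.lTensor_tmul, smashProj₃_tmul,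
    smashProj₄_tmul]
  refine (congrArg (fun z => actFirst R (tensorSq X).act (a ⊗ₜ z)) this).trans ?_
  rw [LinearMap.comp_apply]
  exact (actFirst_natural hg a _).symm

theorem counitRight_act (hX : X.IsCoalgebra) (h : H) (z : R ⊗[K] R) :
    counitRight R X.counit ((tensorSq X).act h z) = X.act h (counitRight R X.counit z) := by
  revert z; apply lin_ext (by fun_prop) (by fun_prop); intro r s
  change counitRight R X.counit (tensorAct X.act X.act h (r ⊗ₜ s)) = _
  simp only [tensorAct_tmul, linearMap_sw, counitRight_tmul, hX.counit_act, map_smul, mul_smul]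
  exact (isCoalg_hopf K H).sw_counit_right h (F := fun x => X.counit s • X.act x r) (by fun_prop)

theorem counitRight_smashProj₂ (hX : X.IsCoalgebra) (b c : R ⊗[K] H) :
    counitRight R X.counit (smashProj₂ X (b ⊗ₜ c)) = smashCounit X c • smashFst K R H b := by
  revert b; apply lin_ext (by fun_prop) (by fun_prop); intro r h
  rw [smashProj₂_tmul, actFirst_tmul, counitRight_tmul, hX.counit_act, smashFst_tmul,
    (isCoalgMap_smashFst hX).counit, mul_comm, mul_smul]

theorem lTensor_counitRight_smashProj₃ (hX : X.IsCoalgebra) (a b c : R ⊗[K] H) :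
    LinearMap.lTensor R (counitRight R X.counit) (smashProj₃ X (a ⊗ₜ (b ⊗ₜ c))) =
      smashCounit X c • smashProj₂ X (a ⊗ₜ b) := by
  rw [smashProj₃_tmul, actFirst_natural (counitRight_act hX), counitRight_smashProj₂ hX,
    TensorProduct.tmul_smul, map_smul]
  rfl

theorem counitLast_smashProj₄ (hX : X.IsCoalgebra) (a b c d : R ⊗[K] H) :
    counitLast X.counit (smashProj₄ X (a ⊗ₜ (b ⊗ₜ (c ⊗ₜ d)))) =
      smashCounit X d • smashProj₃ X (a ⊗ₜ (b ⊗ₜ c)) := by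
  rw [smashProj₄_tmul, counitLast]
  refine (actFirst_natural (actE := (tensorSq X).act)
    (fun h d => lTensor_tensorAct (counitRight_act hX) h d) a _).trans ?_
  rw [lTensor_counitRight_smashProj₃ hX, TensorProduct.tmul_smul, map_smul]
  rfl

theorem tensorCounit_eq (f : R ⊗[K] R →ₗ[K] K) (ε : R →ₗ[K] K) :
    tensorCounit f ε = f ∘ₗ LinearMap.lTensor R (counitRight R ε) :=
  ext_threefold fun a b c => by
    simp [mul_comm]

theorem tensorCounit_smashProj₂ (hX : X.IsCoalgebra) (f : R ⊗[K] R →ₗ[K] K) :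
    tensorCounit (f ∘ₗ smashProj₂ X) (smashCounit X) =
      tensorCounit f X.counit ∘ₗ smashProj₃ X :=
  ext_threefold fun a b c => by
    rw [tensorCounit_tmul, tensorCounit_eq, LinearMap.comp_apply, LinearMap.comp_apply,
      LinearMap.comp_apply, lTensor_counitRight_smashProj₃ hX, map_smul, smul_eq_mul, mul_comm]

theorem tensorCounit₃_smashProj₃ (hX : X.IsCoalgebra) (f : R ⊗[K] (R ⊗[K] R) →ₗ[K] K) :
    tensorCounit₃ (f ∘ₗ smashProj₃ X) (smashCounit X) =
      tensorCounit₃ f X.counit ∘ₗ smashProj₄ X :=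
  ext_fourfold fun a b c d => by
    rw [tensorCounit₃_tmul, tensorCounit₃_eq, LinearMap.comp_apply, LinearMap.comp_apply,
      LinearMap.comp_apply, counitLast_smashProj₄ hX, map_smul, smul_eq_mul, mul_comm]

theorem tensorFun_smashProj₂ {f : R ⊗[K] R →ₗ[K] K} (hf : IsInvariant (tensorSq X).act f) :
    tensorFun (smashCounit X) (f ∘ₗ smashProj₂ X) = tensorFun X.counit f ∘ₗ smashProj₃ X := by
  refine TensorProduct.ext' fun a y => ?_
  rw [LinearMap.comp_apply, smashProj₃_tmul, tensorFun_actFirst X hf, tensorFun_tmul]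
  rfl

theorem tensorFun_smashProj₃ {f : R ⊗[K] (R ⊗[K] R) →ₗ[K] K}
    (hf : IsInvariant (tensorCube X).act f) :
    tensorFun (smashCounit X) (f ∘ₗ smashProj₃ X) = tensorFun X.counit f ∘ₗ smashProj₄ X := by
  refine TensorProduct.ext' fun a y => ?_
  rw [LinearMap.comp_apply, smashProj₄_tmul, tensorFun_actFirst X hf, tensorFun_tmul]
  rfl

end Projections

end Coboundary

/-! ### The dual quasi-bialgebra `R^v` -/

section DualQuasi

variable {K : Type*} [Field K] {H : Type*} [Ring H] [HopfAlgebra K H]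

local notation "δ" => CoalgebraStruct.comul (R := K)
local notation "ϵ" => CoalgebraStruct.counit (R := K)

variable {R D M : Type*} [AddCommGroup R] [Module K R] [AddCommGroup D] [Module K D]
  [AddCommGroup M] [Module K M] {X : YDCoalgebraData K H R} {m n : R ⊗[K] R →ₗ[K] R}
  {u : K →ₗ[K] R} {ξ : R ⊗[K] R →ₗ[K] H} {l : H →ₗ[K] K} {v v' : R ⊗[K] R →ₗ[K] K}

theorem mulActFirst_one (hX : X.IsCoalgebra) (n : R ⊗[K] R →ₗ[K] R) :
    mulActFirst X.act ((TensorProduct.mk K R H).flip 1 ∘ₗ n) = mulId n :=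
  ext_threefold fun r s t => by
    simp [hX.one_act]

theorem mulActFirst_sq_one (hX : X.IsCoalgebra) (n : R ⊗[K] R →ₗ[K] R) :
    mulActFirst (tensorSq X).act ((TensorProduct.mk K R H).flip 1 ∘ₗ n) =
      LinearMap.rTensor (R ⊗[K] R) n ∘ₗ (TensorProduct.assoc K R R (R ⊗[K] R)).symm.toLinearMap :=
  ext_threefold fun r s t => by
    simp [(isModuleCoalg_sq hX).one_act]

theorem mulId_act (hn : ∀ h z, n ((tensorSq X).act h z) = X.act h (n z)) (h : H)
    (z : R ⊗[K] (R ⊗[K] R)) :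
    mulId n ((tensorCube X).act h z) = (tensorSq X).act h (mulId n z) := by
  revert z; apply lin_ext (by fun_prop) (by fun_prop); intro r y
  revert y; apply lin_ext (by fun_prop) (by fun_prop); intro s t
  change mulId n (tensorAct X.act (tensorAct X.act X.act) h _) =
    tensorAct X.act X.act h (n (r ⊗ₜ s) ⊗ₜ t)
  have hn' : ∀ h, n (tensorAct X.act X.act h (r ⊗ₜ s)) = X.act h (n (r ⊗ₜ s)) :=
    fun h => hn h _
  simp only [tensorAct_tmul, tmul_sw, linearMap_sw, mulId_tmul] at hn' ⊢
  rw [← (isCoalg_hopf K H).sw_coassoc h (by fun_prop) (by fun_prop) (by fun_prop)]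
  refine sw_congr fun a b => ?_
  rw [← sw_tmul_const, hn']

/-- The coboundary as a convolution product on `R ⊗ R ⊗ R`. -/
def braidedCoboundary (X : YDCoalgebraData K H R) (m : R ⊗[K] R →ₗ[K] R) (ξ : R ⊗[K] R →ₗ[K] H)
    (v v' : R ⊗[K] R →ₗ[K] K) : R ⊗[K] (R ⊗[K] R) →ₗ[K] K :=
  conv (tensorCube X).comul
    (conv (tensorCube X).comul (tensorFun X.counit v) (v ∘ₗ idMul m))
    (conv (tensorCube X).comul (v' ∘ₗ mulActFirst X.act (mulXi X m ξ)) (tensorCounit v' X.counit))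

/-- Each of the four convolution factors of `∂²_A(v_A)` is a functional on `R ⊗ R ⊗ R` composed with
`P₃`; invariance of `v` is needed for `ε_A ⊗ v_A`. -/
theorem coboundary₂_smash (hR : IsPreBialgebra X m u) (hξ : IsCocycle X m u ξ)
    (hv : IsConvInverse (tensorSq X).comul (tensorSq X).counit v' v)
    (hvi : IsInvariant (tensorSq X).act v) :
    coboundary₂ (smashComul X) (smashCounit X) (smashMul X m ξ) (mho₂ X v) =
      braidedCoboundary X m ξ v v' ∘ₗ smashProj₃ X := by
  have hX := hR.coalgebra
  have h₃ := isCoalgMap_smashProj₃ hX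
  have hp : ∀ y, smashFst K R H (smashMul X m ξ y) = m (smashProj₂ X y) :=
    LinearMap.congr_fun (smashFst_smashMul hR hξ)
  rw [mho₂_eq, coboundary₂_eq (isCoalg_smash hX) (isConvInverse_smashProj₂ hX hv),
    braidedCoboundary, h₃.conv_comp, h₃.conv_comp, h₃.conv_comp, tensorFun_smashProj₂ hvi,
    tensorCounit_smashProj₂ hX, LinearMap.comp_assoc, LinearMap.comp_assoc, LinearMap.comp_assoc,
    LinearMap.comp_assoc, smashProj₂_idMul hp hR.mul_linear,
    smashProj₂_mulId hX (isSmashMul_smashMul X m ξ)]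

/-- `r ⊗ s ⊗ t ↦ (r # 1) ⊗ (s # 1) ⊗ (t # 1)` is a section of `P₃`. -/
theorem coboundaryR₂_eq (hR : IsPreBialgebra X m u) (hξ : IsCocycle X m u ξ)
    (hv : IsConvInverse (tensorSq X).comul (tensorSq X).counit v' v)
    (hvi : IsInvariant (tensorSq X).act v) :
    coboundaryR₂ X m ξ v = braidedCoboundary X m ξ v v' := by
  refine ext_threefold fun r s t => ?_
  simp only [coboundaryR₂, coboundary₂_smash hR hξ hv hvi, omega₃, LinearMap.comp_apply,
    TensorProduct.map_tmul, LinearMap.flip_apply, TensorProduct.mk_apply,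
    smashProj₃_one hR.coalgebra]

theorem coboundary₂_eq_comp (hR : IsPreBialgebra X m u) (hξ : IsCocycle X m u ξ)
    (hv : IsConvInverse (tensorSq X).comul (tensorSq X).counit v' v)
    (hvi : IsInvariant (tensorSq X).act v) :
    coboundary₂ (smashComul X) (smashCounit X) (smashMul X m ξ) (mho₂ X v) =
      coboundaryR₂ X m ξ v ∘ₗ smashProj₃ X := by
  rw [coboundaryR₂_eq hR hξ hv hvi, coboundary₂_smash hR hξ hv hvi]

theorem isInvariant_counit (hX : X.IsCoalgebra) : IsInvariant X.act X.counit := hX.counit_act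

theorem isInvariant_coboundaryR₂ (hR : IsPreBialgebra X m u) (hξ : IsCocycle X m u ξ)
    (hv : IsConvInverse (tensorSq X).comul (tensorSq X).counit v' v)
    (hvi : IsInvariant (tensorSq X).act v) (hvi' : IsInvariant (tensorSq X).act v') :
    IsInvariant (tensorCube X).act (coboundaryR₂ X m ξ v) := by
  have hX := hR.coalgebra
  have h₃ := isModuleCoalg_cube hX
  rw [coboundaryR₂_eq hR hξ hv hvi]
  refine ((IsInvariant.tensorFun (isInvariant_counit hX) hvi).conv h₃ fun h z => ?_).conv h₃
    (IsInvariant.conv h₃ (fun h z => ?_) fun h z => ?_)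
  · refine (congrArg v (lTensor_tensorAct (actW' := X.act) hR.mul_linear h z)).trans ?_
    exact hvi h _
  · refine (congrArg v' (mulActFirst_act hX hX.isModuleCoalg (isSmashMul_smashMul X m ξ)
      (smashMul_act_left hR hξ) h z)).trans ?_
    exact hvi' h _
  · rw [tensorCounit_eq]
    refine (congrArg v' (lTensor_tensorAct (counitRight_act hX) h z)).trans ?_
    exact hvi' h _

theorem isConvInvertible_coboundaryR₂ (hR : IsPreBialgebra X m u) (hξ : IsCocycle X m u ξ)
    (hv : IsConvInverse (tensorSq X).comul (tensorSq X).counit v' v)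
    (hvi : IsInvariant (tensorSq X).act v) (hvi' : IsInvariant (tensorSq X).act v') :
    IsConvInvertible (tensorCube X).comul (tensorCube X).counit (coboundaryR₂ X m ξ v) := by
  have hX := hR.coalgebra
  have h₃ := (isModuleCoalg_cube hX).coalg
  have hA := isCoalg_smash hX
  have hm := isCoalgMap_smashMul hR hξ
  have hw := isConvInverse_smashProj₂ hX hv
  have hp : ∀ y, smashFst K R H (smashMul X m ξ y) = m (smashProj₂ X y) :=
    LinearMap.congr_fun (smashFst_smashMul hR hξ)
  -- Inverses on `R ⊗ R ⊗ R` are tested after pull-back along the surjection `P₃`, where the results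
  -- for usual tensor products apply.
  have desc : ∀ f g : R ⊗[K] (R ⊗[K] R) →ₗ[K] K,
      IsConvInverse (usualComul (smashComul X) (usualComul (smashComul X) (smashComul X)))
        (tensorFun (smashCounit X) (tensorFun (smashCounit X) (smashCounit X)))
        (f ∘ₗ smashProj₃ X) (g ∘ₗ smashProj₃ X) →
      IsConvInverse (tensorCube X).comul (tensorCube X).counit f g := fun f g h =>
    IsConvInverse.of_comp_surjective (isCoalgMap_smashProj₃ hX) (smashProj₃_surjective hX) h
  have i₁ : IsConvInverse (tensorCube X).comul (tensorCube X).counit (tensorFun X.counit v)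
      (tensorFun X.counit v') := desc _ _ (by
    rw [← tensorFun_smashProj₂ hvi, ← tensorFun_smashProj₂ hvi']
    exact IsConvInverse.counit_tensorFun (ΔD := usualComul (smashComul X) (smashComul X)) hA hw)
  have i₂ : IsConvInverse (tensorCube X).comul (tensorCube X).counit (v ∘ₗ idMul m)
      (v' ∘ₗ idMul m) := desc _ _ (by
    rw [LinearMap.comp_assoc, LinearMap.comp_assoc, ← smashProj₂_idMul hp hR.mul_linear]
    have := (isCoalgMap_idMul hm).isConvInverse_comp hw
    simp only [LinearMap.comp_assoc] at this
    exact this)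
  have i₃ : IsConvInverse (tensorCube X).comul (tensorCube X).counit
      (v' ∘ₗ mulActFirst X.act (mulXi X m ξ)) (v ∘ₗ mulActFirst X.act (mulXi X m ξ)) := desc _ _ (by
    rw [LinearMap.comp_assoc, LinearMap.comp_assoc,
      ← smashProj₂_mulId hX (isSmashMul_smashMul X m ξ)]
    have := (isCoalgMap_mulId hm).isConvInverse_comp hw.symm
    simp only [LinearMap.comp_assoc] at this
    exact this)
  have i₄ : IsConvInverse (tensorCube X).comul (tensorCube X).counit
      (tensorCounit v' X.counit) (tensorCounit v X.counit) := desc _ _ (by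
    rw [← tensorCounit_smashProj₂ hX, ← tensorCounit_smashProj₂ hX]
    exact hw.symm.tensorCounit hA)
  rw [coboundaryR₂_eq hR hξ hv hvi]
  exact ⟨_, (i₁.conv h₃ i₂).conv h₃ (i₃.conv h₃ i₄)⟩

theorem twist_linear (hR : IsPreBialgebra X m u)
    (hv : IsConvInverse (tensorSq X).comul (tensorSq X).counit v' v)
    (hvi : IsInvariant (tensorSq X).act v) (hvi' : IsInvariant (tensorSq X).act v') (h : H)
    (z : R ⊗[K] R) : twist X m v ((tensorSq X).act h z) = X.act h (twist X m v z) := by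
  rw [twist_eq hR.coalgebra hv]
  exact conj_linear (isModuleCoalg_sq hR.coalgebra) hvi hvi' hR.mul_linear h z

theorem twist_isCoalgMap (hR : IsPreBialgebra X m u)
    (hv : IsConvInverse (tensorSq X).comul (tensorSq X).counit v' v) :
    IsCoalgMap (tensorSq X).comul (tensorSq X).counit X.comul X.counit (twist X m v) := by
  rw [twist_eq hR.coalgebra hv]
  exact (isCoalgMap_mul hR).conj (isModuleCoalg_sq hR.coalgebra).coalg hv.symm

/-- The `R`-component of quasi-associativity in `A`. As the twisted product has no cocycle left,
both sides factor through the surjection `P₃`. -/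
theorem twist_quasi_assoc (hl : IsAdInvariantIntegral l) (hR : IsPreBialgebra X m u)
    (hξ : IsCocycle X m u ξ)
    (hv : IsConvInverse (tensorSq X).comul (tensorSq X).counit (l ∘ₗ ξ) v) :
    convRight (tensorCube X).comul (twist X m v ∘ₗ idMul (twist X m v)) (coboundaryR₂ X m ξ v) =
      convLeft (tensorCube X).comul (coboundaryR₂ X m ξ v)
        (twist X m v ∘ₗ mulId (twist X m v)) := by
  have hX := hR.coalgebra
  have hvi' := hξ.isInvariant hl
  have hvi := hvi'.inverse (isModuleCoalg_sq hX) hv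
  have h₃ := isCoalgMap_smashProj₃ hX
  have hN := isSmashMul_twistedMul hl hR hξ hv
  have hp := smashFst_twistedMul hR hξ hv
  have hpc : smashFst K R H ∘ₗ twistedMul X m ξ v (l ∘ₗ ξ) = twist X m v ∘ₗ smashProj₂ X :=
    LinearMap.ext hp
  have key := quasi_assoc_conj (isCoalg_smash hX) (isCoalgMap_smashMul hR hξ)
    (smashMul_assoc hR hξ) (isConvInverse_smashProj₂ hX hv)
  rw [← mho₂_eq, coboundary₂_eq_comp hR hξ hv hvi, mho₂_eq, ← twistedMul] at key
  have key' := congrArg (fun f => smashFst K R H ∘ₗ f) key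
  simp only [comp_convLeft, comp_convRight] at key'
  rw [← LinearMap.comp_assoc, ← LinearMap.comp_assoc, hpc, LinearMap.comp_assoc,
    LinearMap.comp_assoc, smashProj₂_idMul hp (twist_linear hR hv hvi hvi'),
    smashProj₂_mulId hX hN, mulActFirst_one hX, ← LinearMap.comp_assoc, ← LinearMap.comp_assoc,
    ← h₃.convRight_comp, ← h₃.convLeft_comp] at key'
  exact (LinearMap.cancel_right (smashProj₃_surjective hX)).1 key'

/-- The pentagon in `A`, all of whose terms factor through the surjection `P₄`. The form of the
twisted product makes the two left-handed multiplications descend to those of `m^v`. -/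
theorem twist_three_cocycle (hl : IsAdInvariantIntegral l) (hR : IsPreBialgebra X m u)
    (hξ : IsCocycle X m u ξ)
    (hv : IsConvInverse (tensorSq X).comul (tensorSq X).counit (l ∘ₗ ξ) v) :
    conv (tensorFourth X).comul
      (coboundaryR₂ X m ξ v ∘ₗ LinearMap.lTensor R (LinearMap.lTensor R (twist X m v)))
      (coboundaryR₂ X m ξ v ∘ₗ LinearMap.rTensor (R ⊗[K] R) (twist X m v) ∘ₗ
        (TensorProduct.assoc K R R (R ⊗[K] R)).symm.toLinearMap) =
    conv (tensorFourth X).comul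
      (conv (tensorFourth X).comul (tensorFun X.counit (coboundaryR₂ X m ξ v))
        (coboundaryR₂ X m ξ v ∘ₗ LinearMap.lTensor R (mulId (twist X m v))))
      (tensorCounit₃ (coboundaryR₂ X m ξ v) X.counit) := by
  have hX := hR.coalgebra
  have hvi' := hξ.isInvariant hl
  have hvi := hvi'.inverse (isModuleCoalg_sq hX) hv
  have h₄ := isCoalgMap_smashProj₄ hX
  have hN := isSmashMul_twistedMul hl hR hξ hv
  have hp := smashFst_twistedMul hR hξ hv
  have hlin := twist_linear hR hv hvi hvi'
  have key := pentagon_conj (isCoalg_smash hX) (isCoalgMap_smashMul hR hξ)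
    (smashMul_assoc hR hξ) (isConvInverse_smashProj₂ hX hv)
  dsimp only at key
  rw [← mho₂_eq, coboundary₂_eq_comp hR hξ hv hvi, mho₂_eq, ← twistedMul] at key
  rw [tensorFun_smashProj₃ (isInvariant_coboundaryR₂ hR hξ hv hvi hvi'),
    tensorCounit₃_smashProj₃ hX, LinearMap.comp_assoc, smashProj₃_idIdMul hp hlin,
    LinearMap.comp_assoc _ _ (coboundaryR₂ X m ξ v), smashProj₃_mulIdId hX hN,
      mulActFirst_sq_one hX,
    LinearMap.comp_assoc _ _ (coboundaryR₂ X m ξ v), smashProj₃_idMulId hX hN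
      (by rw [mulActFirst_one hX]; exact mulId_act hlin), mulActFirst_one hX] at key
  refine (LinearMap.cancel_right (smashProj₄_surjective hX)).1 ?_
  rw [h₄.conv_comp, h₄.conv_comp, h₄.conv_comp]
  simp only [LinearMap.comp_assoc] at key ⊢
  exact key

/-- The twisted product sends `(r # 1) ⊗ (s # 1)` to `m^v(r ⊗ s) # 1`. Applying `π ⊗ p` to the
coproduct of this element gives the coaction of `m^v(r ⊗ s)`; computing the same through the
coalgebra map property and multiplicativity of `π` gives `r₋₁ s₋₁ ⊗ m^v(r₀ ⊗ s₀)`. -/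
theorem twist_colinear (hl : IsAdInvariantIntegral l) (hR : IsPreBialgebra X m u)
    (hξ : IsCocycle X m u ξ)
    (hv : IsConvInverse (tensorSq X).comul (tensorSq X).counit (l ∘ₗ ξ) v) :
    YDCoalgebraData.IsColinear (tensorSq X) X (twist X m v) := by
  have hX := hR.coalgebra
  have hN := isSmashMul_twistedMul hl hR hξ hv
  refine TensorProduct.ext' fun r s => ?_
  have e : twistedMul X m ξ v (l ∘ₗ ξ) ((r ⊗ₜ 1) ⊗ₜ (s ⊗ₜ 1)) = twist X m v (r ⊗ₜ s) ⊗ₜ 1 := by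
    rw [hN, sw_comul_one (by fun_prop) (by fun_prop), hX.one_act]
    simp
  have e₁ := sw_smash_snd_fst hX (twist X m v (r ⊗ₜ s)) (1 : H)
  simp only [mul_one, sw_eta] at e₁
  rw [LinearMap.comp_apply, LinearMap.comp_apply, ← e₁, ← e,
    (isCoalgMap_twistedMul hR hξ hv).sw_comul _ (by fun_prop) (by fun_prop),
    sw_usualComul _ _ _ _ (by fun_prop) (by fun_prop)]
  simp only [smashSnd_twistedMul hl hR hξ hv, smashFst_twistedMul hR hξ hv]
  have e₂ : ∀ a₁ a₂ : R ⊗[K] H, (sw (smashComul X (s ⊗ₜ (1 : H))) fun x y =>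
      (smashSnd X a₁ * smashSnd X x) ⊗ₜ[K] twist X m v (smashProj₂ X (a₂ ⊗ₜ y))) =
      sw (X.coact s) fun k s₀ => (smashSnd X a₁ * k) ⊗ₜ[K]
        twist X m v (smashProj₂ X (a₂ ⊗ₜ (s₀ ⊗ₜ 1))) := fun a₁ a₂ => by
    rw [sw_smash_snd_left hX s 1 (F := fun x y => (smashSnd X a₁ * x) ⊗ₜ[K]
      twist X m v (smashProj₂ X (a₂ ⊗ₜ y))) (by fun_prop) (by fun_prop)]
    simp (disch := fun_prop) only [sw_comul_one, mul_one]
  simp only [e₂]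
  rw [sw_smash_snd_left hX r 1 (F := fun x y => sw (X.coact s) fun k s₀ => (x * k) ⊗ₜ[K]
    twist X m v (smashProj₂ X (y ⊗ₜ (s₀ ⊗ₜ 1)))) (by fun_prop) (by fun_prop)]
  simp (disch := fun_prop) only [sw_comul_one, mul_one, smashProj₂_one hX]
  change _ = LinearMap.lTensor H (twist X m v) (tensorCoact X.coact X.coact (r ⊗ₜ s))
  simp only [tensorCoact_tmul, linearMap_sw, LinearMap.lTensor_tmul]

theorem sw_smash_one_left (hX : X.IsCoalgebra) (r : R) {F : H → R ⊗[K] H → M}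
    (h₁ : ∀ b, Lin K (fun a => F a b)) (h₂ : ∀ a, Lin K (F a)) :
    (sw (smashComul X (r ⊗ₜ 1)) fun x y => F (smashSnd X x) y) =
      sw (X.coact r) fun k r₀ => F k (r₀ ⊗ₜ 1) := by
  rw [sw_smash_snd_left hX r 1 h₁ h₂]
  simp (disch := fun_prop) only [sw_comul_one, mul_one]

theorem sw_smash_one_right (hX : X.IsCoalgebra) (r : R) {F : R ⊗[K] H → H → M}
    (h₁ : ∀ b, Lin K (fun a => F a b)) (h₂ : ∀ a, Lin K (F a)) :
    (sw (smashComul X (r ⊗ₜ 1)) fun x y => F x (smashSnd X y)) = F (r ⊗ₜ 1) 1 := by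
  rw [sw_smash_snd hX r 1 h₁ h₂, sw_comul_one (by fun_prop) (by fun_prop)]

/-- The `H`-component of quasi-associativity in `A`. Since `π` is multiplicative, both bracketings
have the component `π · π · π`. On `r # 1`, `s # 1`, `t # 1` the identity becomes `r₋₁ s₋₁ t₋₁ α(r₀
⊗ s₀ ⊗ t₀) = α(r ⊗ s ⊗ t) 1`. -/
theorem coboundaryR₂_colinear (hl : IsAdInvariantIntegral l) (hR : IsPreBialgebra X m u)
    (hξ : IsCocycle X m u ξ)
    (hv : IsConvInverse (tensorSq X).comul (tensorSq X).counit (l ∘ₗ ξ) v) :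
    YDCoalgebraData.IsColinear (tensorCube X) (YDCoalgebraData.unit K H)
      (coboundaryR₂ X m ξ v) := by
  have hX := hR.coalgebra
  have hvi' := hξ.isInvariant hl
  have hvi := hvi'.inverse (isModuleCoalg_sq hX) hv
  have hs := smashSnd_twistedMul hl hR hξ hv
  have key := quasi_assoc_conj (isCoalg_smash hX) (isCoalgMap_smashMul hR hξ)
    (smashMul_assoc hR hξ) (isConvInverse_smashProj₂ hX hv)
  rw [← mho₂_eq, coboundary₂_eq_comp hR hξ hv hvi, mho₂_eq, ← twistedMul] at key
  have key' := congrArg (fun f => smashSnd X ∘ₗ f) key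
  simp only [comp_convLeft, comp_convRight] at key'
  have e₁ : smashSnd X ∘ₗ twistedMul X m ξ v (l ∘ₗ ξ) ∘ₗ mulId (twistedMul X m ξ v (l ∘ₗ ξ)) =
      smashSnd X ∘ₗ twistedMul X m ξ v (l ∘ₗ ξ) ∘ₗ idMul (twistedMul X m ξ v (l ∘ₗ ξ)) :=
    ext_threefold fun a b c => by
      simp only [LinearMap.comp_apply, mulId_tmul, idMul_tmul, hs, mul_assoc]
  rw [e₁] at key'
  refine ext_threefold fun r s t => ?_
  have key₃ := LinearMap.congr_fun key'
    ((r ⊗ₜ (1 : H)) ⊗ₜ[K] ((s ⊗ₜ[K] (1 : H)) ⊗ₜ[K] (t ⊗ₜ[K] (1 : H))))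
  rw [convRight_apply, convLeft_apply] at key₃
  simp (disch := fun_prop) only [sw_usualComul] at key₃
  simp only [LinearMap.comp_apply, idMul_tmul, hs] at key₃
  generalize coboundaryR₂ X m ξ v = α at key₃ ⊢
  rw [sw_smash_one_left hX r (F := fun x y => sw (smashComul X (s ⊗ₜ (1 : H))) fun b₁ b₂ =>
      sw (smashComul X (t ⊗ₜ (1 : H))) fun c₁ c₂ => α (smashProj₃ X (y ⊗ₜ (b₂ ⊗ₜ c₂))) •
        (x * (smashSnd X b₁ * smashSnd X c₁))) (by fun_prop) (by fun_prop),
    sw_smash_one_right hX r (F := fun x y => sw (smashComul X (s ⊗ₜ (1 : H))) fun b₁ b₂ =>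
      sw (smashComul X (t ⊗ₜ (1 : H))) fun c₁ c₂ => α (smashProj₃ X (x ⊗ₜ (b₁ ⊗ₜ c₁))) •
        (y * (smashSnd X b₂ * smashSnd X c₂))) (by fun_prop) (by fun_prop),
    sw_smash_one_right hX s (F := fun x y => sw (smashComul X (t ⊗ₜ (1 : H))) fun c₁ c₂ =>
      α (smashProj₃ X ((r ⊗ₜ 1) ⊗ₜ (x ⊗ₜ c₁))) • (1 * (y * smashSnd X c₂)))
      (by fun_prop) (by fun_prop),
    sw_smash_one_right hX t (F := fun x y => α (smashProj₃ X ((r ⊗ₜ 1) ⊗ₜ ((s ⊗ₜ 1) ⊗ₜ x))) •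
      (1 * (1 * y))) (by fun_prop) (by fun_prop), smashProj₃_one hX] at key₃
  simp only [one_mul] at key₃
  change (1 : H) ⊗ₜ[K] α (r ⊗ₜ (s ⊗ₜ t)) = LinearMap.lTensor H α
    (tensorCoact X.coact (tensorCoact X.coact X.coact) (r ⊗ₜ (s ⊗ₜ t)))
  rw [tensorCoact_tmul, tensorCoact_tmul]
  simp (disch := fun_prop) only [sw_sw, sw_tmul, linearMap_sw, LinearMap.lTensor_tmul]
  apply (TensorProduct.rid K H).injective
  simp only [linearEquiv_sw, TensorProduct.rid_tmul]
  rw [← key₃]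
  refine sw_congr fun k r₀ => ?_
  rw [sw_smash_one_left hX s (F := fun x y => sw (smashComul X (t ⊗ₜ (1 : H))) fun c₁ c₂ =>
      α (smashProj₃ X ((r₀ ⊗ₜ 1) ⊗ₜ (y ⊗ₜ c₂))) • (k * (x * smashSnd X c₁)))
    (by fun_prop) (by fun_prop)]
  refine sw_congr fun k' s₀ => ?_
  rw [sw_smash_one_left hX t (F := fun x y => α (smashProj₃ X ((r₀ ⊗ₜ 1) ⊗ₜ ((s₀ ⊗ₜ 1) ⊗ₜ y))) •
      (k * (k' * x))) (by fun_prop) (by fun_prop)]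
  simp only [smashProj₃_one hX]

theorem conj_counit {C : Type*} [AddCommGroup C] [Module K C] {Δ : C →ₗ[K] C ⊗[K] C}
    {ε : C →ₗ[K] K} (hC : IsCoalg Δ ε) (g : C →ₗ[K] M) : conj Δ ε g ε = g := by
  refine dual_ext fun φ => ?_
  rw [comp_conj, conj_eq_conv, hC.one_conv, hC.conv_one]

theorem isCoalgMap_unit_tmul (hR : IsPreBialgebra X m u) :
    IsCoalgMap X.comul X.counit (tensorSq X).comul (tensorSq X).counit
      (TensorProduct.mk K R R (u 1)) := by
  refine IsCoalgMap.of_sw (fun r => ?_) (fun r => ?_)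
  · rw [TensorProduct.mk_apply, ← sw_eta ((tensorSq X).comul _),
      sw_sq_comul _ _ _ (by fun_prop) (by fun_prop)]
    simp (disch := fun_prop) only [comul_unit hR, sw_tmul, coact_unit hR, hR.coalgebra.one_act,
      TensorProduct.mk_apply]
  · refine (tensorFun_tmul _ _ _ _).trans ?_
    rw [counit_unit hR, one_mul]

theorem isCoalgMap_tmul_unit (hR : IsPreBialgebra X m u) :
    IsCoalgMap X.comul X.counit (tensorSq X).comul (tensorSq X).counit
      ((TensorProduct.mk K R R).flip (u 1)) := by
  refine IsCoalgMap.of_sw (fun r => ?_) (fun r => ?_)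
  · rw [LinearMap.flip_apply, TensorProduct.mk_apply, ← sw_eta ((tensorSq X).comul _),
      sq_comul_tmul_one hR _ (by fun_prop) (by fun_prop)]
    rfl
  · refine (tensorFun_tmul _ _ _ _).trans ?_
    rw [counit_unit hR, mul_one]

theorem isDualQuasiBialgebra_twist (hl : IsAdInvariantIntegral l) (hR : IsPreBialgebra X m u)
    (hξ : IsCocycle X m u ξ)
    (hv : IsConvInverse (tensorSq X).comul (tensorSq X).counit (l ∘ₗ ξ) v) :
    IsDualQuasiBialgebra X (twist X m v) u (coboundaryR₂ X m ξ v) := by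
  have hX := hR.coalgebra
  have hvi' := hξ.isInvariant hl
  have hvi := hvi'.inverse (isModuleCoalg_sq hX) hv
  have hm := twist_isCoalgMap hR hv
  -- Normalization of `λξ` on either side comes from that of `ξ` and `λ(1) = 1`; the coboundary then
  -- inherits it.
  have hwl : ∀ a, ((l ∘ₗ ξ) ∘ₗ smashProj₂ X) ((u 1 ⊗ₜ 1) ⊗ₜ a) = smashCounit X a := fun a => by
    rw [LinearMap.comp_apply, smashProj₂_tmul, actFirst_tmul, hX.one_act, LinearMap.comp_apply,
      hξ.map_one_tmul, Algebra.algebraMap_eq_smul_one, map_smul, hl.map_one,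
      (isCoalgMap_smashFst hX).counit, smul_eq_mul, mul_one]
  have hwr : ∀ a, ((l ∘ₗ ξ) ∘ₗ smashProj₂ X) (a ⊗ₜ (u 1 ⊗ₜ 1)) = smashCounit X a := by
    apply lin_ext (by fun_prop) (by fun_prop); intro r h
    rw [LinearMap.comp_apply, smashProj₂_tmul, smashFst_tmul, Bialgebra.counit_one, one_smul,
      actFirst_tmul, act_unit hR, LinearMap.comp_apply, TensorProduct.tmul_smul, map_smul,
      hξ.map_tmul_one, Algebra.algebraMap_eq_smul_one, map_smul, map_smul, hl.map_one,
      smashCounit_tmul, smul_eq_mul, smul_eq_mul, mul_one, mul_comm]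
  have hα := coboundary₂_unit (isCoalg_smash hX) (smashComul_one hR) (smashCounit_one hR)
    (smashMul_one_left hR hξ) (smashMul_one_right hR hξ) (isCoalgMap_smashMul hR hξ)
    (isConvInverse_smashProj₂ hX hv) hwl hwr
  rw [← mho₂_eq, coboundary₂_eq_comp hR hξ hv hvi] at hα
  have hα' : ∀ r s : R, _ := fun r s => hα (r ⊗ₜ 1) (s ⊗ₜ 1)
  simp only [LinearMap.comp_apply, smashProj₃_one hX, smashCounit_tmul, Bialgebra.counit_one,
    mul_one] at hα'
  -- On `1 ⊗ R` and `R ⊗ 1` both `λξ` and its inverse are counits, so the twist changes nothing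
  -- there.
  have key : ∀ j : R →ₗ[K] R ⊗[K] R,
      IsCoalgMap X.comul X.counit (tensorSq X).comul (tensorSq X).counit j →
      (l ∘ₗ ξ) ∘ₗ j = X.counit → m ∘ₗ j = LinearMap.id → twist X m v ∘ₗ j = LinearMap.id :=
    fun j hj h₁ h₂ => by
      rw [twist_eq hX hv, conj_comp hj, h₁, hv.normalized hX.isCoalg hj h₁, h₂,
        conj_counit hX.isCoalg]
  exact
  { coalgebra := hX
    mul_linear := twist_linear hR hv hvi hvi'
    mul_colinear := twist_colinear hl hR hξ hv
    mul_coalgHom := ⟨LinearMap.ext hm.comul, LinearMap.ext hm.counit⟩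
    unit_linear := hR.unit_linear
    unit_colinear := hR.unit_colinear
    unit_coalgHom := hR.unit_coalgHom
    assoc_linear := isInvariant_coboundaryR₂ hR hξ hv hvi hvi'
    assoc_colinear := coboundaryR₂_colinear hl hR hξ hv
    assoc_invertible := isConvInvertible_coboundaryR₂ hR hξ hv hvi hvi'
    three_cocycle := twist_three_cocycle hl hR hξ hv
    assoc_one_left := fun r s => (hα' r s).1
    assoc_one_middle := fun r s => (hα' r s).2.1
    assoc_one_right := fun r s => (hα' r s).2.2
    quasi_assoc := twist_quasi_assoc hl hR hξ hv
    one_mul := LinearMap.congr_fun (key _ (isCoalgMap_unit_tmul hR)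
      (LinearMap.ext fun r => by
        simp [hξ.map_one_tmul, Algebra.algebraMap_eq_smul_one, hl.map_one])
      (LinearMap.ext hR.one_mul))
    mul_one := LinearMap.congr_fun (key _ (isCoalgMap_tmul_unit hR)
      (LinearMap.ext fun r => by
        simp [hξ.map_tmul_one, Algebra.algebraMap_eq_smul_one, hl.map_one])
      (LinearMap.ext hR.mul_one)) }

end DualQuasi

/-! ### Connected coalgebras are exhausted by their coradical filtration -/

/-- Choose a left ideal `L` complementary to `J`. Then `J L ≤ J ⊓ L = ⊥`. The two-sided ideal `L A`
contains `L`, so it cannot be proper, for otherwise `L ≤ J` and `J = A`. Hence `J = J (L A) = (J L)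
A = ⊥`. -/
theorem eq_bot_of_greatest_ideal {A : Type*} [Ring A] [IsSemisimpleRing A] (J : Ideal A)
    [J.IsTwoSided] (hJ : J ≠ ⊤) (h : ∀ I : Ideal A, I.IsTwoSided → I ≠ ⊤ → I ≤ J) : J = ⊥ := by
  obtain ⟨L, hL⟩ := exists_isCompl J
  have h₁ : J * L = ⊥ := by
    rw [← le_bot_iff, ← hL.inf_eq_bot]
    exact le_inf (Ideal.mul_le.2 fun r hr s _ => J.mul_mem_right s hr)
      (Ideal.mul_le.2 fun r _ s hs => L.mul_mem_left r hs)
  have h₂ : L * (⊤ : Ideal A) = ⊤ := by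
    by_contra hne
    have hle : L ≤ J := le_trans (fun x hx => by
      simpa using Ideal.mul_mem_mul hx (Submodule.mem_top (x := (1 : A))))
      (h (L * ⊤) inferInstance hne)
    exact hJ (by rw [← hL.sup_eq_top, sup_eq_left.2 hle])
  rw [← J.mul_top, ← h₂, ← Ideal.mul_assoc, h₁, Ideal.bot_mul]

/-- In an Artinian ring, a proper two-sided ideal that contains all others is nilpotent. -/
theorem isNilpotent_of_greatest_ideal {A : Type*} [Ring A] [IsArtinianRing A] (J : Ideal A)
    [J.IsTwoSided] (hJ : J ≠ ⊤) (h : ∀ I : Ideal A, I.IsTwoSided → I ≠ ⊤ → I ≤ J) :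
    IsNilpotent J := by
  obtain ⟨n, hn⟩ := IsSemiprimaryRing.isNilpotent (R := A)
  have : Nontrivial A := by
    by_contra hA
    rw [not_nontrivial_iff_subsingleton] at hA
    exact hJ (Subsingleton.elim _ _)
  -- Modulo the Jacobson radical the ring is semisimple and the image of `J` is still the greatest
  -- proper two-sided ideal, hence zero. The radical itself is nilpotent.
  suffices hle : J ≤ Ring.jacobson A from
    ⟨n, le_bot_iff.1 ((Ideal.pow_right_mono hle n).trans hn.le)⟩
  have hr : Ring.jacobson A ≤ J := h _ inferInstance (Ring.jacobson_lt_top A).ne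
  have hs : Function.Surjective (Ideal.Quotient.mk (Ring.jacobson A)) :=
    Ideal.Quotient.mk_surjective
  have hmem : ∀ x, Ideal.Quotient.mk (Ring.jacobson A) x ∈
      J.map (Ideal.Quotient.mk (Ring.jacobson A)) → x ∈ J := fun x hx => by
    obtain ⟨y, hy, hxy⟩ := (Ideal.mem_map_iff_of_surjective _ hs).1 hx
    rw [Ideal.Quotient.eq] at hxy
    have := J.sub_mem hy (hr hxy)
    rwa [sub_sub_cancel] at this
  have : RingHomSurjective (Ideal.Quotient.mk (Ring.jacobson A)) := ⟨hs⟩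
  have key := eq_bot_of_greatest_ideal (J.map (Ideal.Quotient.mk (Ring.jacobson A)))
    (fun hne => hJ ((Ideal.eq_top_iff_one _).2 (hmem 1 (by rw [hne]; trivial))))
    (fun I hI hne x hx => by
      obtain ⟨y, rfl⟩ := hs x
      refine Ideal.mem_map_of_mem _ (h (I.comap (Ideal.Quotient.mk (Ring.jacobson A)))
        inferInstance ?_ hx)
      rwa [Ne, Ideal.comap_eq_top_iff])
  intro x hx
  rw [← Ideal.Quotient.eq_zero_iff_mem, ← Ideal.mem_bot, ← key]
  exact Ideal.mem_map_of_mem _ hx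

/-! ### Membership in a tensor product of subspaces -/

section Wedge

variable {K : Type*} [Field K] {M N : Type*} [AddCommGroup M] [Module K M] [AddCommGroup N]
  [Module K N]

/-- Retractions `p`, `q` onto `D` and `E` fix all one-sided slices of `t`, so `(p ⊗ q) t` and `t`
agree under every pair of functionals. -/
theorem mem_range_map_subtype {D : Submodule K M} {E : Submodule K N} {t : M ⊗[K] N}
    (h₁ : ∀ ψ : N →ₗ[K] K, (sw t fun a b => ψ b • a) ∈ D)
    (h₂ : ∀ φ : M →ₗ[K] K, (sw t fun a b => φ a • b) ∈ E) :
    t ∈ LinearMap.range (TensorProduct.map D.subtype E.subtype) := by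
  obtain ⟨p, hp⟩ := D.subtype.exists_leftInverse_of_injective (Submodule.ker_subtype D)
  obtain ⟨q, hq⟩ := E.subtype.exists_leftInverse_of_injective (Submodule.ker_subtype E)
  have hp' : ∀ x ∈ D, (p x : M) = x := fun x hx =>
    congrArg Subtype.val (LinearMap.congr_fun hp ⟨x, hx⟩)
  have hq' : ∀ x ∈ E, (q x : N) = x := fun x hx =>
    congrArg Subtype.val (LinearMap.congr_fun hq ⟨x, hx⟩)
  refine ⟨TensorProduct.map p q t, ?_⟩
  apply tensor_ext_dual
  intro φ ψ
  simp (disch := fun_prop) only [tensorFun_eq_sw, sw_map]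
  have e₁ := congrArg φ (hp' _ (h₁ (ψ ∘ₗ E.subtype ∘ₗ q)))
  have e₂ := congrArg ψ (hq' _ (h₂ φ))
  have e₃ := linearMap_sw (D.subtype ∘ₗ p) t fun a b => (ψ ∘ₗ E.subtype ∘ₗ q) b • a
  have e₄ := linearMap_sw (E.subtype ∘ₗ q) t fun a b => φ a • b
  simp only [LinearMap.comp_apply, Submodule.subtype_apply] at e₁ e₂ e₃ e₄ ⊢
  rw [e₃] at e₁
  rw [e₄] at e₂
  simp only [linearMap_sw, map_smul, smul_eq_mul, SetLike.val_smul] at e₁ e₂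
  rw [← e₂]
  simp only [mul_comm (φ _)]
  exact e₁

end Wedge

/-! ### Geometric series in the convolution monoid -/

section Convolution

variable {K : Type*} [Field K] {C : Type*} [AddCommGroup C] [Module K C]
  {Δ : C →ₗ[K] C ⊗[K] C} {ε : C →ₗ[K] K}

/-- The convolution powers of a functional. -/
def convPow (Δ : C →ₗ[K] C ⊗[K] C) (ε g : C →ₗ[K] K) : ℕ → (C →ₗ[K] K)
  | 0 => ε
  | n + 1 => conv Δ (convPow Δ ε g n) g

theorem convPow_succ' (h : IsCoalg Δ ε) (g : C →ₗ[K] K) (n : ℕ) :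
    convPow Δ ε g (n + 1) = conv Δ g (convPow Δ ε g n) := by
  induction n with
  | zero => exact (h.one_conv g).trans (h.conv_one g).symm
  | succ n ih =>
    change conv Δ (convPow Δ ε g (n + 1)) g = conv Δ g (conv Δ (convPow Δ ε g n) g)
    rw [ih, h.conv_assoc]

theorem conv_add_left (Δ : C →ₗ[K] C ⊗[K] C) (f g k : C →ₗ[K] K) :
    conv Δ (f + g) k = conv Δ f k + conv Δ g k := by
  simp [conv, tensorFun, TensorProduct.map_add_left, LinearMap.comp_add, LinearMap.add_comp]

theorem conv_add_right (Δ : C →ₗ[K] C ⊗[K] C) (f g k : C →ₗ[K] K) :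
    conv Δ f (g + k) = conv Δ f g + conv Δ f k := by
  simp [conv, tensorFun, TensorProduct.map_add_right, LinearMap.comp_add, LinearMap.add_comp]

/-- The inverse is the geometric series `∑ g^{*k}`, finite at each point. Its partial sums satisfy
`(ε - g) * S n = S n * (ε - g) = ε - g^{*n}`. -/
theorem isConvInvertible_of_locally_nilpotent (h : IsCoalg Δ ε) {g : C →ₗ[K] K}
    (hg : ∀ x, ∃ n, ∀ k ≥ n, convPow Δ ε g k x = 0) : IsConvInvertible Δ ε (ε - g) := by
  have hfin : ∀ x, (Function.support fun k => convPow Δ ε g k x).Finite := fun x => by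
    obtain ⟨n, hn⟩ := hg x
    refine (Set.finite_lt_nat n).subset fun k hk => ?_
    by_contra hk'
    exact hk (hn k (not_lt.1 hk'))
  -- Local nilpotence makes every support finite, so the default value of `finsum` never intervenes.
  let F : C →ₗ[K] K :=
    { toFun := fun x => ∑ᶠ k, convPow Δ ε g k x
      map_add' := fun x y => by
        simp only [map_add]
        exact finsum_add_distrib (hfin x) (hfin y)
      map_smul' := fun c x => by
        simp only [map_smul, RingHom.id_apply]
        exact (smul_finsum _ _).symm }
  let S : ℕ → C →ₗ[K] K := fun n => ∑ k ∈ Finset.range n, convPow Δ ε g k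
  have hS : ∀ x n, (∀ k ≥ n, convPow Δ ε g k x = 0) → F x = S n x := fun x n hn => by
    refine (finsum_eq_sum_of_support_subset _ fun k hk => ?_).trans (LinearMap.sum_apply _ _ _).symm
    by_contra hk'
    exact hk (hn k (by simpa using hk'))
  have hF : ∀ x, ∃ n₀, ∀ n ≥ n₀, F x = S n x := fun x => by
    obtain ⟨n, hn⟩ := hg x
    exact ⟨n, fun k hk => hS x k fun j hj => hn j (hk.trans hj)⟩
  have hl : ∀ n, conv Δ (ε - g) (S n) = ε - convPow Δ ε g n := fun n => by
    induction n with
    | zero =>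
      have h₀ := conv_add_right Δ (ε - g) 0 0
      rw [add_zero, left_eq_add] at h₀
      simpa [S, convPow] using h₀
    | succ n ih =>
      have h₀ := conv_add_left Δ (ε - g) g (convPow Δ ε g n)
      rw [sub_add_cancel, h.one_conv, ← convPow_succ' h] at h₀
      have h₁ := conv_add_right Δ (ε - g) (S n) (convPow Δ ε g n)
      rw [ih, eq_sub_iff_add_eq.2 h₀.symm] at h₁
      simp only [S, Finset.sum_range_succ] at h₁ ⊢
      rw [h₁]
      abel
  have hr : ∀ n, conv Δ (S n) (ε - g) = ε - convPow Δ ε g n := fun n => by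
    induction n with
    | zero =>
      have h₀ := conv_add_left Δ 0 0 (ε - g)
      rw [add_zero, left_eq_add] at h₀
      simpa [S, convPow] using h₀
    | succ n ih =>
      have h₀ := conv_add_right Δ (convPow Δ ε g n) (ε - g) g
      rw [sub_add_cancel, h.conv_one] at h₀
      have h₁ := conv_add_left Δ (S n) (convPow Δ ε g n) (ε - g)
      rw [ih, eq_sub_iff_add_eq.2 h₀.symm] at h₁
      simp only [S, Finset.sum_range_succ] at h₁ ⊢
      rw [h₁, convPow]
      abel
  refine ⟨F, LinearMap.ext fun x => ?_, LinearMap.ext fun x => ?_⟩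
  · have key : ∀ t : C ⊗[K] C, ∃ n₀, ∀ n ≥ n₀,
        tensorFun (ε - g) F t = tensorFun (ε - g) (S n) t := fun t => by
      induction t using TensorProduct.induction_on with
      | zero => exact ⟨0, by simp⟩
      | tmul a b =>
        obtain ⟨n₀, h₀⟩ := hF b
        exact ⟨n₀, fun n hn => by rw [tensorFun_tmul, tensorFun_tmul, h₀ n hn]⟩
      | add t t' ht ht' =>
        obtain ⟨n₀, h₀⟩ := ht
        obtain ⟨n₁, h₁⟩ := ht'
        exact ⟨max n₀ n₁, fun n hn => by
          rw [map_add, map_add, h₀ n (le_of_max_le_left hn), h₁ n (le_of_max_le_right hn)]⟩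
    obtain ⟨n₀, h₀⟩ := key (Δ x)
    obtain ⟨n₁, h₁⟩ := hg x
    refine (h₀ (max n₀ n₁) (le_max_left _ _)).trans ?_
    refine (LinearMap.congr_fun (hl _) x).trans ?_
    rw [LinearMap.sub_apply, h₁ _ (le_max_right _ _), sub_zero]
  · have key : ∀ t : C ⊗[K] C, ∃ n₀, ∀ n ≥ n₀,
        tensorFun F (ε - g) t = tensorFun (S n) (ε - g) t := fun t => by
      induction t using TensorProduct.induction_on with
      | zero => exact ⟨0, by simp⟩
      | tmul a b =>
        obtain ⟨n₀, h₀⟩ := hF a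
        exact ⟨n₀, fun n hn => by rw [tensorFun_tmul, tensorFun_tmul, h₀ n hn]⟩
      | add t t' ht ht' =>
        obtain ⟨n₀, h₀⟩ := ht
        obtain ⟨n₁, h₁⟩ := ht'
        exact ⟨max n₀ n₁, fun n hn => by
          rw [map_add, map_add, h₀ n (le_of_max_le_left hn), h₁ n (le_of_max_le_right hn)]⟩
    obtain ⟨n₀, h₀⟩ := key (Δ x)
    obtain ⟨n₁, h₁⟩ := hg x
    refine (h₀ (max n₀ n₁) (le_max_left _ _)).trans ?_
    refine (LinearMap.congr_fun (hr _) x).trans ?_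
    rw [LinearMap.sub_apply, h₁ _ (le_max_right _ _), sub_zero]

end Convolution

/-! ### The dual algebra and exhaustion by the wedge filtration -/

section Connected

variable {K : Type*} [Field K] {C : Type*} [AddCommGroup C] [Module K C]
  {Δ : C →ₗ[K] C ⊗[K] C} {ε : C →ₗ[K] K} {e : C}

/-- `x ↦ x₁ φ(x₂)`. -/
def rightHit (Δ : C →ₗ[K] C ⊗[K] C) (φ : C →ₗ[K] K) : C →ₗ[K] C :=
  convRight Δ LinearMap.id φ

theorem rightHit_apply (Δ : C →ₗ[K] C ⊗[K] C) (φ : C →ₗ[K] K) (x : C) :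
    rightHit Δ φ x = sw (Δ x) fun a b => φ b • a :=
  convRight_apply _ _ _ _

/-- The endomorphisms `T` with `Δ(T x) = x₁ ⊗ T x₂`. -/
def coEnd (Δ : C →ₗ[K] C ⊗[K] C) : Subalgebra K (Module.End K C) where
  carrier := {T | Δ ∘ₗ T = LinearMap.lTensor C T ∘ₗ Δ}
  mul_mem' {S T} hS hT := by
    have hS' : Δ ∘ₗ S = LinearMap.lTensor C S ∘ₗ Δ := hS
    have hT' : Δ ∘ₗ T = LinearMap.lTensor C T ∘ₗ Δ := hT
    change Δ ∘ₗ (S ∘ₗ T) = LinearMap.lTensor C (S ∘ₗ T) ∘ₗ Δ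
    rw [← LinearMap.comp_assoc, hS', LinearMap.comp_assoc, hT', ← LinearMap.comp_assoc,
      LinearMap.lTensor_comp]
  add_mem' {S T} hS hT := by
    have hS' : Δ ∘ₗ S = LinearMap.lTensor C S ∘ₗ Δ := hS
    have hT' : Δ ∘ₗ T = LinearMap.lTensor C T ∘ₗ Δ := hT
    change Δ ∘ₗ (S + T) = LinearMap.lTensor C (S + T) ∘ₗ Δ
    rw [LinearMap.comp_add, hS', hT', LinearMap.lTensor_add, LinearMap.add_comp]
  algebraMap_mem' k := by
    change Δ ∘ₗ (k • LinearMap.id) = LinearMap.lTensor C (k • LinearMap.id) ∘ₗ Δ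
    rw [LinearMap.lTensor_smul, LinearMap.lTensor_id, LinearMap.comp_smul, LinearMap.smul_comp]
    rfl

theorem rightHit_mem (hC : IsCoalg Δ ε) (φ : C →ₗ[K] K) : rightHit Δ φ ∈ coEnd Δ := by
  change Δ ∘ₗ rightHit Δ φ = LinearMap.lTensor C (rightHit Δ φ) ∘ₗ Δ
  ext x
  rw [LinearMap.comp_apply, LinearMap.comp_apply, rightHit_apply, linearMap_sw]
  conv_rhs => rw [← sw_eta (Δ x), linearMap_sw]
  simp only [LinearMap.lTensor_tmul, rightHit_apply, tmul_sw]
  rw [← hC.sw_coassoc x (by fun_prop) (by fun_prop) (by fun_prop)]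
  refine sw_congr fun a b => ?_
  simp only [TensorProduct.tmul_smul, ← smul_sw, sw_eta, map_smul]

/-- Each `T` is `x ↦ x₁ φ(x₂)` with `φ = ε ∘ T`. Thus `coEnd Δ` is the dual algebra of `C` in
disguise, with composition as convolution, and ring-theoretic results apply to it. -/
theorem coEnd_apply (hC : IsCoalg Δ ε) (T : coEnd Δ) (x : C) :
    T.1 x = sw (Δ x) fun a b => ε (T.1 b) • a := by
  have hT : Δ (T.1 x) = LinearMap.lTensor C T.1 (Δ x) := LinearMap.congr_fun T.2 x
  rw [← hC.sw_counit_right (T.1 x) (F := fun a => a) (by fun_prop), hT,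
    sw_lTensor _ _ (by fun_prop) (by fun_prop)]

theorem counit_rightHit (hC : IsCoalg Δ ε) (φ : C →ₗ[K] K) (x : C) :
    ε (rightHit Δ φ x) = φ x := by
  rw [rightHit_apply, linearMap_sw]
  simp only [map_smul, smul_eq_mul, mul_comm (φ _)]
  exact hC.sw_counit_left x (F := fun b => φ b) (by fun_prop)

/-- A group-like element spans a line stable under the dual algebra, so its annihilator is a
two-sided ideal. -/
theorem coEnd_groupLike (hC : IsCoalg Δ ε) (he : Δ e = e ⊗ₜ e) (T : coEnd Δ) :
    T.1 e = ε (T.1 e) • e := by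
  conv_lhs => rw [coEnd_apply hC, he, sw_tmul _ _ (by fun_prop) (by fun_prop)]

theorem sw_mem {M N P : Type*} [AddCommGroup M] [Module K M] [AddCommGroup N] [Module K N]
    [AddCommGroup P] [Module K P] (t : M ⊗[K] N) {f : M → N → P} {W : Submodule K P}
    (h : ∀ p ∈ repr t, f p.1 p.2 ∈ W) : sw t f ∈ W := by
  refine multiset_sum_mem _ fun x hx => ?_
  obtain ⟨p, hp, rfl⟩ := Multiset.mem_map.1 hx
  exact h p hp

/-- A nonzero finite dimensional subcoalgebra contains a simple subcoalgebra. -/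
theorem exists_simple_le {D : Submodule K C} [FiniteDimensional K D] (hD : IsSubcoalgebra Δ D)
    (h0 : D ≠ ⊥) : ∃ D' ≤ D, IsSimpleSubcoalgebra Δ D' := by
  generalize hn : Module.finrank K D = n
  induction n using Nat.strong_induction_on generalizing D with
  | _ n ih =>
    by_cases hs : IsSimpleSubcoalgebra Δ D
    · exact ⟨D, le_rfl, hs⟩
    · simp only [IsSimpleSubcoalgebra, not_and, not_forall] at hs
      obtain ⟨D', hle, hD', hne⟩ := hs hD h0
      rw [not_or] at hne
      have : FiniteDimensional K D' := Submodule.finiteDimensional_of_le hle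
      obtain ⟨D'', h₁, h₂⟩ := ih _ (hn ▸ Submodule.finrank_lt_finrank_of_lt
        (lt_of_le_of_ne hle hne.2)) hD' hne.1 rfl
      exact ⟨D'', h₁.trans hle, h₂⟩

/-- The coradical filtration of a connected coalgebra. -/
def wedgePow (Δ : C →ₗ[K] C ⊗[K] C) (e : C) : ℕ → Submodule K C
  -- The index is shifted by one: for a counital coalgebra and a group-like `e`, stage `1` is
  -- already the line through `e`.
  | 0 => ⊥
  | n + 1 => ⨅ φ : {φ : C →ₗ[K] K // φ e = 0}, (wedgePow Δ e n).comap (rightHit Δ φ)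

theorem mem_wedgePow_succ {n : ℕ} {x : C} : x ∈ wedgePow Δ e (n + 1) ↔
    ∀ φ : C →ₗ[K] K, φ e = 0 → rightHit Δ φ x ∈ wedgePow Δ e n := by
  simp [wedgePow]

theorem wedgePow_mono : Monotone (wedgePow Δ e) := by
  refine monotone_nat_of_le_succ fun n => ?_
  induction n with
  | zero => exact bot_le
  | succ n ih => exact fun x hx => mem_wedgePow_succ.2 fun φ hφ => ih (mem_wedgePow_succ.1 hx φ hφ)

/-- A proper cofinite two-sided ideal of `coEnd Δ` annihilates the group-like element. -/
theorem apply_groupLike_eq_zero (hC : IsCoalg Δ ε) (he : Δ e = e ⊗ₜ e)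
    (hconn : coradical Δ = Submodule.span K {e}) (V : Submodule K C) [FiniteDimensional K V]
    (I : Ideal (coEnd Δ)) [I.IsTwoSided] (hI : (1 : coEnd Δ) ∉ I)
    (hV : ∀ T : coEnd Δ, (∀ x ∈ V, T.1 x = 0) → T ∈ I) {T : coEnd Δ} (hT : T ∈ I) :
    T.1 e = 0 := by
  let b := Module.finBasis K V
  let hit : (C →ₗ[K] K) → coEnd Δ := fun φ => ⟨rightHit Δ φ, rightHit_mem hC φ⟩
  have hV' : ∀ T : coEnd Δ, (∀ i, T.1 (b i) = 0) → T ∈ I := fun T h => hV T fun x hx => by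
    have : T.1 ∘ₗ V.subtype = 0 := b.ext fun i => h i
    exact LinearMap.congr_fun this ⟨x, hx⟩
  -- The orthogonal complement of `I` under the pairing `(T, d) ↦ ε (T d)`; two-sidedness of `I`
  -- makes it a subcoalgebra.
  let D : Submodule K C :=
    { carrier := {d | ∀ T ∈ I, ε (T.1 d) = 0}
      add_mem' := fun {x y} hx hy T hT => by rw [map_add, map_add, hx T hT, hy T hT, add_zero]
      zero_mem' := fun T _ => by rw [map_zero, map_zero]
      smul_mem' := fun k x hx T hT => by rw [map_smul, map_smul, hx T hT, smul_zero] }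
  have hDsub : IsSubcoalgebra Δ D := fun x hx => mem_range_map_subtype
    (fun ψ S hS => by
      have := hx (S * hit ψ) (I.mul_mem_right _ hS)
      rwa [← rightHit_apply])
    (fun φ S hS => by
      have := hx (hit φ * S) (I.mul_mem_left _ hS)
      rw [linearMap_sw, linearMap_sw]
      change ε (rightHit Δ φ (S.1 x)) = 0 at this
      rw [counit_rightHit hC, coEnd_apply hC, linearMap_sw] at this
      simpa only [map_smul, smul_eq_mul, mul_comm] using this)
  -- `D` lies in the span of the right tensor factors of `Δ(b i)`: a functional killing that span
  -- yields an operator that vanishes on `V`, hence lies in `I`, so the functional kills `D`.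
  have hDfin : FiniteDimensional K D := by
    let s : Set C := ⋃ i, {z | ∃ p ∈ repr (Δ (b i)), p.2 = z}
    have hs : s.Finite := Set.finite_iUnion fun i => by
      classical
      exact ((repr (Δ (b i))).toFinset.finite_toSet.image Prod.snd).subset
        (by rintro _ ⟨p, hp, rfl⟩; exact ⟨p, by simpa using hp, rfl⟩)
    have : FiniteDimensional K (Submodule.span K s) := FiniteDimensional.span_of_finite K hs
    refine Submodule.finiteDimensional_of_le (S₂ := Submodule.span K s) fun d hd => ?_
    by_contra hds
    obtain ⟨φ, hφd, hφ⟩ := Submodule.exists_le_ker_of_notMem hds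
    refine hφd ?_
    rw [← counit_rightHit hC]
    refine hd (hit φ) (hV' _ fun i => ?_)
    change rightHit Δ φ (b i) = 0
    rw [rightHit_apply, ← Submodule.mem_bot K]
    refine sw_mem _ fun p hp => ?_
    have : φ p.2 = 0 := hφ (Submodule.subset_span (Set.mem_iUnion.2 ⟨i, p, hp, rfl⟩))
    rw [this, zero_smul]
    exact zero_mem _
  -- Evaluation on the basis of `V` separates `1` from `I`, since an element of `I` agreeing with
  -- `1` on `V` would force `1 ∈ I`.
  have hD0 : D ≠ ⊥ := by
    let Θ : coEnd Δ →ₗ[K] (Fin (Module.finrank K V) → C) :=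
      LinearMap.pi fun i => LinearMap.applyₗ (b i : C) ∘ₗ (coEnd Δ).val.toLinearMap
    have h1 : Θ 1 ∉ (I.restrictScalars K).map Θ := by
      rintro ⟨S, hS, hS1⟩
      refine hI ?_
      have := hV' (1 - S) fun i => by
        have := congrFun hS1 i
        change (b i : C) - S.1 (b i) = 0
        rw [sub_eq_zero]
        exact this.symm
      simpa using I.add_mem this hS
    obtain ⟨Ψ, hΨ1, hΨ⟩ := Submodule.exists_le_ker_of_notMem h1
    let Ψ' : Fin (Module.finrank K V) → C →ₗ[K] K := fun i =>
      Ψ ∘ₗ LinearMap.single K (fun _ => C) i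
    -- The vector representing the separating functional, in the sense that `ε (S d) = Ψ (Θ S)`. It
    -- is orthogonal to `I` but not to `1`.
    let d : C := ∑ i, sw (Δ (b i)) fun a z => Ψ' i a • z
    have hd : ∀ S : coEnd Δ, ε (S.1 d) = Ψ (Θ S) := fun S => by
      have hΘ : Ψ (Θ S) = ∑ i, Ψ' i (S.1 (b i)) := by
        conv_lhs => rw [← Finset.univ_sum_single (Θ S), map_sum]
        rfl
      rw [hΘ, map_sum, map_sum]
      refine Finset.sum_congr rfl fun i _ => ?_
      rw [coEnd_apply hC S (b i), linearMap_sw, linearMap_sw, linearMap_sw]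
      simp only [map_smul, smul_eq_mul, mul_comm]
    intro hbot
    have : d ∈ D := fun S hS => by
      rw [hd]
      exact hΨ ⟨S, hS, rfl⟩
    rw [hbot, Submodule.mem_bot] at this
    refine hΨ1 ?_
    rw [← hd, this, map_zero, map_zero]
  -- Connectedness puts every simple subcoalgebra in the line of `e`, so `D` contains `e`.
  obtain ⟨D', hle, hD'⟩ := exists_simple_le hDsub hD0
  have hspan : D' ≤ Submodule.span K {e} := hconn ▸ le_sSup hD'
  have heD : e ∈ D := by
    obtain ⟨y, hy, hy0⟩ := (Submodule.ne_bot_iff _).1 hD'.2.1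
    obtain ⟨k, rfl⟩ := Submodule.mem_span_singleton.1 (hspan hy)
    have hk : k ≠ 0 := fun h => hy0 (by rw [h, zero_smul])
    have := D'.smul_mem k⁻¹ hy
    rw [smul_smul, inv_mul_cancel₀ hk, one_smul] at this
    exact hle this
  rw [coEnd_groupLike hC he, heD T hT, zero_smul]

/-- A connected coalgebra is the union of its coradical filtration. -/
theorem exists_mem_wedgePow (hC : IsCoalg Δ ε) (he : Δ e = e ⊗ₜ e) (he' : ε e = 1)
    (hconn : coradical Δ = Submodule.span K {e}) (c : C) : ∃ n, c ∈ wedgePow Δ e n := by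
  by_cases hc : c = 0
  · exact ⟨0, hc ▸ zero_mem _⟩
  -- The cyclic module generated by `c`. It is finite dimensional because it lies in the span of the
  -- left tensor factors of `Δ c`.
  let V : Submodule K C :=
    LinearMap.range (LinearMap.applyₗ c ∘ₗ (coEnd Δ).val.toLinearMap)
  have hcV : c ∈ V := ⟨1, rfl⟩
  have hVfin : FiniteDimensional K V := by
    let s : Set C := {z | ∃ p ∈ repr (Δ c), p.1 = z}
    have hs : s.Finite := by
      classical
      exact ((repr (Δ c)).toFinset.finite_toSet.image Prod.fst).subset
        (by rintro _ ⟨p, hp, rfl⟩; exact ⟨p, by simpa using hp, rfl⟩)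
    have : FiniteDimensional K (Submodule.span K s) := FiniteDimensional.span_of_finite K hs
    refine Submodule.finiteDimensional_of_le (S₂ := Submodule.span K s) ?_
    rintro _ ⟨T, rfl⟩
    change T.1 c ∈ _
    rw [coEnd_apply hC]
    exact sw_mem _ fun p hp => Submodule.smul_mem _ _ (Submodule.subset_span ⟨p, hp, rfl⟩)
  have hstab : ∀ T : coEnd Δ, ∀ x ∈ V, T.1 x ∈ V := by
    rintro T _ ⟨S, rfl⟩
    exact ⟨T * S, rfl⟩
  let ρ : coEnd Δ →ₐ[K] Module.End K V :=
    AlgHom.ofLinearMap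
      { toFun := fun T => T.1.restrict (hstab T)
        map_add' := fun S T => rfl
        map_smul' := fun k T => rfl } rfl (fun S T => rfl)
  have hρ : ∀ (T : coEnd Δ) (x : V), (ρ T x : C) = T.1 x := fun T x => rfl
  let A := ρ.range
  have : IsArtinianRing A := IsArtinianRing.of_finite K A
  let ρ' : coEnd Δ →+* A := ρ.rangeRestrict.toRingHom
  have hs : Function.Surjective ρ' := ρ.rangeRestrict_surjective
  have : RingHomSurjective ρ' := ⟨hs⟩
  have hnt : (1 : A) ≠ 0 := fun h => hc (by
    have : ((1 : A).1 ⟨c, hcV⟩ : C) = ((0 : A).1 ⟨c, hcV⟩ : C) := by rw [h]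
    exact this)
  -- A proper ideal of the finite dimensional quotient pulls back to a proper ideal containing the
  -- annihilator of `V`, to which `apply_groupLike_eq_zero` applies.
  have hker : ∀ (I : Ideal A) [I.IsTwoSided], I ≠ ⊤ → ∀ T : coEnd Δ, ρ' T ∈ I → T.1 e = 0 := by
    intro I _ hI T hT
    refine apply_groupLike_eq_zero hC he hconn V (I.comap ρ') ?_ (fun S hS => ?_) hT
    · rw [Ideal.mem_comap, map_one]
      exact fun h => hI ((Ideal.eq_top_iff_one _).2 h)
    · have : ρ' S = 0 := Subtype.ext (LinearMap.ext fun x => Subtype.ext (hS x x.2))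
      rw [Ideal.mem_comap, this]
      exact I.zero_mem
  -- The annihilator of `e`. By `hker` its image in `A` contains every proper two-sided ideal.
  let J : Ideal (coEnd Δ) :=
    { carrier := {T | T.1 e = 0}
      add_mem' := fun {S T} hS hT => by
        change S.1 e + T.1 e = 0
        rw [show S.1 e = 0 from hS, show T.1 e = 0 from hT, add_zero]
      zero_mem' := rfl
      smul_mem' := fun S T hT => by
        change S.1 (T.1 e) = 0
        rw [show T.1 e = 0 from hT, map_zero] }
  have : J.IsTwoSided := ⟨fun {T} S hT => by
    change T.1 (S.1 e) = 0
    rw [coEnd_groupLike hC he, map_smul, show T.1 e = 0 from hT, smul_zero]⟩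
  -- If some `T ∈ J` acted on `V` as `1`, then `1 - T` would annihilate `V`, hence also `e`, and `e
  -- = T e = 0` would contradict `ε e = 1`.
  have hJ : J.map ρ' ≠ ⊤ := fun h => by
    obtain ⟨T, hT, hT1⟩ := (Ideal.mem_map_iff_of_surjective ρ' hs).1
      (h ▸ Submodule.mem_top : (1 : A) ∈ J.map ρ')
    have h0 := hker ⊥ (fun hbt => hnt (by
      rw [← Ideal.mem_bot, hbt]; exact Submodule.mem_top)) (1 - T) (by
        rw [map_sub, map_one, hT1, sub_self]; exact zero_mem _)
    have h1 : e - T.1 e = 0 := h0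
    rw [show T.1 e = 0 from hT, sub_zero] at h1
    rw [h1, map_zero] at he'
    exact zero_ne_one he'
  obtain ⟨n, hn⟩ := isNilpotent_of_greatest_ideal (J.map ρ') hJ fun I hI hne x hx => by
    obtain ⟨T, rfl⟩ := hs x
    exact Ideal.mem_map_of_mem _ (hker I hne T hx)
  -- For `φ e = 0` the operator `rightHit Δ φ` lies in `J`, so each stage of the wedge filtration
  -- uses up one power of `J`. Nilpotence then places `c` in a finite stage.
  have key : ∀ (k : ℕ) (x : V), (∀ a ∈ (J.map ρ') ^ k, a.1 x = 0) →
      (x : C) ∈ wedgePow Δ e k := by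
    intro k
    induction k with
    | zero =>
      intro x hx
      have h1 : (1 : A).1 x = 0 := hx 1 (by
        rw [Submodule.pow_zero, Ideal.one_eq_top]; exact Submodule.mem_top)
      have : x = 0 := h1
      rw [this]
      exact zero_mem _
    | succ k ih =>
      intro x hx
      refine mem_wedgePow_succ.2 fun φ hφ => ?_
      let T : coEnd Δ := ⟨rightHit Δ φ, rightHit_mem hC φ⟩
      have hT : T ∈ J := by
        change rightHit Δ φ e = 0
        rw [rightHit_apply, he, sw_tmul _ _ (by fun_prop) (by fun_prop), hφ, zero_smul]
      refine ih (ρ T x) fun a ha => ?_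
      refine hx (a * ρ' T) ?_
      rw [Submodule.pow_succ]
      exact Ideal.mul_mem_mul ha (Ideal.mem_map_of_mem _ hT)
  refine ⟨n, key n ⟨c, hcV⟩ fun a ha => ?_⟩
  rw [hn] at ha
  rw [show a = 0 from ha]
  rfl

end Connected

/-! ### Coproducts along the wedge filtration -/

section Connected

variable {K : Type*} [Field K] {C : Type*} [AddCommGroup C] [Module K C]
  {Δ : C →ₗ[K] C ⊗[K] C} {ε : C →ₗ[K] K} {e : C}

/-- For `r` in stage `n + 1`, `Δ r` lies in `W_n ⊗ C + C ⊗ K e`, and `F` vanishes on both summands.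
-/
theorem sw_comul_eq_zero_of_mem_wedgePow {M : Type*} [AddCommGroup M] [Module K M]
    (he : ε e = 1) {n : ℕ} {r : C} (hr : r ∈ wedgePow Δ e (n + 1)) {F : C → C → M}
    (h₁ : ∀ b, Lin K (fun a => F a b)) (h₂ : ∀ a, Lin K (F a)) (hF : ∀ a, F a e = 0)
    (hF' : ∀ a ∈ wedgePow Δ e n, ∀ b, F a b = 0) : sw (Δ r) F = 0 := by
  -- The projection that kills `e`. It leaves `F` unchanged in its second argument, and it moves `Δ
  -- r` into `W_n ⊗ C`.
  set p : C →ₗ[K] C := LinearMap.id - ε.smulRight e with hp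
  have hpe : p e = 0 := by simp [hp, he]
  have hFp : ∀ a b, F a (p b) = F a b := fun a b => by
    have h := (h₂ a).add (p b) (ε b • e)
    rw [(h₂ a).smul, hF, smul_zero, add_zero] at h
    rw [← h]
    simp [hp]
  have hmem : LinearMap.lTensor C p (Δ r) ∈ LinearMap.range
      (TensorProduct.map (wedgePow Δ e n).subtype (⊤ : Submodule K C).subtype) := by
    refine mem_range_map_subtype (fun ψ => ?_) fun _ => Submodule.mem_top
    rw [sw_lTensor _ _ (by fun_prop) (by fun_prop)]
    have := mem_wedgePow_succ.1 hr (ψ ∘ₗ p) (by simp [hpe])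
    rwa [rightHit_apply] at this
  have hsw : sw (Δ r) F = sw (LinearMap.lTensor C p (Δ r)) F := by
    rw [sw_lTensor _ _ h₁ h₂]
    exact sw_congr fun a b => (hFp a b).symm
  obtain ⟨t, ht⟩ := hmem
  rw [hsw, ← ht, sw_map _ _ _ h₁ h₂]
  refine (sw_congr (g := fun _ _ => (0 : M)) fun a b => ?_).trans (by simp [sw])
  exact hF' _ a.2 _

end Connected

/-! ### Convolution invertibility of the integral of the cocycle -/

section Integral

variable {K : Type*} [Field K] {H : Type*} [Ring H] [HopfAlgebra K H]
  {R : Type*} [AddCommGroup R] [Module K R] {X : YDCoalgebraData K H R}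
  {m : R ⊗[K] R →ₗ[K] R} {u : K →ₗ[K] R}

/-- Each further factor `g` lowers the filtration degree of the first argument by one. The braiding
does no harm, because `e = u 1` is coinvariant and the coaction only affects the second argument of
the inductive factor. No filtration on the second tensor factor is required. -/
theorem convPow_tmul_eq_zero (hR : IsPreBialgebra X m u) {g : R ⊗[K] R →ₗ[K] K}
    (hg : ∀ s, g (u 1 ⊗ₜ s) = 0) (n : ℕ) :
    ∀ r ∈ wedgePow X.comul (u 1) n, ∀ s,
      convPow (tensorSq X).comul (tensorSq X).counit g n (r ⊗ₜ s) = 0 := by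
  induction n with
  | zero =>
    intro r hr s
    have : r = 0 := by simpa [wedgePow] using hr
    simp [this]
  | succ n ih =>
    intro r hr s
    change conv _ (convPow _ _ g n) g _ = 0
    rw [conv_apply, sw_sq_comul X r s (by fun_prop) (by fun_prop)]
    refine sw_comul_eq_zero_of_mem_wedgePow (counit_unit hR) hr (by fun_prop) (by fun_prop)
      (fun a => ?_) fun a ha b => ?_
    · refine (sw_congr (g := fun _ _ => (0 : K)) fun s₁ s₂ => ?_).trans (by simp [sw])
      rw [coact_unit hR, sw_tmul _ _ (by fun_prop) (by fun_prop), hg, mul_zero]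
    · refine (sw_congr (g := fun _ _ => (0 : K)) fun s₁ s₂ => ?_).trans (by simp [sw])
      refine (sw_congr (g := fun _ _ => (0 : K)) fun k b₀ => ?_).trans (by simp [sw])
      rw [ih a ha, zero_mul]

/-- A form on `R ⊗ R` that agrees with the counit on `1 ⊗ R` is convolution invertible when `R` is
connected. -/
theorem isConvInvertible_of_map_one_tmul (hR : IsPreBialgebra X m u)
    (hconn : IsConnectedCoalgebra X.comul u) {f : R ⊗[K] R →ₗ[K] K}
    (hf : ∀ s, f (u 1 ⊗ₜ s) = X.counit s) :
    IsConvInvertible (tensorSq X).comul (tensorSq X).counit f := by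
  have hg : ∀ s, ((tensorSq X).counit - f) (u 1 ⊗ₜ s) = 0 := fun s => by
    have : (tensorSq X).counit (u 1 ⊗ₜ s) = X.counit (u 1) * X.counit s := tensorFun_tmul _ _ _ _
    rw [LinearMap.sub_apply, this, hf, counit_unit hR, one_mul, sub_self]
  rw [← sub_sub_cancel (tensorSq X).counit f]
  refine isConvInvertible_of_locally_nilpotent (isModuleCoalg_sq hR.coalgebra).coalg fun z => ?_
  induction z using TensorProduct.induction_on with
  | zero => exact ⟨0, fun k _ => map_zero _⟩
  | tmul r s =>
    obtain ⟨n, hn⟩ := exists_mem_wedgePow hR.coalgebra.isModuleCoalg.coalg (comul_unit hR)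
      (counit_unit hR) hconn r
    exact ⟨n, fun k hk => convPow_tmul_eq_zero hR hg k r (wedgePow_mono hk hn) s⟩
  | add x y hx hy =>
    obtain ⟨a, ha⟩ := hx
    obtain ⟨b, hb⟩ := hy
    refine ⟨max a b, fun k hk => ?_⟩
    rw [map_add, ha k (le_trans (le_max_left _ _) hk), hb k (le_trans (le_max_right _ _) hk),
      add_zero]

theorem isConvInvertible_integral_comp {l : H →ₗ[K] K} (hl : IsAdInvariantIntegral l)
    (hR : IsPreBialgebra X m u) (hconn : IsConnectedCoalgebra X.comul u)
    {ξ : R ⊗[K] R →ₗ[K] H} (hξ : IsCocycle X m u ξ) :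
    IsConvInvertible (tensorSq X).comul (tensorSq X).counit (l ∘ₗ ξ) :=
  isConvInvertible_of_map_one_tmul hR hconn fun s => by
    rw [LinearMap.comp_apply, hξ.map_one_tmul, Algebra.algebraMap_eq_smul_one, map_smul, hl.map_one,
      smul_eq_mul, mul_one]

end Integral

end

end YD

open scoped TensorProduct in
theorem mainTheorem5 {K : Type*} [Field K] [CharZero K] {H : Type*} [Ring H] [HopfAlgebra K H]
    (l : H →ₗ[K] K) (hl : YD.IsAdInvariantIntegral l)
    {R : Type*} [AddCommGroup R] [Module K R] (X : YD.YDCoalgebraData K H R)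
    (m : R ⊗[K] R →ₗ[K] R) (u : K →ₗ[K] R) (ξ : R ⊗[K] R →ₗ[K] H)
    (hR : YD.IsPreBialgebra X m u) (hconn : YD.IsConnectedCoalgebra X.comul u)
    (hξ : YD.IsCocycle X m u ξ) :
    YD.IsConvInvertible (YD.tensorSq X).comul (YD.tensorSq X).counit (l ∘ₗ ξ) ∧
    ∀ v : R ⊗[K] R →ₗ[K] K, YD.IsConvInverse (YD.tensorSq X).comul (YD.tensorSq X).counit (l ∘ₗ ξ) v →
      YD.IsConvInvertible (YD.usualComul (YD.smashComul X) (YD.smashComul X))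
        (YD.tensorFun (YD.smashCounit X) (YD.smashCounit X)) (YD.mho₂ X v) ∧
      YD.IsDualQuasiBialgebra X (YD.twist X m v) u (YD.coboundaryR₂ X m ξ v) ∧
      YD.IsConnectedCoalgebra X.comul u := by
  refine ⟨YD.isConvInvertible_integral_comp hl hR hconn hξ,
    fun v hv => ⟨?_, YD.isDualQuasiBialgebra_twist hl hR hξ hv, hconn⟩⟩
  rw [YD.mho₂_eq]
  -- The inverse of `v_A` is `λξ` pulled back along `P₂`.
  exact ⟨_, YD.isConvInverse_smashProj₂ hR.coalgebra hv⟩
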